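/- Let $m\ge 2$ and equip $\mathbb C^m=\mathbb C^{m-1}\times\mathbb C$ with the Euclidean metric, the complex structure $J$, the Kähler form $\omega_0=\sum dx_j\wedge dy_j$, the holomorphic volume form $\Omega_0=dz_1\wedge\dots\wedge dz_m$ and the Liouville form $\lambda=\frac1{2i}\sum_j(\bar z_jdz_j-z_jd\bar z_j)$; let $e_m=(0,\dots,0,1)$. The Lagrangian angle $\theta$ of a Lagrangian plane is defined modulo $\pi$ by $\Omega_0(e_1,\dots,e_m)=\pm e^{i\theta}$ for an orthonormal basis $e_1,\dots,e_m$ of it. A $G$-invariant Lagrangian in $\mathbb C^d$ is of cohomogeneity $j$ if all its points have conjugate stabilisers in $G$ and all its orbits have dimension $d-j$. Let $G\le \mathrm{SU}(m-1)$ be a compact connected subgroup with Lie algebra $\mathfrak g$ and standard moment map $\mu(z)=-\frac12\pi_{\mathfrak g}(iz\bar z^T)$ on $\mathbb C^{m-1}$, where $\pi_{\mathfrak g}$ is the orthogonal projection to $\mathfrak g$. Let $Z$ be a connected component of $\mu^{-1}(0)$ that contains a (nonempty, immersed) $G$-invariant Lagrangian submanifold of $\mathbb C^{m-1}$ of cohomogeneity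 one, and let $z'\in Z\setminus\{0\}$, $P=\mathbb Cz'$. Let $G$ act on $\mathbb C^m$ trivially on the last coordinate. Call a complex linear isomorphism $\Phi:P\to\mathbb C$ adapted if, for $V=\Phi^{-1}(1)$ and an orthonormal basis $\nu_1,\dots,\nu_{m-2}$ of the tangent space at $(V,0)$ to its $G$-orbit, $\Omega_0(\nu_1,\dots,\nu_{m-2},(V,0),e_m)=\pm1$. Then an adapted $\Phi$ exists, and the following holds for every adapted $\Phi$. Let $I_1,I_2\subset\mathbb R$ be open intervals, $s_1\in I_1$, $s_2\in I_2$, $a,b\in\mathbb R$, and let $\gamma:I_1\to\mathbb C$, $\xi:I_2\to\mathbb C$ be smooth regular curves with $$\vec\kappa_\gamma-(m-2)\frac{\gamma^\perp}{|\gamma|^2}=a\gamma^\perp,\qquad \vec\kappa_\xi-(m-2)\frac{\xi^\perp}{|\xi|^2}=b\,\xi^\perp$$ wherever $\gamma\neq0$, respectively $\xi\ne0$. Put $\beta_\gamma(s)=-\int_{s_1}^s\langle\gamma,i\gamma'\rangle dt$ and $\tilde\beta_\gamma(s)=-\int_{s_1}^s|\gamma|^2\langle\gamma,i\gamma'\rangle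 dt$, define $\beta_\xi,\tilde\beta_\xi$ likewise with base point $s_2$, and put $$\check F(x,y)=\Big(\gamma(x)\xi(y),\ \tfrac12\big(|\xi(y)|^2-|\gamma(x)|^2\big)+i\big(\beta_\xi(y)-\beta_\gamma(x)\big)\Big),$$ $$F:G\times I_1\times I_2\to\mathbb C^m,\qquad F(g,x,y)=g\cdot(\Phi\oplus\mathrm{Id})^{-1}(\check F(x,y)).$$ Then the image $L$ of $F$ is $G$-invariant; $L\setminus(\{0\}\times\mathbb C)$ is of cohomogeneity two; and on the part of the domain where $F\notin\{0\}\times\mathbb C$ the map $F$ descends to a Lagrangian immersion $\iota$ of a smooth $m$-manifold $M$ with image $L\setminus(\{0\}\times\mathbb C)$, two points $(g,x,y)$ and $(g_1,x_1,y_1)$ giving the same point of $M$ exactly when $x=x_1$, $y=y_1$ and $gz'=g_1z'$. On all of $G\times I_1\times I_2$, $$F^*\lambda=df,\qquad f(x,y)=-\tfrac12\big(|\gamma(x)|^2-|\xi(y)|^2\big)\big(\beta_\gamma(x)-\beta_\xi(y)\big)+\tilde\beta_\gamma(x)+\tilde\beta_\xi(y),$$ and $f$ descends to a smooth function on $M$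 whose differential is $\iota^*\lambda$, so $\iota$ is exact. Furthermore: * If $a=b=0$, then $\iota$ is special Lagrangian: its mean curvature vanishes and its Lagrangian angle is a constant $c$ (modulo $\pi$). * If $a=-b$, then $\iota$ is a Lagrangian translator with velocity $-a\,e_m$: its mean curvature vector is $\vec H=(-a\,e_m)^\perp$, and $\theta=a\langle\iota,Je_m\rangle+c$ (modulo $\pi$) for a constant $c$. In particular, if $a=-b=-1$ then $\vec H=e_m^\perp$ and $\theta=-\langle\iota,Je_m\rangle+c$, and if $a=-b=1$ then $\vec H=-e_m^\perp$ and $\theta=\langle\iota,Je_m\rangle+c$. -/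

import Mathlib

open scoped Manifold ContDiff Matrix

noncomputable section

namespace CohomTwo

/-! ## Complex Euclidean space with its standard Calabi-Yau structure -/

/-- `ℂ^d` with its Euclidean metric `Re ⟨u, v⟩`, which is `inner ℝ u v`. -/
abbrev Cn (d : ℕ) : Type := EuclideanSpace ℂ (Fin d)

/-- The Kähler form `ω₀ = ∑ dxᵢ ∧ dyᵢ` (the inner product of Mathlib is conjugate-linear in its
first argument). -/
def kaehler {d : ℕ} (u v : Cn d) : ℝ := (inner ℂ u v).im

/-- The Liouville form `λ = (1 / 2i) ∑ (z̄ⱼ dzⱼ - zⱼ dz̄ⱼ)` at the point `z`, applied to the tangent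
vector `v`. -/
def liouville {d : ℕ} (z v : Cn d) : ℝ := (inner ℂ z v).im

/-- The holomorphic volume form `Ω₀ = dz₁ ∧ … ∧ dz_d`. -/
def holVol {d : ℕ} (v : Fin d → Cn d) : ℂ := Matrix.det (Matrix.of fun i j => v j i)

/-- `θ` is the Lagrangian angle, for one of the two orientations, of the real `d`-plane `T`:
`Ω₀(e₁, …, e_d) = e^{iθ}` for an orthonormal basis `e₁, …, e_d` of `T`. So `θ` is determined
modulo `π`. -/
def HasLagrangianAngle {d : ℕ} (T : Submodule ℝ (Cn d)) (θ : ℝ) : Prop :=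
  ∃ e : Fin d → Cn d, Orthonormal ℝ e ∧ Submodule.span ℝ (Set.range e) = T ∧
    holVol e = Complex.exp (θ * Complex.I)

/-- `N` is the component `v^⊥` of `v` orthogonal to `T`. -/
def IsNormalPart {d : ℕ} (T : Submodule ℝ (Cn d)) (v N : Cn d) : Prop :=
  v - N ∈ T ∧ ∀ t ∈ T, inner ℝ t N = 0

/-! ## Immersed Lagrangian submanifolds -/

section Immersions

variable {d : ℕ} {M : Type} [TopologicalSpace M] [ChartedSpace (EuclideanSpace ℝ (Fin d)) M]

/-- The differential at `p` of a map from a real `d`-manifold to `ℂ^d`. -/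
def dmap (ι : M → Cn d) (p : M) : EuclideanSpace ℝ (Fin d) →L[ℝ] Cn d :=
  mfderiv 𝓘(ℝ, EuclideanSpace ℝ (Fin d)) 𝓘(ℝ, Cn d) ι p

/-- The tangent plane at `p`, as a real subspace of `ℂ^d`. -/
def tangentPlane (ι : M → Cn d) (p : M) : Submodule ℝ (Cn d) :=
  LinearMap.range (dmap ι p : EuclideanSpace ℝ (Fin d) →ₗ[ℝ] Cn d)

/-- `ι` is a smooth Lagrangian immersion. -/
def IsLagrangianImmersion (ι : M → Cn d) : Prop :=
  ContMDiff 𝓘(ℝ, EuclideanSpace ℝ (Fin d)) 𝓘(ℝ, Cn d) ∞ ι ∧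
    (∀ p, Function.Injective (dmap ι p)) ∧
    ∀ p u v, kaehler (dmap ι p u) (dmap ι p v) = 0

/-- The smooth function `h` is a primitive of the pulled back Liouville form: `ι^* λ = dh`. -/
def IsLiouvillePrimitive (ι : M → Cn d) (h : M → ℝ) : Prop :=
  ContMDiff 𝓘(ℝ, EuclideanSpace ℝ (Fin d)) 𝓘(ℝ, ℝ) ∞ h ∧
    ∀ p (v : EuclideanSpace ℝ (Fin d)), liouville (ι p) (dmap ι p v) =
      (mfderiv 𝓘(ℝ, EuclideanSpace ℝ (Fin d)) 𝓘(ℝ, ℝ) h p :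
        EuclideanSpace ℝ (Fin d) →L[ℝ] ℝ) v

/-- The immersion `ι` read in the preferred chart around `p`. -/
def inChart (ι : M → Cn d) (p : M) : EuclideanSpace ℝ (Fin d) → Cn d :=
  ι ∘ (chartAt (EuclideanSpace ℝ (Fin d)) p).symm

/-- `H` is the mean curvature vector of the immersion `ι` at `p`: the normal part of
`∑ᵢ ∂²φ(eᵢ, eᵢ)`, where `φ` is `ι` in the chart around `p`, and `e₁, …, e_d` is a frame that is
orthonormal for the induced metric at `p`. -/
def HasMeanCurvature (ι : M → Cn d) (p : M) (H : Cn d) : Prop :=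
  ∃ e : Fin d → EuclideanSpace ℝ (Fin d),
    Orthonormal ℝ (fun i =>
      fderiv ℝ (inChart ι p) (chartAt (EuclideanSpace ℝ (Fin d)) p p) (e i)) ∧
    IsNormalPart (tangentPlane ι p)
      (∑ i, fderiv ℝ (fderiv ℝ (inChart ι p)) (chartAt (EuclideanSpace ℝ (Fin d)) p p)
        (e i) (e i)) H

/-- Special Lagrangian: vanishing mean curvature, and constant Lagrangian angle. -/
def IsSpecialLagrangian (ι : M → Cn d) : Prop :=
  IsLagrangianImmersion ι ∧ (∀ p, HasMeanCurvature ι p 0) ∧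
    ∃ c : ℝ, ∀ p, HasLagrangianAngle (tangentPlane ι p) c

/-- `ι` is a Lagrangian translator with velocity `v`, i.e. `H = v^⊥`, and its Lagrangian angle is
`θ = -⟨ι, J v⟩ + c` for a constant `c`. -/
def IsLagrangianTranslator (ι : M → Cn d) (v : Cn d) : Prop :=
  IsLagrangianImmersion ι ∧
    (∀ p, ∃ H, HasMeanCurvature ι p H ∧ IsNormalPart (tangentPlane ι p) v H) ∧
    ∃ c : ℝ, ∀ p,
      HasLagrangianAngle (tangentPlane ι p) (-inner ℝ (ι p) (Complex.I • v) + c)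

end Immersions

/-- The set `S` is an immersed Lagrangian submanifold of `ℂ^d`, i.e. the image of a Lagrangian
immersion of a smooth manifold. -/
def IsImmersedLagrangian {d : ℕ} (S : Set (Cn d)) : Prop :=
  ∃ (M : Type) (_ : TopologicalSpace M) (_ : ChartedSpace (EuclideanSpace ℝ (Fin d)) M)
    (ι : M → Cn d), T2Space M ∧ SecondCountableTopology M ∧
    IsManifold 𝓘(ℝ, EuclideanSpace ℝ (Fin d)) ∞ M ∧ IsLagrangianImmersion ι ∧ Set.range ι = S

/-! ## Linear group actions and the moment map -/

/-- The special unitary group `SU(d)`. -/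
abbrev SU (d : ℕ) := Matrix.specialUnitaryGroup (Fin d) ℂ

/-- The action of a matrix on `ℂ^d`. -/
def act {d : ℕ} (A : Matrix (Fin d) (Fin d) ℂ) (z : Cn d) : Cn d := WithLp.toLp 2 (A *ᵥ z.ofLp)

/-- The Lie algebra of a (closed) subgroup of `SU(d)`: the matrices whose one-parameter group lies
in the subgroup. -/
def lieAlg {d : ℕ} (G : Subgroup (SU d)) : Set (Matrix (Fin d) (Fin d) ℂ) :=
  {X | ∀ t : ℝ, ∃ g ∈ G, (g : Matrix (Fin d) (Fin d) ℂ) = NormedSpace.exp (t • X)}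

/-- The pairing `⟨μ(z), X⟩` of the standard moment map `μ(z) = -½ π_𝔤(i z z̄ᵀ)` with `X ∈ 𝔤`, for
the invariant inner product `⟨A, B⟩ = Re tr(Aᴴ B)`. -/
def momentPairing {d : ℕ} (z : Cn d) (X : Matrix (Fin d) (Fin d) ℂ) : ℝ :=
  -(1 / 2) * (Matrix.trace (Xᴴ * (Complex.I • Matrix.vecMulVec z.ofLp (star z.ofLp)))).re

/-- The zero level set `μ⁻¹(0)` of the standard moment map of `G`. -/
def zeroLevel {d : ℕ} (G : Subgroup (SU d)) : Set (Cn d) :=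
  {z | ∀ X ∈ lieAlg G, momentPairing z X = 0}

/-- The tangent space at `z` to the orbit of `z`, spanned by the fundamental vector fields. Its
dimension is `dim (G / Stab z)`. -/
def orbitTangent {d : ℕ} (G : Subgroup (SU d)) (z : Cn d) : Submodule ℝ (Cn d) :=
  Submodule.span ℝ ((fun X => act X z) '' lieAlg G)

/-- A subset `S` of `ℂ^d`, thought of as a Lagrangian (so `d`-dimensional) submanifold, is
`G`-invariant of cohomogeneity `j`: it is `G`-invariant, all its points have the same isotropy type
(their stabilisers in `G` are conjugate), and all orbits in it have dimension `d - j`. -/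
def IsCohomogeneity {d : ℕ} (G : Subgroup (SU d)) (j : ℕ) (S : Set (Cn d)) : Prop :=
  (∀ g ∈ G, ∀ z ∈ S, act (g : Matrix (Fin d) (Fin d) ℂ) z ∈ S) ∧
  (∀ z ∈ S, ∀ w ∈ S, ∃ g ∈ G, ∀ h ∈ G,
    act (h : Matrix (Fin d) (Fin d) ℂ) z = z ↔
      act ((g * h * g⁻¹ : SU d) : Matrix (Fin d) (Fin d) ℂ) w = w) ∧
  ∀ z ∈ S, Module.finrank ℝ (orbitTangent G z) + j = d

/-! ## Extension by a trivial factor -/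

/-- The block matrix `diag(A, 1)`. -/
def extMatrix {n : ℕ} (A : Matrix (Fin n) (Fin n) ℂ) : Matrix (Fin (n + 1)) (Fin (n + 1)) ℂ :=
  Matrix.reindex finSumFinEquiv finSumFinEquiv
    (Matrix.fromBlocks A 0 0 (1 : Matrix (Fin 1) (Fin 1) ℂ))

theorem extMatrix_mul {n : ℕ} (A B : Matrix (Fin n) (Fin n) ℂ) :
    extMatrix (A * B) = extMatrix A * extMatrix B := by
  simp [extMatrix, Matrix.submatrix_mul_equiv, Matrix.fromBlocks_multiply]

theorem extMatrix_one {n : ℕ} : extMatrix (1 : Matrix (Fin n) (Fin n) ℂ) = 1 := by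
  simp [extMatrix]

theorem extMatrix_star {n : ℕ} (A : Matrix (Fin n) (Fin n) ℂ) :
    extMatrix (star A) = star (extMatrix A) := by
  simp [extMatrix, Matrix.star_eq_conjTranspose, Matrix.fromBlocks_conjTranspose]

theorem extMatrix_mem {n : ℕ} (A : SU n) :
    extMatrix (A : Matrix (Fin n) (Fin n) ℂ) ∈ SU (n + 1) := by
  obtain ⟨A, hA⟩ := A
  rw [Matrix.mem_specialUnitaryGroup_iff, Matrix.mem_unitaryGroup_iff] at hA ⊢
  refine ⟨?_, ?_⟩
  · rw [← extMatrix_star, ← extMatrix_mul, hA.1, extMatrix_one]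
  · simp [extMatrix, hA.2]

/-- The inclusion `SU(n) → SU(n + 1)`, `A ↦ diag(A, 1)`: the action on `ℂ^n` is extended to
`ℂ^n × ℂ` by acting trivially on the last coordinate. -/
def extHom (n : ℕ) : SU n →* SU (n + 1) where
  toFun A := ⟨extMatrix A, extMatrix_mem A⟩
  map_one' := Subtype.ext extMatrix_one
  map_mul' A B := Subtype.ext (extMatrix_mul (A : Matrix (Fin n) (Fin n) ℂ) B)

/-- The group `G ≤ SU(n)` acting on `ℂ^{n+1} = ℂ^n × ℂ`. -/
def ext {n : ℕ} (G : Subgroup (SU n)) : Subgroup (SU (n + 1)) := G.map (extHom n)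

/-- The point `(z', w)` of `ℂ^{n+1} = ℂ^n × ℂ`. -/
def pair {n : ℕ} (z : Cn n) (w : ℂ) : Cn (n + 1) := WithLp.toLp 2 (Fin.snoc (α := fun _ => ℂ) z.ofLp w)

/-- The unit vector `e_m = (0, …, 0, 1)`, where `m = n + 1`. -/
def lastVec (n : ℕ) : Cn (n + 1) := pair 0 1

/-- The subset `{0} × ℂ` of `ℂ^n × ℂ`. -/
def axis (n : ℕ) : Set (Cn (n + 1)) := {p | ∃ w : ℂ, p = pair 0 w}

/-- The normalisation of the complex linear isomorphism `Φ : P → ℂ`, where `P` is the complex line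
through `z'` in `ℂ^{k+1}`. Let `V = Φ⁻¹(1)` and let `ν₁, …, ν_k` be an orthonormal basis of the
tangent space at `(V, 0)` to its `G`-orbit; then `Ω₀(ν₁, …, ν_k, (V, 0), e_m) = ± 1` in
`ℂ^m`, `m = k + 2`. -/
def IsAdapted {k : ℕ} (G : Subgroup (SU (k + 1))) (z' : Cn (k + 1))
    (Φ : (Submodule.span ℂ {z'}) ≃ₗ[ℂ] ℂ) : Prop :=
  ∃ ν : Fin k → Cn (k + 2), Orthonormal ℝ ν ∧
    Submodule.span ℝ (Set.range ν) = orbitTangent (ext G) (pair (Φ.symm 1 : Cn (k + 1)) 0) ∧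
    (holVol (Fin.snoc (α := fun _ => Cn (k + 2))
        (Fin.snoc (α := fun _ => Cn (k + 2)) ν (pair (Φ.symm 1 : Cn (k + 1)) 0))
        (lastVec (k + 1))) = 1 ∨
      holVol (Fin.snoc (α := fun _ => Cn (k + 2))
        (Fin.snoc (α := fun _ => Cn (k + 2)) ν (pair (Φ.symm 1 : Cn (k + 1)) 0))
        (lastVec (k + 1))) = -1)

/-! ## Plane curves and the Ansatz -/

/-- The component of `v` orthogonal to the nonzero vector `t` in the plane. -/
def perp (t v : ℂ) : ℂ := v - (inner ℝ t v / ‖t‖ ^ 2) • t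

/-- The curvature vector of a regular plane curve (in any parametrisation). -/
def curvatureVec (γ : ℝ → ℂ) (s : ℝ) : ℂ :=
  (1 / ‖deriv γ s‖ ^ 2) • perp (deriv γ s) (deriv (deriv γ) s)

/-- `γ` is a smooth regular curve on `I` with `κ - k γ^⊥ / |γ|² = a γ^⊥` wherever `γ ≠ 0`. -/
def IsSolitonCurve (k : ℕ) (a : ℝ) (γ : ℝ → ℂ) (I : Set ℝ) : Prop :=
  ContDiffOn ℝ ∞ γ I ∧ (∀ s ∈ I, deriv γ s ≠ 0) ∧
    ∀ s ∈ I, γ s ≠ 0 →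
      curvatureVec γ s - ((k : ℝ) / ‖γ s‖ ^ 2) • perp (deriv γ s) (γ s) =
        a • perp (deriv γ s) (γ s)

/-- `β_γ(s) = - ∫_{s₀}^s ⟨γ, i γ'⟩`. -/
def beta (γ : ℝ → ℂ) (s₀ s : ℝ) : ℝ :=
  -∫ t in s₀..s, inner ℝ (γ t) (Complex.I * deriv γ t)

/-- `β̃_γ(s) = - ∫_{s₀}^s |γ|² ⟨γ, i γ'⟩`. -/
def betaTilde (γ : ℝ → ℂ) (s₀ s : ℝ) : ℝ :=
  -∫ t in s₀..s, ‖γ t‖ ^ 2 * inner ℝ (γ t) (Complex.I * deriv γ t)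

/-- The map `F̌ : I₁ × I₂ → ℂ²`. -/
def profileMap (γ ξ : ℝ → ℂ) (s₁ s₂ x y : ℝ) : ℂ × ℂ :=
  (γ x * ξ y,
    ((1 / 2 * (‖ξ y‖ ^ 2 - ‖γ x‖ ^ 2) : ℝ) : ℂ) +
      Complex.I * ((beta ξ s₂ y - beta γ s₁ x : ℝ) : ℂ))

/-- The map `F(g, x, y) = g · (Φ ⊕ Id)⁻¹(F̌(x, y))`, with `g ∈ G` given as a matrix. -/
def ansatz {k : ℕ} {z' : Cn (k + 1)} (Φ : (Submodule.span ℂ {z'}) ≃ₗ[ℂ] ℂ)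
    (γ ξ : ℝ → ℂ) (s₁ s₂ : ℝ) (g : Matrix (Fin (k + 1)) (Fin (k + 1)) ℂ) (x y : ℝ) : Cn (k + 2) :=
  act (extMatrix g)
    (pair (Φ.symm (profileMap γ ξ s₁ s₂ x y).1 : Cn (k + 1)) (profileMap γ ξ s₁ s₂ x y).2)

/-- The explicit primitive of the Liouville form. -/
def primitive (γ ξ : ℝ → ℂ) (s₁ s₂ x y : ℝ) : ℝ :=
  -(1 / 2) * (‖γ x‖ ^ 2 - ‖ξ y‖ ^ 2) * (beta γ s₁ x - beta ξ s₂ y) +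
    betaTilde γ s₁ x + betaTilde ξ s₂ y

/-- The parameter domain `G × I₁ × I₂`. -/
def dom {k : ℕ} (G : Subgroup (SU (k + 1))) (I₁ I₂ : Set ℝ) : Set (SU (k + 1) × ℝ × ℝ) :=
  {u | u.1 ∈ G ∧ u.2.1 ∈ I₁ ∧ u.2.2 ∈ I₂}

/-- The part of the parameter domain where `F` avoids `{0} × ℂ`. -/
def regularDom {k : ℕ} {z' : Cn (k + 1)} (G : Subgroup (SU (k + 1)))
    (Φ : (Submodule.span ℂ {z'}) ≃ₗ[ℂ] ℂ) (γ ξ : ℝ → ℂ) (s₁ s₂ : ℝ) (I₁ I₂ : Set ℝ) :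
    Set (SU (k + 1) × ℝ × ℝ) :=
  {u | u ∈ dom G I₁ I₂ ∧ ansatz Φ γ ξ s₁ s₂ u.1 u.2.1 u.2.2 ∉ axis (k + 1)}

/-- The image `L` of the map `F`. -/
def ansatzImage {k : ℕ} {z' : Cn (k + 1)} (G : Subgroup (SU (k + 1)))
    (Φ : (Submodule.span ℂ {z'}) ≃ₗ[ℂ] ℂ) (γ ξ : ℝ → ℂ) (s₁ s₂ : ℝ) (I₁ I₂ : Set ℝ) :
    Set (Cn (k + 2)) :=
  (fun u : SU (k + 1) × ℝ × ℝ => ansatz Φ γ ξ s₁ s₂ u.1 u.2.1 u.2.2) '' dom G I₁ I₂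

end CohomTwo

end

noncomputable section

open scoped Manifold ContDiff Matrix Matrix.Norms.L2Operator
open Filter Topology

namespace CohomTwo

/-! ## Closed groups in a finite-dimensional algebra -/

section ClosedGroups

set_option linter.unusedSectionVars false

variable {𝔸 : Type*} [NormedRing 𝔸] [NormedAlgebra ℝ 𝔸] [FiniteDimensional ℝ 𝔸]

/-! Write k = m − 2 and V = Φ⁻¹(1). For z in the zero level and X in the Lie algebra, X is
skew-Hermitian and the moment pairing vanishes, so ⟨Xz, z⟩ = 0; moreover the orbit of z is
isotropic. If the orbit of V has dimension k, an orthonormal basis ν of its tangent space is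
therefore unitary and, together with V, spans ℂ^(k+1) over ℂ. The partial derivatives of the profile
are (γ'ξ, −γ̄γ') and (γξ', ξ̄ξ'), which are Hermitian orthogonal. Hence off the axis the tangent
plane of F has a unitary basis (`exists_unitary_frame`), so it is Lagrangian, and the square of its
holomorphic volume is (γ/γ̄)^k (γ'/γ̄') times the same expression in ξ. The soliton equation says
that k arg γ + arg γ' + aβ_γ is constant (`IsSolitonCurve.exists_angle`). So for b = −a the angle is
a constant plus a times the imaginary part of the last coordinate. Differentiating the angle and the
Lagrangian condition gives H = J∇θ, which is the translator equation (`exists_normalPart_of_angle`);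
a = b = 0 is velocity zero.

The hypothesis supplies only one point p with an orbit of dimension k, and this must be carried to
z'. The carrying result is `exists_act_eq_smul`: every unit z in the zero level lies, up to G, on
the complex line of the unit vector p. At p the spaces 𝔤p, i𝔤p and ℂp span everything, so by
complexified invariance a homogeneous G-invariant holomorphic function is determined by its value at
p (`invariant_eq_zero`). Apply this to the Haar averages K_n(z, w) = ∫ ⟨gz, w⟩ⁿ dg: it yields K_n(z,
z) K_n(p, p) = K_n(p, z) K_n(z, p). If z and p were not on one line up to G, then |⟨gz, p⟩| ≤ ρ < 1
for all g and the right side would decay exponentially. The left side is the n-th moment of the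
function ⟨gz, z⟩⟨hp, p⟩ on G × G. Its law has at least polynomial mass near 1, and because z and p
are in the zero level it approaches 1 only inside a cusp around the real axis. Integrating (1 −
tζ)^(−(D+1)) as t → 1 shows that such moments cannot decay exponentially (`not_forall_moment_le`).

The manifold M is the orbit of V times the parameters with γξ ≠ 0. Its charts come from the closed
subgroup argument: near 1, an element of G is exp of a vector transverse to the stabiliser times exp
of a vector annihilating V. -/

theorem exp_add' {X Y : 𝔸} (h : Commute X Y) :
    NormedSpace.exp (X + Y) = NormedSpace.exp X * NormedSpace.exp Y := by
  let _ := NormedAlgebra.restrictScalars ℚ ℝ 𝔸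
  have : CompleteSpace 𝔸 := FiniteDimensional.complete ℝ 𝔸
  exact NormedSpace.exp_add_of_commute h

/-- A closed set that is a group under multiplication. -/
structure IsClosedGroup (Γ : Set 𝔸) : Prop where
  isClosed : IsClosed Γ
  one_mem : 1 ∈ Γ
  mul_mem : ∀ {a b}, a ∈ Γ → b ∈ Γ → a * b ∈ Γ
  inv_mem : ∀ {a b}, a ∈ Γ → a * b = 1 → b ∈ Γ

/-- The generators of the one-parameter subgroups in `Γ`. -/
def oneParam (Γ : Set 𝔸) : Set 𝔸 :=
  {X | ∀ t : ℝ, NormedSpace.exp (t • X) ∈ Γ}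

theorem exp_neg_mul_exp (X : 𝔸) :
    NormedSpace.exp (-X) * NormedSpace.exp X = 1 := by
  rw [← exp_add' (Commute.neg_left (Commute.refl X))]
  simp

theorem exp_mul_exp_neg (X : 𝔸) :
    NormedSpace.exp X * NormedSpace.exp (-X) = 1 := by
  rw [← exp_add' (Commute.neg_right (Commute.refl X))]
  simp

theorem continuous_exp' : Continuous (NormedSpace.exp : 𝔸 → 𝔸) := by
  let _ := NormedAlgebra.restrictScalars ℚ ℝ 𝔸
  have : CompleteSpace 𝔸 := FiniteDimensional.complete ℝ 𝔸
  exact NormedSpace.exp_continuous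

theorem hasStrictFDerivAt_exp'_zero :
    HasStrictFDerivAt (NormedSpace.exp : 𝔸 → 𝔸) (ContinuousLinearMap.id ℝ 𝔸) 0 := by
  have : CompleteSpace 𝔸 := FiniteDimensional.complete ℝ 𝔸
  exact hasStrictFDerivAt_exp_zero

variable {Γ : Set 𝔸}

theorem IsClosedGroup.pow_mem (hΓ : IsClosedGroup Γ) {a : 𝔸} (ha : a ∈ Γ) (n : ℕ) :
    a ^ n ∈ Γ := by
  induction n with
  | zero => simpa using hΓ.one_mem
  | succ n ih => rw [pow_succ]; exact hΓ.mul_mem ih ha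

theorem IsClosedGroup.exp_neg_mem (hΓ : IsClosedGroup Γ) {X : 𝔸}
    (h : NormedSpace.exp X ∈ Γ) : NormedSpace.exp (-X) ∈ Γ :=
  hΓ.inv_mem h (exp_mul_exp_neg X)

theorem tendsto_floor_div_mul {ι : Type*} {l : Filter ι} {ε : ι → ℝ}
    (hε : ∀ᶠ i in l, 0 < ε i) (hε0 : Tendsto ε l (𝓝 0)) {t : ℝ} (ht : 0 ≤ t) :
    Tendsto (fun i => (⌊t / ε i⌋₊ : ℝ) * ε i) l (𝓝 t) := by
  have h1 : Tendsto (fun i => t - ε i) l (𝓝 t) := by simpa using tendsto_const_nhds.sub hε0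
  refine tendsto_of_tendsto_of_tendsto_of_le_of_le' h1 tendsto_const_nhds ?_ ?_
  · filter_upwards [hε] with i hi
    have := (Nat.lt_floor_add_one (t / ε i)).le
    rw [div_le_iff₀ hi] at this
    linarith
  · filter_upwards [hε] with i hi
    have := Nat.floor_le (div_nonneg ht hi.le)
    rwa [le_div_iff₀ hi] at this

/-- exp(tY) is the limit of the powers exp(X i)^⌊t / ε i⌋, which stay in the closed set Γ. Negative
t are reached through the inverses exp(−X i). -/
theorem IsClosedGroup.mem_oneParam_of_tendsto (hΓ : IsClosedGroup Γ) {ι : Type*}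
    {l : Filter ι} [l.NeBot] {ε : ι → ℝ} {X : ι → 𝔸} {Y : 𝔸}
    (hε : ∀ᶠ i in l, 0 < ε i) (hε0 : Tendsto ε l (𝓝 0))
    (hX : ∀ᶠ i in l, NormedSpace.exp (X i) ∈ Γ)
    (hY : Tendsto (fun i => (ε i)⁻¹ • X i) l (𝓝 Y)) : Y ∈ oneParam Γ := by
  have key : ∀ (X : ι → 𝔸) (Y : 𝔸), (∀ᶠ i in l, NormedSpace.exp (X i) ∈ Γ) →
      Tendsto (fun i => (ε i)⁻¹ • X i) l (𝓝 Y) → ∀ t : ℝ, 0 ≤ t →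
      NormedSpace.exp (t • Y) ∈ Γ := by
    intro X Y hX hY t ht
    have h1 : Tendsto (fun i => ((⌊t / ε i⌋₊ : ℝ) * ε i) • ((ε i)⁻¹ • X i)) l (𝓝 (t • Y)) :=
      (tendsto_floor_div_mul hε hε0 ht).smul hY
    refine hΓ.isClosed.mem_of_tendsto ((continuous_exp'.tendsto _).comp h1) ?_
    filter_upwards [hX, hε] with i hi hεi
    have h2 : ((⌊t / ε i⌋₊ : ℝ) * ε i) • ((ε i)⁻¹ • X i) = ⌊t / ε i⌋₊ • X i := by
      rw [smul_smul, mul_assoc, mul_inv_cancel₀ hεi.ne', mul_one, Nat.cast_smul_eq_nsmul]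
    simp only [Function.comp]
    let _ := NormedAlgebra.restrictScalars ℚ ℝ 𝔸
    have : CompleteSpace 𝔸 := FiniteDimensional.complete ℝ 𝔸
    rw [h2, NormedSpace.exp_nsmul]
    exact hΓ.pow_mem hi _
  intro t
  rcases le_total 0 t with ht | ht
  · exact key X Y hX hY t ht
  · have := key (fun i => -X i) (-Y) (hX.mono fun i hi => hΓ.exp_neg_mem hi)
      (by simpa using hY.neg) (-t) (by linarith)
    simpa using this

theorem exists_log : ∃ L : 𝔸 → 𝔸, L 1 = 0 ∧
    HasStrictFDerivAt L (ContinuousLinearMap.id ℝ 𝔸) 1 ∧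
    ∀ᶠ a in 𝓝 (1 : 𝔸), NormedSpace.exp (L a) = a := by
  have : CompleteSpace 𝔸 := FiniteDimensional.complete ℝ 𝔸
  have h : HasStrictFDerivAt (NormedSpace.exp : 𝔸 → 𝔸)
    ((ContinuousLinearEquiv.refl ℝ 𝔸) : 𝔸 →L[ℝ] 𝔸) 0 := hasStrictFDerivAt_exp'_zero
  have e0 : NormedSpace.exp (0 : 𝔸) = 1 := NormedSpace.exp_zero
  refine ⟨h.localInverse _ _ _, ?_, ?_, ?_⟩
  · have := h.localInverse_apply_image; rwa [e0] at this
  · have := h.to_localInverse; rwa [e0] at this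
  · have := h.eventually_right_inverse; rwa [e0] at this

theorem hasDerivAt_exp'_smul_zero (X : 𝔸) :
    HasDerivAt (fun t : ℝ => NormedSpace.exp (t • X)) X 0 := by
  have : CompleteSpace 𝔸 := FiniteDimensional.complete ℝ 𝔸
  have := hasDerivAt_exp_smul_const X (0 : ℝ)
  simpa using this

theorem IsClosedGroup.smul_mem_oneParam {X : 𝔸}
    (hX : X ∈ oneParam Γ) (c : ℝ) : c • X ∈ oneParam Γ := fun t => by
  rw [smul_smul]; exact hX _

/-- The logarithm of exp(tX) exp(tY) is t(X + Y) + o(t), so X + Y is a limit of rescaled logarithms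
of elements of Γ. -/
theorem IsClosedGroup.add_mem_oneParam (hΓ : IsClosedGroup Γ) {X Y : 𝔸}
    (hX : X ∈ oneParam Γ) (hY : Y ∈ oneParam Γ) : X + Y ∈ oneParam Γ := by
  obtain ⟨L, hL1, hL, hLe⟩ := exists_log (𝔸 := 𝔸)
  set h : ℝ → 𝔸 := fun t => NormedSpace.exp (t • X) * NormedSpace.exp (t • Y) with hh
  have h0 : h 0 = 1 := by simp [hh]
  have hd : HasDerivAt h (X + Y) 0 := by
    have := (hasDerivAt_exp'_smul_zero X).mul (hasDerivAt_exp'_smul_zero Y)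
    simp only [zero_smul, NormedSpace.exp_zero, mul_one, one_mul] at this
    exact this
  have hLd : HasDerivAt (fun t => L (h t)) (X + Y) 0 := by
    have h2 : HasFDerivAt L (ContinuousLinearMap.id ℝ 𝔸) (h 0) := by
      rw [h0]; exact hL.hasFDerivAt
    exact h2.comp_hasDerivAt (0 : ℝ) hd
  have hs := hasDerivAt_iff_tendsto_slope.1 hLd
  have hs' : Tendsto (fun t : ℝ => t⁻¹ • L (h t)) (𝓝[>] 0) (𝓝 (X + Y)) := by
    refine (hs.mono_left (nhdsWithin_mono _ fun t ht => ne_of_gt ht)).congr fun t => ?_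
    simp [slope, h0, hL1]
  refine hΓ.mem_oneParam_of_tendsto (l := 𝓝[>] (0 : ℝ)) (ε := id) (X := fun t => L (h t))
    self_mem_nhdsWithin (tendsto_id.mono_left nhdsWithin_le_nhds) ?_ hs'
  have hc : Tendsto h (𝓝[>] 0) (𝓝 1) := by
    have := hd.continuousAt.tendsto
    rw [h0] at this
    exact this.mono_left nhdsWithin_le_nhds
  filter_upwards [hc.eventually hLe] with t ht
  rw [ht]
  exact hΓ.mul_mem (hX t) (hY t)

/-- The Lie algebra of a closed group, as a subspace. -/
def IsClosedGroup.lie (hΓ : IsClosedGroup Γ) : Submodule ℝ 𝔸 where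
  carrier := oneParam Γ
  add_mem' := hΓ.add_mem_oneParam
  zero_mem' := fun t => by simpa using hΓ.one_mem
  smul_mem' c _ hX := IsClosedGroup.smul_mem_oneParam hX c

theorem IsClosedGroup.exp_mem (hΓ : IsClosedGroup Γ) {X : 𝔸} (hX : X ∈ hΓ.lie) :
    NormedSpace.exp X ∈ Γ := by simpa using hX 1

/-- A neighbourhood of `1` in a closed group consists of products `exp Y * exp Z` of elements
of complementary subspaces of the Lie algebra. -/
theorem IsClosedGroup.eventually_eq_exp_mul_exp (hΓ : IsClosedGroup Γ)
    (a b c : 𝔸 →L[ℝ] 𝔸) (habc : a + b + c = ContinuousLinearMap.id ℝ _)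
    (ha : ∀ X, a X ∈ hΓ.lie) (hb : ∀ X, b X ∈ hΓ.lie)
    (hcc : ∀ X, c (c X) = c X) (hc : ∀ X ∈ hΓ.lie, c X = X → X = 0)
    {U : Set 𝔸} (hU : U ∈ 𝓝 0) :
    ∀ᶠ g in 𝓝[Γ] 1, ∃ X ∈ U, g = NormedSpace.exp (a X) * NormedSpace.exp (b X) := by
  -- Θ is a local diffeomorphism at 0, since its derivative there is a + b + c = id. Its inverse Λ
  -- gives every g near 1 three coordinates, and the claim is that the third vanishes on Γ.
  set Θ : 𝔸 → 𝔸 := fun X =>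
    NormedSpace.exp (a X) * NormedSpace.exp (b X) * NormedSpace.exp (c X) with hΘ
  have hstrict : ∀ f : 𝔸 →L[ℝ] 𝔸,
      HasStrictFDerivAt (fun X => NormedSpace.exp (f X)) f 0 := by
    intro f
    have h1 : HasStrictFDerivAt (NormedSpace.exp : 𝔸 → 𝔸)
      (ContinuousLinearMap.id ℝ 𝔸) (f 0) := by
      rw [map_zero]; exact hasStrictFDerivAt_exp'_zero
    simpa using h1.comp (0 : 𝔸) f.hasStrictFDerivAt
  have hD : HasStrictFDerivAt Θ
      ((ContinuousLinearEquiv.refl ℝ 𝔸) : 𝔸 →L[ℝ] 𝔸) 0 := by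
    have := ((hstrict a).mul' (hstrict b)).mul' (hstrict c)
    refine this.congr_fderiv ?_
    ext1 X
    have := congrArg (fun f => f X) habc
    simp only [add_apply, ContinuousLinearMap.id_apply] at this
    simp only [Pi.mul_apply, map_zero, NormedSpace.exp_zero, mul_one, one_smul, MulOpposite.op_one,
      add_apply, ContinuousLinearEquiv.coe_coe, ContinuousLinearEquiv.coe_refl', id_eq]
    calc c X + (b X + a X) = a X + b X + c X := by abel
      _ = X := this
  have hΘ0 : Θ 0 = 1 := by simp [hΘ]
  have : CompleteSpace 𝔸 := FiniteDimensional.complete ℝ 𝔸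
  set Λ := hD.localInverse _ _ _ with hΛ
  have hΛ1 : Λ 1 = 0 := by have := hD.localInverse_apply_image; rwa [hΘ0] at this
  have hΛc : Tendsto Λ (𝓝 1) (𝓝 0) := by
    have := hD.localInverse_tendsto; rwa [hΘ0] at this
  have hΛr : ∀ᶠ g in 𝓝 (1 : 𝔸), Θ (Λ g) = g := by
    have := hD.eventually_right_inverse; rwa [hΘ0] at this
  have hcmem : ∀ g ∈ Γ, Θ (Λ g) = g → NormedSpace.exp (c (Λ g)) ∈ Γ := by
    intro g hg h
    have h1 : NormedSpace.exp (c (Λ g)) =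
        NormedSpace.exp (-b (Λ g)) * (NormedSpace.exp (-a (Λ g)) * g) := by
      conv_rhs => enter [2, 2]; rw [← h]
      simp only [hΘ]
      rw [mul_assoc (NormedSpace.exp (a (Λ g))), ← mul_assoc (NormedSpace.exp (-a (Λ g))),
        exp_neg_mul_exp, one_mul, ← mul_assoc, exp_neg_mul_exp, one_mul]
    rw [h1]
    exact hΓ.mul_mem (hΓ.exp_neg_mem (hΓ.exp_mem (hb _)))
      (hΓ.mul_mem (hΓ.exp_neg_mem (hΓ.exp_mem (ha _))) hg)
  -- Otherwise the normalised vectors c(Λ g) accumulate at a unit vector Y as g → 1 in Γ. Since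
  -- exp(c(Λ g)) ∈ Γ, the limit Y lies in the Lie algebra, and cY = Y forces Y = 0. The ultrafilter
  -- replaces the extraction of a convergent subsequence.
  have hzero : ∀ᶠ g in 𝓝[Γ] 1, c (Λ g) = 0 := by
    by_contra hcon
    rw [not_eventually] at hcon
    have : (𝓝[Γ] (1 : 𝔸) ⊓ 𝓟 {g | ¬ c (Λ g) = 0}).NeBot :=
      frequently_mem_iff_neBot.1 hcon
    set 𝒰 := Ultrafilter.of (𝓝[Γ] (1 : 𝔸) ⊓ 𝓟 {g | ¬ c (Λ g) = 0})
    have h𝒰 : (𝒰 : Filter 𝔸) ≤ 𝓝[Γ] (1 : 𝔸) ⊓ 𝓟 {g | ¬ c (Λ g) = 0} :=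
      Ultrafilter.of_le _
    have hne : ∀ᶠ g in (𝒰 : Filter 𝔸), c (Λ g) ≠ 0 :=
      (h𝒰.trans inf_le_right) (mem_principal_self _)
    have h𝒰1 : (𝒰 : Filter 𝔸) ≤ 𝓝 1 := (h𝒰.trans inf_le_left).trans nhdsWithin_le_nhds
    have h𝒰Γ : ∀ᶠ g in (𝒰 : Filter 𝔸), g ∈ Γ :=
      (h𝒰.trans inf_le_left) self_mem_nhdsWithin
    have hcΛ : Tendsto (fun g => c (Λ g)) 𝒰 (𝓝 0) := by
      have := (c.continuous.tendsto 0).comp (hΛc.mono_left h𝒰1)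
      rwa [map_zero] at this
    have hsph : ∀ᶠ g in (𝒰 : Filter 𝔸),
        ‖c (Λ g)‖⁻¹ • c (Λ g) ∈ Metric.sphere (0 : 𝔸) 1 := by
      filter_upwards [hne] with g hg
      simp [norm_smul, inv_mul_cancel₀ (norm_ne_zero_iff.2 hg)]
    have : ProperSpace 𝔸 := FiniteDimensional.proper ℝ 𝔸
    obtain ⟨Y, hY1, hY⟩ := (isCompact_sphere (0 : 𝔸) 1).ultrafilter_le_nhds'
      (𝒰.map fun g => ‖c (Λ g)‖⁻¹ • c (Λ g)) hsph
    have hY' : Tendsto (fun g => ‖c (Λ g)‖⁻¹ • c (Λ g)) 𝒰 (𝓝 Y) := hY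
    have hYlie : Y ∈ hΓ.lie := by
      refine hΓ.mem_oneParam_of_tendsto (l := (𝒰 : Filter 𝔸)) (ε := fun g => ‖c (Λ g)‖)
        (X := fun g => c (Λ g)) ?_ (by simpa using hcΛ.norm) ?_ hY'
      · filter_upwards [hne] with g hg using norm_pos_iff.2 hg
      · filter_upwards [h𝒰Γ, h𝒰1 hΛr] with g hg h using hcmem g hg h
    have hcY : c Y = Y := by
      have h1 : Tendsto (fun g => c (‖c (Λ g)‖⁻¹ • c (Λ g))) 𝒰 (𝓝 (c Y)) :=
        (c.continuous.tendsto Y).comp hY'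
      refine tendsto_nhds_unique (h1.congr fun g => ?_) hY'
      rw [map_smul, hcc]
    have := hc Y hYlie hcY
    simp [this] at hY1
  filter_upwards [hzero, nhdsWithin_le_nhds hΛr, nhdsWithin_le_nhds (hΛc hU)] with g h1 h2 h3
  refine ⟨Λ g, h3, ?_⟩
  conv_lhs => rw [← h2]
  simp [hΘ, h1]

end ClosedGroups

/-- Square complex matrices. -/
abbrev Mat (d : ℕ) : Type := Matrix (Fin d) (Fin d) ℂ

variable {d : ℕ}

/-- The elements of `G`, as matrices. -/
def matrices {d : ℕ} (G : Subgroup (SU d)) : Set (Mat d) :=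
  (fun g : SU d => (g : Mat d)) '' (G : Set (SU d))

theorem isClosedGroup_matrices {G : Subgroup (SU d)}
    (hG : IsCompact (G : Set (SU d))) : IsClosedGroup (matrices G) where
  isClosed := (hG.image continuous_subtype_val).isClosed
  one_mem := ⟨1, G.one_mem, rfl⟩
  mul_mem := by
    rintro _ _ ⟨g, hg, rfl⟩ ⟨h, hh, rfl⟩
    exact ⟨g * h, G.mul_mem hg hh, rfl⟩
  inv_mem := by
    rintro _ b ⟨g, hg, rfl⟩ h
    refine ⟨g⁻¹, G.inv_mem hg, ?_⟩
    have h1 : ((g⁻¹ : SU d) : Mat d) * (g : Mat d) = 1 := by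
      have : (g⁻¹ * g : SU d) = 1 := inv_mul_cancel g
      exact congrArg Subtype.val this
    exact left_inv_eq_right_inv h1 h

end CohomTwo

end

noncomputable section

open scoped Manifold ContDiff Matrix Matrix.Norms.L2Operator
open Filter Topology

namespace CohomTwo

/-! ## The linear action and the moment map -/

variable {d : ℕ}

theorem act_eq (A : Mat d) (z : Cn d) : act A z = Matrix.toEuclideanCLM (𝕜 := ℂ) A z := rfl

theorem act_add_left (A B : Mat d) (z : Cn d) : act (A + B) z = act A z + act B z := by
  simp [act_eq]

theorem act_add_right (A : Mat d) (z w : Cn d) : act A (z + w) = act A z + act A w := by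
  simp [act_eq]

theorem act_sub_left (A B : Mat d) (z : Cn d) : act (A - B) z = act A z - act B z := by
  simp [act_eq]

theorem act_smul_left (c : ℂ) (A : Mat d) (z : Cn d) : act (c • A) z = c • act A z := by
  simp [act_eq]

theorem act_smul_right (c : ℂ) (A : Mat d) (z : Cn d) : act A (c • z) = c • act A z := by
  simp [act_eq]

theorem act_real_smul_left (c : ℝ) (A : Mat d) (z : Cn d) : act (c • A) z = c • act A z := by
  simpa using act_smul_left (c : ℂ) A z

theorem act_real_smul_right (c : ℝ) (A : Mat d) (z : Cn d) : act A (c • z) = c • act A z := by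
  simpa using act_smul_right (c : ℂ) A z

theorem act_mul (A B : Mat d) (z : Cn d) : act (A * B) z = act A (act B z) := by
  simp [act_eq]

@[simp] theorem act_one (z : Cn d) : act (1 : Mat d) z = z := by
  simp [act_eq]

@[simp] theorem act_zero_right (A : Mat d) : act A (0 : Cn d) = 0 := by
  simp [act_eq]

theorem norm_act_le (A : Mat d) (z : Cn d) : ‖act A z‖ ≤ ‖A‖ * ‖z‖ :=
  Matrix.l2_opNorm_mulVec A z

/-- The action as a continuous bilinear map. -/
def actL (d : ℕ) : Mat d →L[ℂ] Cn d →L[ℂ] Cn d :=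
  LinearMap.mkContinuous₂
    (LinearMap.mk₂ ℂ (fun (A : Mat d) (z : Cn d) => act A z) act_add_left act_smul_left
      act_add_right (fun c A z => act_smul_right c A z)) 1
    (fun A z => by simpa using norm_act_le A z)

@[simp] theorem actL_apply (A : Mat d) (z : Cn d) : actL d A z = act A z := rfl

/-- The action, as a function of the matrix. -/
def orbitMapL (z : Cn d) : Mat d →L[ℂ] Cn d := (actL d).flip z

@[simp] theorem orbitMapL_apply (A : Mat d) (z : Cn d) : orbitMapL z A = act A z := rfl

theorem inner_act_left (A : Mat d) (z w : Cn d) :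
    inner ℂ (act A z) w = inner ℂ z (act (star A) w) := by
  rw [act_eq, act_eq, map_star, ContinuousLinearMap.star_eq_adjoint,
    ContinuousLinearMap.adjoint_inner_right]

theorem inner_act_act {A : Mat d} (hA : star A * A = 1) (z w : Cn d) :
    inner ℂ (act A z) (act A w) = inner ℂ z w := by
  rw [inner_act_left, ← act_mul, hA, act_one]

theorem norm_act {A : Mat d} (hA : star A * A = 1) (z : Cn d) : ‖act A z‖ = ‖z‖ := by
  have h := inner_act_act hA z z
  rw [inner_self_eq_norm_sq_to_K, inner_self_eq_norm_sq_to_K] at h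
  have h2 : ‖act A z‖ ^ 2 = ‖z‖ ^ 2 := by exact_mod_cast h
  exact (pow_left_inj₀ (norm_nonneg _) (norm_nonneg _) two_ne_zero).1 h2

theorem star_mul_self_of_SU (g : SU d) : star (g : Mat d) * (g : Mat d) = 1 :=
  (Matrix.mem_unitaryGroup_iff').1 (Matrix.mem_specialUnitaryGroup_iff.1 g.2).1

theorem SU_mul_star_self (g : SU d) : (g : Mat d) * star (g : Mat d) = 1 :=
  (Matrix.mem_unitaryGroup_iff).1 (Matrix.mem_specialUnitaryGroup_iff.1 g.2).1

theorem SU_coe_inv (g : SU d) : ((g⁻¹ : SU d) : Mat d) = star (g : Mat d) := rfl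

theorem real_inner_eq_re (u v : Cn d) : inner ℝ u v = (inner ℂ u v).re := by
  simp [PiLp.inner_apply, Complex.inner]

instance : IsTopologicalGroup (SU d) where
  continuous_inv := by
    refine Continuous.subtype_mk ?_ _
    exact (continuous_star).comp continuous_subtype_val

theorem norm_SU_le (g : SU d) : ‖(g : Mat d)‖ ≤ 1 := by
  rw [Matrix.cstar_norm_def]
  refine ContinuousLinearMap.opNorm_le_bound _ zero_le_one fun z => ?_
  rw [← act_eq, norm_act (star_mul_self_of_SU g), one_mul]

theorem hasDerivAt_exp_smul_mul (X B : Mat d) (t : ℝ) :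
    HasDerivAt (fun t : ℝ => NormedSpace.exp (t • X) * B) (X * (NormedSpace.exp (t • X) * B)) t := by
  have : CompleteSpace (Mat d) := FiniteDimensional.complete ℂ _
  have := (hasDerivAt_exp_smul_const' X t).mul_const B
  rwa [mul_assoc] at this

theorem hasDerivAt_act_exp (X B : Mat d) (z : Cn d) (t : ℝ) :
    HasDerivAt (fun t : ℝ => act (NormedSpace.exp (t • X) * B) z)
      (act X (act (NormedSpace.exp (t • X) * B) z)) t := by
  have := ((orbitMapL z).restrictScalars ℝ).hasFDerivAt.comp_hasDerivAt t
    (hasDerivAt_exp_smul_mul X B t)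
  simp only [ContinuousLinearMap.coe_restrictScalars', orbitMapL_apply, act_mul X] at this
  exact this

theorem hasDerivAt_act_exp' (X : Mat d) (z : Cn d) (t : ℝ) :
    HasDerivAt (fun t : ℝ => act (NormedSpace.exp (t • X)) z)
      (act X (act (NormedSpace.exp (t • X)) z)) t := by
  simpa using hasDerivAt_act_exp X 1 z t

/-! ### Infinitesimal action, zero level of the moment map, isotropy of the orbits -/

variable {G : Subgroup (SU d)}

/-- Differentiate the constant function ⟨exp(tX)z, exp(tX)w⟩ at t = 0. -/
theorem inner_act_lie {X : Mat d} (hX : X ∈ lieAlg G) (z w : Cn d) :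
    inner ℂ (act X z) w = - inner ℂ z (act X w) := by
  have h1 := (hasDerivAt_act_exp' X z 0).inner ℂ (hasDerivAt_act_exp' X w 0)
  have h2 : (fun t : ℝ => inner ℂ (act (NormedSpace.exp (t • X)) z)
      (act (NormedSpace.exp (t • X)) w)) = fun _ => inner ℂ z w := by
    funext t
    obtain ⟨g, -, hg⟩ := hX t
    rw [← hg, inner_act_act (star_mul_self_of_SU g)]
  rw [h2] at h1
  have h3 := h1.unique (hasDerivAt_const _ _)
  simp at h3
  linear_combination h3

theorem lieAlg_conj {X : Mat d} (hX : X ∈ lieAlg G) {g : SU d} (hg : g ∈ G) :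
    (g : Mat d) * X * star (g : Mat d) ∈ lieAlg G := by
  intro t
  obtain ⟨h, hh, he⟩ := hX t
  refine ⟨g * h * g⁻¹, G.mul_mem (G.mul_mem hg hh) (G.inv_mem hg), ?_⟩
  have hu : IsUnit (g : Mat d) := IsUnit.of_mul_eq_one _ (SU_mul_star_self g)
  have hi : (g : Mat d)⁻¹ = star (g : Mat d) := Matrix.inv_eq_right_inv (SU_mul_star_self g)
  have := Matrix.exp_conj (g : Mat d) (t • X) hu
  rw [hi] at this
  have h2 : t • ((g : Mat d) * X * star (g : Mat d)) = (g : Mat d) * (t • X) * star (g : Mat d) := by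
    simp
  rw [h2, this, ← he]
  rfl

theorem momentPairing_eq (z : Cn d) (X : Mat d) :
    momentPairing z X = (1 / 2) * (inner ℂ (act X z) z).im := by
  have h : Matrix.trace (Xᴴ * (Complex.I • Matrix.vecMulVec z.ofLp (star z.ofLp))) =
      Complex.I * inner ℂ (act X z) z := by
    rw [inner_act_left, Matrix.mul_smul, Matrix.trace_smul, Matrix.mul_vecMulVec,
      Matrix.trace_vecMulVec, smul_eq_mul]
    congr 1
  rw [momentPairing, h]
  simp

/-- The real part vanishes because X is skew-Hermitian, the imaginary part is twice the moment
pairing. This form of the condition is visibly invariant under complex scalars. -/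
theorem inner_act_self {z : Cn d} (hz : z ∈ zeroLevel G) {X : Mat d} (hX : X ∈ lieAlg G) :
    inner ℂ (act X z) z = 0 := by
  have h1 := hz X hX
  rw [momentPairing_eq] at h1
  have h2 := inner_act_lie hX z z
  have h3 := inner_conj_symm (𝕜 := ℂ) (act X z) z
  rw [eq_neg_iff_add_eq_zero.1 h2 |> fun h => (neg_eq_of_add_eq_zero_right h).symm] at h3
  have h4 := congrArg Complex.re h3
  apply Complex.ext
  · simp only [map_neg, Complex.neg_re, Complex.conj_re] at h4
    rw [Complex.zero_re]
    linarith
  · simp at h1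
    simpa using h1

theorem inner_self_act {z : Cn d} (hz : z ∈ zeroLevel G) {X : Mat d} (hX : X ∈ lieAlg G) :
    inner ℂ z (act X z) = 0 := by
  rw [← inner_conj_symm, inner_act_self hz hX, map_zero]

theorem mem_zeroLevel_iff {z : Cn d} :
    z ∈ zeroLevel G ↔ ∀ X ∈ lieAlg G, inner ℂ (act X z) z = 0 := by
  refine ⟨fun h X hX => inner_act_self h hX, fun h X hX => ?_⟩
  rw [momentPairing_eq, h X hX]
  simp

theorem smul_mem_zeroLevel {z : Cn d} (hz : z ∈ zeroLevel G) (c : ℂ) : c • z ∈ zeroLevel G := by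
  rw [mem_zeroLevel_iff] at hz ⊢
  intro X hX
  rw [act_smul_right, inner_smul_left, inner_smul_right, hz X hX]
  simp

theorem act_conj_act (g : SU d) (X : Mat d) (z : Cn d) :
    act ((g : Mat d) * X * star (g : Mat d)) (act (g : Mat d) z) = act (g : Mat d) (act X z) := by
  rw [← act_mul, mul_assoc, star_mul_self_of_SU, mul_one, act_mul]

theorem star_conj_mem_lieAlg {X : Mat d} (hX : X ∈ lieAlg G) {g : SU d} (hg : g ∈ G) :
    star (g : Mat d) * X * (g : Mat d) ∈ lieAlg G := by
  have := lieAlg_conj hX (G.inv_mem hg)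
  rwa [SU_coe_inv, star_star] at this

theorem act_act_conj (g : SU d) (X : Mat d) (z : Cn d) :
    act X (act (g : Mat d) z) =
      act (g : Mat d) (act (star (g : Mat d) * X * (g : Mat d)) z) := by
  rw [← act_mul, ← act_mul, ← mul_assoc, ← mul_assoc, SU_mul_star_self, one_mul]

theorem act_mem_zeroLevel {z : Cn d} (hz : z ∈ zeroLevel G) {g : SU d} (hg : g ∈ G) :
    act (g : Mat d) z ∈ zeroLevel G := by
  rw [mem_zeroLevel_iff] at hz ⊢
  intro X hX
  rw [act_act_conj, inner_act_act (star_mul_self_of_SU g)]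
  exact hz _ (star_conj_mem_lieAlg hX hg)

/-- The orbits in the zero level of the moment map are isotropic. -/
theorem inner_act_act_im {z : Cn d} (hz : z ∈ zeroLevel G) {X Y : Mat d} (hX : X ∈ lieAlg G)
    (hY : Y ∈ lieAlg G) : (inner ℂ (act X z) (act Y z)).im = 0 := by
  -- The curve y = exp(tX)z stays in the zero level, so ⟨y, Yy⟩ = 0 along it. Differentiating gives
  -- ⟨Xz, Yz⟩ = −⟨z, YXz⟩ = ⟨Yz, Xz⟩, which is therefore real.
  have h1 := (hasDerivAt_act_exp' X z 0).inner ℂ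
    (((actL d Y).restrictScalars ℝ).hasFDerivAt.comp_hasDerivAt (0 : ℝ)
      (hasDerivAt_act_exp' X z 0))
  have h2 : (fun t : ℝ => inner ℂ (act (NormedSpace.exp (t • X)) z)
      ((((actL d Y).restrictScalars ℝ) ∘ fun t : ℝ => act (NormedSpace.exp (t • X)) z) t)) =
      fun _ => 0 := by
    funext t
    obtain ⟨g, hg, he⟩ := hX t
    simp only [Function.comp, ← he]
    exact inner_self_act (act_mem_zeroLevel hz hg) hY
  rw [h2] at h1
  have h3 := h1.unique (hasDerivAt_const _ _)
  simp at h3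
  have h4 := inner_act_lie hY z (act X z)
  have h5 := congrArg Complex.im h3
  have h6 := congrArg Complex.im h4
  have h7 := congrArg Complex.im (inner_conj_symm (𝕜 := ℂ) (act X z) (act Y z))
  rw [Complex.conj_im] at h7
  simp only [Complex.add_im, Complex.zero_im, Complex.neg_im] at h5 h6
  linarith

theorem orbitTangent_eq_map (hG : IsCompact (G : Set (SU d))) (z : Cn d) :
    orbitTangent G z = (isClosedGroup_matrices hG).lie.map
      ((orbitMapL z).restrictScalars ℝ : Mat d →ₗ[ℝ] Cn d) := by
  refine le_antisymm (Submodule.span_le.2 ?_) ?_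
  · rintro _ ⟨X, hX, rfl⟩
    exact ⟨X, hX, rfl⟩
  · rintro _ ⟨X, hX, rfl⟩
    exact Submodule.subset_span ⟨X, hX, rfl⟩

theorem mem_orbitTangent (hG : IsCompact (G : Set (SU d))) {z w : Cn d} :
    w ∈ orbitTangent G z ↔ ∃ X ∈ lieAlg G, act X z = w := by
  rw [orbitTangent_eq_map hG]; rfl

theorem finrank_orbitTangent_smul {c : ℂ} (hc : c ≠ 0) (z : Cn d) :
    Module.finrank ℝ (orbitTangent G (c • z)) = Module.finrank ℝ (orbitTangent G z) := by
  set f : Cn d →ₗ[ℝ] Cn d := (c • LinearMap.id : Cn d →ₗ[ℂ] Cn d).restrictScalars ℝ with hf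
  have hinj : Function.Injective f := fun a b h => smul_right_injective _ hc h
  have : orbitTangent G (c • z) = (orbitTangent G z).map f := by
    rw [orbitTangent, orbitTangent, Submodule.map_span, ← Set.image_comp]
    congr 2
    funext X
    simp [hf, act_smul_right]
  rw [this]
  exact (Submodule.equivMapOfInjective f hinj _).finrank_eq.symm

theorem orbitTangent_act {g : SU d} (hg : g ∈ G) (z : Cn d) :
    orbitTangent G (act (g : Mat d) z) =
      (orbitTangent G z).map ((actL d g).restrictScalars ℝ : Cn d →ₗ[ℝ] Cn d) := by
  rw [orbitTangent, orbitTangent, Submodule.map_span, ← Set.image_comp]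
  congr 1
  ext w
  constructor
  · rintro ⟨X, hX, rfl⟩
    exact ⟨_, star_conj_mem_lieAlg hX hg, (act_act_conj g X z).symm⟩
  · rintro ⟨X, hX, rfl⟩
    exact ⟨_, lieAlg_conj hX hg, act_conj_act g X z⟩

theorem act_SU_injective (g : SU d) : Function.Injective (act (g : Mat d)) := by
  intro a b h
  have := congrArg (act (star (g : Mat d))) h
  simpa [← act_mul, star_mul_self_of_SU] using this

theorem finrank_orbitTangent_act {g : SU d} (hg : g ∈ G) (z : Cn d) :
    Module.finrank ℝ (orbitTangent G (act (g : Mat d) z)) =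
      Module.finrank ℝ (orbitTangent G z) := by
  rw [orbitTangent_act hg]
  exact (Submodule.equivMapOfInjective _ (act_SU_injective g) _).finrank_eq.symm

theorem inner_im_orbitTangent (hG : IsCompact (G : Set (SU d))) {z : Cn d} (hz : z ∈ zeroLevel G)
    {u v : Cn d} (hu : u ∈ orbitTangent G z) (hv : v ∈ orbitTangent G z) :
    (inner ℂ u v).im = 0 := by
  obtain ⟨X, hX, rfl⟩ := (mem_orbitTangent hG).1 hu
  obtain ⟨Y, hY, rfl⟩ := (mem_orbitTangent hG).1 hv
  exact inner_act_act_im hz hX hY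

theorem inner_orbitTangent_self (hG : IsCompact (G : Set (SU d))) {z : Cn d}
    (hz : z ∈ zeroLevel G) {u : Cn d} (hu : u ∈ orbitTangent G z) : inner ℂ u z = 0 := by
  obtain ⟨X, hX, rfl⟩ := (mem_orbitTangent hG).1 hu
  exact inner_act_self hz hX

/-- A real orthonormal family on which the Kähler form vanishes is unitary. -/
theorem orthonormal_complex_of_real {ι : Type*} {ν : ι → Cn d} (h : Orthonormal ℝ ν)
    (him : ∀ i j, (inner ℂ (ν i) (ν j)).im = 0) : Orthonormal ℂ ν := by
  classical
  rw [orthonormal_iff_ite] at h ⊢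
  intro i j
  have h1 := h i j
  rw [real_inner_eq_re] at h1
  apply Complex.ext
  · rw [h1]; split_ifs <;> simp
  · rw [him]; split_ifs <;> simp

end CohomTwo

end

noncomputable section

open scoped Manifold ContDiff Matrix Matrix.Norms.L2Operator
open Filter Topology

namespace CohomTwo

/-! ## Moments of a measure with a cusp at `1` -/

open MeasureTheory

/-- By homogeneity only w = 1 + iτ matters, and there the real part is continuous at τ = 0 with
value 1. -/
theorem exists_re_pow_inv_ge (D : ℕ) : ∃ ε > 0, ∀ w : ℂ, 0 < w.re → |w.im| ≤ ε * w.re →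
    (1 / 2) * (w.re ^ D)⁻¹ ≤ ((w ^ D)⁻¹).re := by
  have hc : ContinuousAt (fun τ : ℝ => (((1 + τ * Complex.I : ℂ) ^ D)⁻¹).re) 0 := by
    refine Complex.continuous_re.continuousAt.comp (ContinuousAt.inv₀ ?_ (by simp))
    fun_prop
  have h1 : ∀ᶠ τ : ℝ in 𝓝 0, 1 / 2 < (((1 + τ * Complex.I : ℂ) ^ D)⁻¹).re := by
    refine hc.eventually (lt_mem_nhds ?_)
    simp
    norm_num
  obtain ⟨ε, hε, h⟩ := Metric.eventually_nhds_iff.1 h1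
  refine ⟨ε / 2, by positivity, fun w hw him => ?_⟩
  set τ : ℝ := w.im / w.re with hτ
  have hτε : dist τ 0 < ε := by
    rw [dist_zero_right, Real.norm_eq_abs, hτ, abs_div, abs_of_pos hw, div_lt_iff₀ hw]
    nlinarith
  have hw' : w = (w.re : ℂ) * (1 + τ * Complex.I) := by
    apply Complex.ext
    · simp
    · simp [hτ]; field_simp
  have h2 : (w ^ D)⁻¹ = (((w.re ^ D)⁻¹ : ℝ) : ℂ) * ((1 + τ * Complex.I : ℂ) ^ D)⁻¹ := by
    conv_lhs => rw [hw']
    rw [mul_pow, mul_inv]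
    push_cast
    rfl
  rw [h2, Complex.re_ofReal_mul]
  have h3 := h hτε
  have h4 : 0 < (w.re ^ D)⁻¹ := by positivity
  nlinarith

/-- Integrate the binomial series (1 − tζ)^(−(D+1)) = ∑ C(n+D, D) tⁿ ζⁿ termwise. What matters is
that the bound is uniform in t < 1. -/
theorem integral_inv_one_sub_pow {Ω : Type*} [MeasurableSpace Ω] (ν : Measure Ω)
    [IsProbabilityMeasure ν] {ζ : Ω → ℂ} (hζ : Measurable ζ) (h1 : ∀ x, ‖ζ x‖ ≤ 1) (D : ℕ) {t : ℝ}
    (ht0 : 0 ≤ t) (ht1 : t < 1) {C ρ : ℝ} (hρ0 : 0 ≤ ρ) (hρ1 : ρ < 1)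
    (hm : ∀ n : ℕ, ‖∫ x, ζ x ^ n ∂ν‖ ≤ C * ρ ^ n) :
    ‖∫ x, ((1 - t * ζ x) ^ (D + 1))⁻¹ ∂ν‖ ≤ C * (1 / (1 - ρ) ^ (D + 1)) := by
  have hC : 0 ≤ C := by have := (norm_nonneg _).trans (hm 0); simpa using this
  have hF : ∀ x, ∑' n : ℕ, (((n + D).choose D : ℂ) * t ^ n) * ζ x ^ n =
      ((1 - t * ζ x) ^ (D + 1))⁻¹ := by
    intro x
    have hlt : ‖(t : ℂ) * ζ x‖ < 1 := by
      rw [norm_mul, Complex.norm_real, Real.norm_of_nonneg ht0]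
      nlinarith [h1 x, norm_nonneg (ζ x)]
    rw [← one_div, ← tsum_choose_mul_geometric_of_norm_lt_one D hlt]
    exact tsum_congr fun n => by rw [mul_pow, mul_assoc]
  have hint : ∀ n : ℕ, Integrable (fun x => ζ x ^ n) ν := fun n =>
    Integrable.of_bound ((hζ.pow_const n).aestronglyMeasurable) 1 (Eventually.of_forall fun x => by
      rw [norm_pow]; exact pow_le_one₀ (norm_nonneg _) (h1 x))
  have hnorm : ∀ n : ℕ, ‖(((n + D).choose D : ℂ) * t ^ n)‖ = ((n + D).choose D : ℝ) * t ^ n := by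
    intro n
    rw [norm_mul, norm_pow, Complex.norm_real, Real.norm_of_nonneg ht0, Complex.norm_natCast]
  have hs1 : Summable fun n : ℕ => ((n + D).choose D : ℝ) * t ^ n :=
    summable_choose_mul_geometric_of_norm_lt_one D (by rwa [Real.norm_of_nonneg ht0])
  have hs2 : Summable fun n : ℕ => ((n + D).choose D : ℝ) * ρ ^ n :=
    summable_choose_mul_geometric_of_norm_lt_one D (by rwa [Real.norm_of_nonneg hρ0])
  have hsum := hasSum_integral_of_summable_integral_norm (μ := ν)
    (F := fun (n : ℕ) x => (((n + D).choose D : ℂ) * t ^ n) * ζ x ^ n)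
    (fun n => (hint n).const_mul _)
    (by
      refine Summable.of_nonneg_of_le (fun n => integral_nonneg fun x => norm_nonneg _)
        (fun n => ?_) hs1
      have : ∫ x, ‖(((n + D).choose D : ℂ) * t ^ n) * ζ x ^ n‖ ∂ν ≤
          ∫ x, ((n + D).choose D : ℝ) * t ^ n ∂ν := by
        refine integral_mono ((hint n).const_mul _).norm (integrable_const _) fun x => ?_
        simp only []
        rw [norm_mul, hnorm, norm_pow]
        exact mul_le_of_le_one_right (by positivity) (pow_le_one₀ (norm_nonneg _) (h1 x))
      simpa using this)
  simp only [hF] at hsum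
  rw [← hsum.tsum_eq]
  have hb : ∀ n : ℕ, ‖∫ x, (((n + D).choose D : ℂ) * t ^ n) * ζ x ^ n ∂ν‖ ≤
      C * (((n + D).choose D : ℝ) * ρ ^ n) := by
    intro n
    rw [integral_const_mul, norm_mul, hnorm]
    have h3 : t ^ n ≤ 1 := pow_le_one₀ ht0 ht1.le
    have h4 : (0 : ℝ) ≤ ((n + D).choose D : ℝ) := by positivity
    calc ((n + D).choose D : ℝ) * t ^ n * ‖∫ x, ζ x ^ n ∂ν‖
        ≤ ((n + D).choose D : ℝ) * 1 * (C * ρ ^ n) := by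
          gcongr
          exact hm n
      _ = _ := by ring
  refine (tsum_of_norm_bounded (hs2.mul_left C).hasSum hb).trans ?_
  rw [tsum_mul_left, tsum_choose_mul_geometric_of_norm_lt_one D
    (by rwa [Real.norm_of_nonneg hρ0])]

/-- If a measure on the closed unit disc is not too small near `1`, and approaches `1` only in a
cusp symmetric about the real axis, then its moments do not decay exponentially. -/
theorem not_forall_moment_le {Ω : Type*} [MeasurableSpace Ω] (ν : Measure Ω)
    [IsProbabilityMeasure ν] {ζ : Ω → ℂ} (hζ : Measurable ζ) (h1 : ∀ x, ‖ζ x‖ ≤ 1)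
    (hcusp : ∀ ε > 0, ∃ δ > 0, ∀ x, ‖1 - ζ x‖ < δ → |(ζ x).im| ≤ ε * (1 - (ζ x).re))
    {c : ℝ} (hc : 0 < c) (D : ℕ)
    (hmass : ∀ r : ℝ, 0 < r → r ≤ 1 → c * r ^ D ≤ ν.real {x | ‖1 - ζ x‖ < r})
    {C ρ : ℝ} (hρ0 : 0 ≤ ρ) (hρ1 : ρ < 1)
    (hm : ∀ n : ℕ, ‖∫ x, ζ x ^ n ∂ν‖ ≤ C * ρ ^ n) : False := by
  obtain ⟨ε, hε, hre⟩ := exists_re_pow_inv_ge (D + 1)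
  obtain ⟨δ', hδ', hδcusp'⟩ := hcusp ε hε
  set δ := min δ' 1 with hδdef
  have hδ : 0 < δ := by positivity
  have hδ1 : δ ≤ 1 := min_le_right _ _
  have hδcusp : ∀ x, ‖1 - ζ x‖ < δ → |(ζ x).im| ≤ ε * (1 - (ζ x).re) := fun x hx =>
    hδcusp' x (hx.trans_le (min_le_left _ _))
  set M := C * (1 / (1 - ρ) ^ (D + 1)) with hM
  -- M2 bounds the integrand where ‖1 − ζ‖ ≥ δ: there ‖1 − tζ‖ ≥ δ − r ≥ δ/2.
  set M2 := ((δ / 2) ^ (D + 1))⁻¹ with hM2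
  have hM2pos : 0 < M2 := by positivity
  -- Take t = 1 − r. Points with ‖1 − ζ‖ < r, of mass at least c r^D, contribute at least
  -- ½(2r)^(−(D+1)) each to the real part; the remaining points of the cusp contribute positively,
  -- and all others at least −M2.
  have key : ∀ r : ℝ, 0 < r → r ≤ δ / 2 →
      (1 / 2) * ((2 * r) ^ (D + 1))⁻¹ * (c * r ^ D) - M2 ≤ M := by
    intro r hr hrδ
    set t := 1 - r with ht
    have ht0 : 0 ≤ t := by linarith
    have ht1 : t < 1 := by linarith
    have hI := integral_inv_one_sub_pow ν hζ h1 D ht0 ht1 hρ0 hρ1 hm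
    set S := {x | ‖1 - ζ x‖ < r} with hS
    have hSm : MeasurableSet S := measurableSet_lt (by fun_prop) measurable_const
    have hrele : ∀ x, (ζ x).re ≤ 1 := fun x => (Complex.re_le_norm _).trans (h1 x)
    have hpos : ∀ x, 0 < (1 - t * ζ x).re := by
      intro x
      simp
      nlinarith [hrele x]
    have hlow : ∀ x, S.indicator (fun _ => (1 / 2) * ((2 * r) ^ (D + 1))⁻¹) x - M2 ≤
        (((1 - t * ζ x) ^ (D + 1))⁻¹).re := by
      intro x
      by_cases hx : ‖1 - ζ x‖ < δ
      · have him : |(1 - t * ζ x).im| ≤ ε * (1 - t * ζ x).re := by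
          have h2 := hδcusp x hx
          simp only [Complex.sub_im, Complex.one_im, Complex.re_ofReal_mul, Complex.im_ofReal_mul,
            zero_sub, abs_neg, Complex.sub_re, Complex.one_re, abs_mul, abs_of_nonneg ht0]
          have h3 : t * |(ζ x).im| ≤ t * (ε * (1 - (ζ x).re)) := by gcongr
          have h4 : t * (ε * (1 - (ζ x).re)) = ε * (t - t * (ζ x).re) := by ring
          have h5 : ε * (t - t * (ζ x).re) ≤ ε * (1 - t * (ζ x).re) := by gcongr
          linarith
        have h2 := hre _ (hpos x) him
        by_cases hxS : x ∈ S
        · rw [Set.indicator_of_mem hxS]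
          -- 1 − t Re ζ = r + t(1 − Re ζ), and both summands are at most r.
          have h3 : (1 - t * ζ x).re ≤ 2 * r := by
            have h4 : 1 - (ζ x).re ≤ ‖1 - ζ x‖ := by
              have := Complex.re_le_norm (1 - ζ x); simpa using this
            have h5 : ‖1 - ζ x‖ < r := hxS
            have h6 : t * (1 - (ζ x).re) ≤ 1 * r := by
              refine mul_le_mul ht1.le (h4.trans h5.le) ?_ zero_le_one
              linarith [hrele x]
            simp only [Complex.sub_re, Complex.one_re, Complex.re_ofReal_mul]
            nlinarith
          have h7 : ((2 * r) ^ (D + 1))⁻¹ ≤ ((1 - t * ζ x).re ^ (D + 1))⁻¹ := by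
            have := hpos x
            gcongr
          linarith
        · rw [Set.indicator_of_notMem hxS]
          have : 0 < ((1 - t * ζ x).re ^ (D + 1))⁻¹ := by have := hpos x; positivity
          linarith
      · have hxS : x ∉ S := fun h => hx (lt_of_lt_of_le h (by linarith))
        rw [Set.indicator_of_notMem hxS]
        have h2 : δ / 2 ≤ ‖1 - t * ζ x‖ := by
          have h3 : 1 - ζ x = (1 - t * ζ x) - (r : ℂ) * ζ x := by rw [ht]; push_cast; ring
          have h4 := norm_sub_le (1 - t * ζ x) ((r : ℂ) * ζ x)
          rw [← h3, norm_mul, Complex.norm_real, Real.norm_of_nonneg hr.le] at h4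
          have h5 : r * ‖ζ x‖ ≤ r * 1 := by gcongr; exact h1 x
          linarith [not_lt.1 hx]
        have h3 : ‖((1 - t * ζ x) ^ (D + 1))⁻¹‖ ≤ M2 := by
          rw [norm_inv, norm_pow]
          exact inv_anti₀ (by positivity) (pow_le_pow_left₀ (by positivity) h2 _)
        have h4 := neg_le_of_abs_le ((Complex.abs_re_le_norm _).trans h3)
        linarith
    have hint : Integrable (fun x => ((1 - t * ζ x) ^ (D + 1))⁻¹) ν := by
      refine Integrable.of_bound (C := (r ^ (D + 1))⁻¹)
        (Measurable.aestronglyMeasurable (by fun_prop)) (Eventually.of_forall fun x => ?_)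
      rw [norm_inv, norm_pow]
      refine inv_anti₀ (by positivity) (pow_le_pow_left₀ hr.le ?_ _)
      have h4 := norm_sub_norm_le (1 : ℂ) (t * ζ x)
      rw [norm_mul, Complex.norm_real, Real.norm_of_nonneg ht0, norm_one] at h4
      nlinarith [h1 x]
    have hint2 : Integrable (fun x => S.indicator (fun _ => (1 / 2) * ((2 * r) ^ (D + 1))⁻¹) x) ν :=
      (integrable_const _).indicator hSm
    have h2 := integral_mono (hint2.sub (integrable_const M2)) hint.re hlow
    simp only [Pi.sub_apply] at h2
    rw [integral_sub hint2 (integrable_const _), integral_indicator hSm] at h2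
    simp only [integral_const, measureReal_restrict_apply_univ, probReal_univ, smul_eq_mul,
      one_mul] at h2
    have h4 : ∫ x, RCLike.re ((1 - (t : ℂ) * ζ x) ^ (D + 1))⁻¹ ∂ν =
        RCLike.re (∫ x, ((1 - (t : ℂ) * ζ x) ^ (D + 1))⁻¹ ∂ν) := integral_re hint
    rw [h4] at h2
    have h3 := (RCLike.re_le_norm _).trans hI
    have h5 := hmass r hr (by linarith)
    have h6 : (0 : ℝ) < (1 / 2) * ((2 * r) ^ (D + 1))⁻¹ := by positivity
    have h7 := mul_le_mul_of_nonneg_left h5 h6.le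
    linarith
  -- The exponent D + 1 exceeds that of the mass bound by one, so a factor r⁻¹ survives. Multiplied
  -- by r, the inequality bounds a positive constant by a multiple of r, which fails as r → 0.
  have key2 : ∀ r : ℝ, 0 < r → r ≤ δ / 2 → c / 2 ^ (D + 2) ≤ (M + M2) * r := by
    intro r hr hrδ
    have h2 := key r hr hrδ
    have h3 : (1 / 2) * ((2 * r) ^ (D + 1))⁻¹ * (c * r ^ D) = c / 2 ^ (D + 2) / r := by
      rw [mul_pow]
      field_simp
      ring
    rw [h3] at h2
    have h4 : c / 2 ^ (D + 2) / r ≤ M + M2 := by linarith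
    rwa [div_le_iff₀ hr] at h4
  have hlim : Tendsto (fun r : ℝ => (M + M2) * r) (𝓝[>] 0) (𝓝 0) := by
    have : Tendsto (fun r : ℝ => (M + M2) * r) (𝓝 0) (𝓝 ((M + M2) * 0)) :=
      (continuous_const.mul continuous_id).tendsto 0
    rw [mul_zero] at this
    exact this.mono_left nhdsWithin_le_nhds
  have h5 : c / 2 ^ (D + 2) ≤ 0 := by
    refine ge_of_tendsto hlim ?_
    filter_upwards [Ioc_mem_nhdsGT (show (0 : ℝ) < δ / 2 by positivity)] with r hr
    exact key2 r hr.1 hr.2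
  have h6 : 0 < c / 2 ^ (D + 2) := by positivity
  linarith

/-! ## The Haar measure of small balls -/

/-- Compute the measure of {(x, g) : ‖x − ρ(g)‖ < r/2} in both orders. Slices at fixed g are balls
of radius r/2 in the matrix space; slices at fixed x have measure at most that of the r-ball about
1, by left invariance. The exponent is the real dimension of the matrix space, far from sharp but
sufficient. -/
theorem exists_le_measure_ball {K : Type*} [Group K] [TopologicalSpace K] [IsTopologicalGroup K]
    [MeasurableSpace K] [BorelSpace K] (ν : Measure K) [IsProbabilityMeasure ν]
    [ν.IsMulLeftInvariant] {d : ℕ} (ρ : K → Mat d) (hρ : Continuous ρ) (hρ1 : ∀ g, ‖ρ g‖ ≤ 1)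
    (hdist : ∀ g h k, ‖ρ (k * g) - ρ (k * h)‖ = ‖ρ g - ρ h‖) (hone : ρ 1 = 1) :
    ∃ c > 0, ∃ D : ℕ, ∀ r : ℝ, 0 < r → r ≤ 1 → c * r ^ D ≤ ν.real {g | ‖ρ g - 1‖ < r} := by
  let _ : MeasurableSpace (Mat d) := borel _
  have : BorelSpace (Mat d) := ⟨rfl⟩
  have : SecondCountableTopology (Mat d) := inferInstance
  set vol : Measure (Mat d) := Measure.addHaar
  set n := Module.finrank ℝ (Mat d)
  have hB1 : 0 < vol.real (Metric.ball 0 1) :=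
    ENNReal.toReal_pos (Metric.measure_ball_pos vol _ one_pos).ne' measure_ball_lt_top.ne
  have hB2 : 0 < vol.real (Metric.ball 0 2) :=
    ENNReal.toReal_pos (Metric.measure_ball_pos vol _ two_pos).ne' measure_ball_lt_top.ne
  refine ⟨(1 / 2) ^ n * vol.real (Metric.ball 0 1) / vol.real (Metric.ball 0 2),
    by positivity, n, fun r hr hr1 => ?_⟩
  set m := ν {g | ‖ρ g - 1‖ < r} with hm
  set A : Set (Mat d × K) := {p | ‖p.1 - ρ p.2‖ < r / 2} with hA
  have hAm : MeasurableSet A :=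
    measurableSet_lt ((measurable_fst.sub (hρ.measurable.comp measurable_snd)).norm)
      measurable_const
  have h1 : vol.prod ν A = ENNReal.ofReal ((r / 2) ^ n) * vol (Metric.ball 0 1) := by
    rw [Measure.prod_apply_symm hAm]
    have : ∀ g : K, vol ((fun x => (x, g)) ⁻¹' A) =
        ENNReal.ofReal ((r / 2) ^ n) * vol (Metric.ball 0 1) := by
      intro g
      rw [← Measure.addHaar_ball_of_pos vol (ρ g) (half_pos hr)]
      congr 1
      ext x
      simp [hA, dist_eq_norm]
    simp [this]
  have h2 : vol.prod ν A ≤ m * vol (Metric.ball 0 2) := by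
    rw [Measure.prod_apply hAm]
    -- A nonempty slice lies in a left translate of the r-ball about 1, and it forces ‖x‖ < 1 + r/2
    -- < 2 because ‖ρ‖ ≤ 1.
    have h3 : ∀ x : Mat d, ν (Prod.mk x ⁻¹' A) ≤ (Metric.ball (0 : Mat d) 2).indicator
        (fun _ => m) x := by
      intro x
      by_cases hne : (Prod.mk x ⁻¹' A).Nonempty
      · obtain ⟨h, hh⟩ := hne
        have hh' : ‖x - ρ h‖ < r / 2 := hh
        have hx : x ∈ Metric.ball (0 : Mat d) 2 := by
          rw [mem_ball_zero_iff]
          have := norm_add_le (x - ρ h) (ρ h)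
          rw [sub_add_cancel] at this
          linarith [hρ1 h]
        rw [Set.indicator_of_mem hx, hm, ← measure_preimage_mul ν h⁻¹ {g | ‖ρ g - 1‖ < r}]
        refine measure_mono fun g hg => ?_
        have hg' : ‖x - ρ g‖ < r / 2 := hg
        have h4 : ‖ρ (h⁻¹ * g) - 1‖ = ‖ρ g - ρ h‖ := by
          rw [← hdist g h h⁻¹, inv_mul_cancel, hone]
        change ‖ρ (h⁻¹ * g) - 1‖ < r
        rw [h4]
        have h5 := norm_sub_le (x - ρ h) (x - ρ g)
        rw [sub_sub_sub_cancel_left] at h5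
        linarith
      · rw [Set.not_nonempty_iff_eq_empty.1 hne, measure_empty]
        exact zero_le
    refine (lintegral_mono h3).trans ?_
    rw [lintegral_indicator Metric.isOpen_ball.measurableSet]
    simp
  rw [h1] at h2
  have h4 := ENNReal.toReal_mono (ENNReal.mul_ne_top (measure_ne_top _ _) measure_ball_lt_top.ne) h2
  rw [ENNReal.toReal_mul, ENNReal.toReal_mul, ENNReal.toReal_ofReal (by positivity)] at h4
  rw [div_mul_eq_mul_div, div_le_iff₀ hB2]
  calc (1 / 2) ^ n * vol.real (Metric.ball 0 1) * r ^ n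
      = (r / 2) ^ n * vol.real (Metric.ball 0 1) := by rw [div_pow, div_pow]; ring
    _ ≤ _ := h4

end CohomTwo

end

noncomputable section

open scoped Manifold ContDiff Matrix Matrix.Norms.L2Operator
open Filter Topology

namespace CohomTwo

open MeasureTheory

/-! ## Invariant holomorphic functions -/

variable {k : ℕ} {G : Subgroup (SU (k + 1))}

theorem orthonormal_snoc {n d : ℕ} {ν : Fin n → Cn d} (hν : Orthonormal ℂ ν) {u : Cn d}
    (hu : ‖u‖ = 1) (h : ∀ i, inner ℂ (ν i) u = 0) :
    Orthonormal ℂ (Fin.snoc (α := fun _ => Cn d) ν u) := by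
  rw [orthonormal_iff_ite] at hν ⊢
  have h' : ∀ i, inner ℂ u (ν i) = 0 := fun i => by rw [← inner_conj_symm, h, map_zero]
  intro i j
  refine Fin.lastCases ?_ (fun i => ?_) i <;> refine Fin.lastCases ?_ (fun j => ?_) j
  · simp [inner_self_eq_norm_sq_to_K, hu]
  · simp [h', (Fin.castSucc_lt_last j).ne']
  · simp [h, (Fin.castSucc_lt_last i).ne]
  · simp [hν]

/-- An orthonormal basis of the tangent space to the orbit. -/
theorem exists_orthonormal_orbitTangent {d n : ℕ} {G : Subgroup (SU d)} {p : Cn d}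
    (hdim : Module.finrank ℝ (orbitTangent G p) = n) :
    ∃ ν : Fin n → Cn d, Orthonormal ℝ ν ∧
      Submodule.span ℝ (Set.range ν) = orbitTangent G p := by
  set b := (stdOrthonormalBasis ℝ (orbitTangent G p)).reindex (finCongr hdim)
  refine ⟨fun i => (b i : Cn d), ?_, ?_⟩
  · exact b.orthonormal.comp_linearIsometry (orbitTangent G p).subtypeₗᵢ
  · have h1 := congrArg (Submodule.map (orbitTangent G p).subtype) b.toBasis.span_eq
    rw [Submodule.map_span, ← Set.range_comp, Submodule.map_top, Submodule.range_subtype] at h1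
    refine Eq.trans ?_ h1
    congr 2

/-- Isotropy makes a real orthonormal basis of 𝔤p unitary, and it is Hermitian orthogonal to p;
these k + 1 directions fill ℂ^(k+1). So p has an open orbit under the complexified group and the
scalars, infinitesimally. -/
theorem exists_eq_act_add_act_add_smul (hG : IsCompact (G : Set (SU (k + 1)))) {p : Cn (k + 1)}
    (hp : p ∈ zeroLevel G) (hp0 : p ≠ 0) (hdim : Module.finrank ℝ (orbitTangent G p) = k)
    (w : Cn (k + 1)) :
    ∃ X ∈ lieAlg G, ∃ Y ∈ lieAlg G, ∃ c : ℂ,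
      act X p + Complex.I • act Y p + c • p = w := by
  obtain ⟨ν, hν, hspan⟩ := exists_orthonormal_orbitTangent hdim
  have hmem : ∀ i, ν i ∈ orbitTangent G p := fun i =>
    hspan ▸ Submodule.subset_span (Set.mem_range_self i)
  have hνc : Orthonormal ℂ ν := orthonormal_complex_of_real hν fun i j =>
    inner_im_orbitTangent hG hp (hmem i) (hmem j)
  set u : Cn (k + 1) := ((‖p‖⁻¹ : ℝ) : ℂ) • p with hu
  have hpn : ‖p‖ ≠ 0 := norm_ne_zero_iff.2 hp0
  have hu1 : ‖u‖ = 1 := by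
    rw [hu, norm_smul, Complex.norm_real, norm_inv, norm_norm, inv_mul_cancel₀ hpn]
  have ho := orthonormal_snoc hνc hu1 fun i => by
    rw [hu, inner_smul_right, inner_orbitTangent_self hG hp (hmem i), mul_zero]
  have htop := ho.linearIndependent.span_eq_top_of_card_eq_finrank' (by simp)
  have hw : w ∈ Submodule.span ℂ (Set.range (Fin.snoc (α := fun _ => Cn (k + 1)) ν u)) := by
    rw [htop]; trivial
  obtain ⟨a, ha⟩ := (Submodule.mem_span_range_iff_exists_fun ℂ).1 hw
  rw [Fin.sum_univ_castSucc] at ha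
  simp only [Fin.snoc_castSucc, Fin.snoc_last] at ha
  choose X hX hXν using fun i => (mem_orbitTangent hG).1 (hmem i)
  set 𝔤 := (isClosedGroup_matrices hG).lie
  refine ⟨∑ i, (a i.castSucc).re • X i, ?_, ∑ i, (a i.castSucc).im • X i, ?_,
    a (Fin.last k) * ((‖p‖⁻¹ : ℝ) : ℂ), ?_⟩
  · exact 𝔤.sum_mem fun i _ => 𝔤.smul_mem _ (hX i)
  · exact 𝔤.sum_mem fun i _ => 𝔤.smul_mem _ (hX i)
  · rw [← ha, hu, smul_smul]
    congr 1
    have h1 : ∀ r : Fin k → ℝ, act (∑ i, r i • X i) p = ∑ i, (r i : ℂ) • ν i := by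
      intro r
      rw [← orbitMapL_apply, map_sum]
      refine Finset.sum_congr rfl fun i _ => ?_
      rw [orbitMapL_apply, act_real_smul_left, hXν]
      simp
    rw [h1, h1, Finset.smul_sum, ← Finset.sum_add_distrib]
    refine Finset.sum_congr rfl fun i _ => ?_
    rw [smul_smul, ← add_smul]
    congr 1
    rw [mul_comm]
    exact Complex.re_add_im _

/-- Invariant holomorphic functions are invariant under the complexified Lie algebra. -/
theorem apply_act_exp_complex {d : ℕ} {G : Subgroup (SU d)} {h : Cn d → ℂ} (hh : Differentiable ℂ h)
    (hinv : ∀ g ∈ G, ∀ w, h (act (g : Mat d) w) = h w)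
    {X Y : Mat d} (hX : X ∈ lieAlg G) (hY : Y ∈ lieAlg G) (w : Cn d) :
    h (act (NormedSpace.exp (X + Complex.I • Y)) w) = h w := by
  -- Invariance kills the differential of h on Xw, and complex linearity of the differential then
  -- kills it on iYw.
  have hzero : ∀ X ∈ lieAlg G, ∀ w, fderiv ℂ h w (act X w) = 0 := by
    intro X hX w
    have h1 := ((hh w).hasFDerivAt.restrictScalars ℝ)
    have h2 := hasDerivAt_act_exp' X w 0
    have h3 : HasFDerivAt h ((fderiv ℂ h w).restrictScalars ℝ)
        (act (NormedSpace.exp ((0 : ℝ) • X)) w) := by simpa using h1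
    have h4 := h3.comp_hasDerivAt (0 : ℝ) h2
    have h5 : (h ∘ fun t : ℝ => act (NormedSpace.exp (t • X)) w) = fun _ => h w := by
      funext t
      obtain ⟨g, hg, he⟩ := hX t
      simp only [Function.comp, ← he]
      exact hinv g hg w
    rw [h5] at h4
    simpa using h4.unique (hasDerivAt_const _ _)
  set W := X + Complex.I • Y with hW
  have hWzero : ∀ w, fderiv ℂ h w (act W w) = 0 := by
    intro w
    rw [hW, act_add_left, act_smul_left, map_add, map_smul, hzero X hX, hzero Y hY]
    simp
  have hd : ∀ t : ℝ, HasDerivAt (fun t : ℝ => h (act (NormedSpace.exp (t • W)) w)) 0 t := by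
    intro t
    have h4 := ((hh _).hasFDerivAt.restrictScalars ℝ).comp_hasDerivAt t (hasDerivAt_act_exp' W w t)
    simp only [ContinuousLinearMap.coe_restrictScalars', hWzero] at h4
    exact h4
  have hconst := is_const_of_deriv_eq_zero (fun t => (hd t).differentiableAt)
    (fun t => (hd t).deriv) 1 0
  simpa using hconst

/-- A homogeneous invariant holomorphic function is determined by its value at a point of the zero
level of the moment map whose orbit has codimension one among isotropic submanifolds. -/
theorem invariant_eq_zero (hG : IsCompact (G : Set (SU (k + 1)))) {p : Cn (k + 1)}
    (hp : p ∈ zeroLevel G) (hp0 : p ≠ 0) (hdim : Module.finrank ℝ (orbitTangent G p) = k)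
    {h : Cn (k + 1) → ℂ} (hh : Differentiable ℂ h)
    (hinv : ∀ g ∈ G, ∀ w, h (act (g : Mat (k + 1)) w) = h w)
    {n : ℕ} (hhom : ∀ (c : ℂ) w, h (c • w) = c ^ n * h w) (h0 : h p = 0) (w : Cn (k + 1)) :
    h w = 0 := by
  set 𝔤 := (isClosedGroup_matrices hG).lie with h𝔤
  set A : 𝔤 × 𝔤 × ℂ →L[ℝ] Mat (k + 1) :=
    𝔤.subtypeL ∘L ContinuousLinearMap.fst ℝ _ _ +
    (Complex.I • (𝔤.subtypeL ∘L ContinuousLinearMap.fst ℝ _ _ ∘L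
      ContinuousLinearMap.snd ℝ 𝔤 (𝔤 × ℂ))) with hA
  set cc : 𝔤 × 𝔤 × ℂ →L[ℝ] ℂ := ContinuousLinearMap.snd ℝ _ _ ∘L
    ContinuousLinearMap.snd ℝ 𝔤 (𝔤 × ℂ) with hcc
  have hAapp : ∀ v, A v = (v.1 : Mat (k + 1)) + Complex.I • (v.2.1 : Mat (k + 1)) := fun v => rfl
  -- The derivative of Ψ at (0, 0, 1) is (X, Y, c) ↦ Xp + iYp + cp, which is onto. Hence Ψ covers a
  -- neighbourhood of p, on which h vanishes, and the identity theorem on the complex line from p to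
  -- w finishes the argument.
  set Ψ : 𝔤 × 𝔤 × ℂ → Cn (k + 1) := fun v => cc v • act (NormedSpace.exp (A v)) p with hΨ
  set v0 : 𝔤 × 𝔤 × ℂ := (0, 0, 1) with hv0
  have hA0 : A v0 = 0 := by simp [hAapp, hv0]
  have hc0 : cc v0 = 1 := rfl
  have h1 : HasStrictFDerivAt (fun v => act (NormedSpace.exp (A v)) p)
      (((orbitMapL p).restrictScalars ℝ) ∘L A) v0 := by
    have h2 : HasStrictFDerivAt (NormedSpace.exp : Mat (k + 1) → Mat (k + 1))
        (ContinuousLinearMap.id ℝ (Mat (k + 1))) (A v0) := by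
      rw [hA0]; exact hasStrictFDerivAt_exp'_zero
    exact (((orbitMapL p).restrictScalars ℝ).hasStrictFDerivAt.comp v0
      (h2.comp v0 A.hasStrictFDerivAt))
  have hΨd := cc.hasStrictFDerivAt (x := v0) |>.smul h1
  have hsurj : (cc v0 • (((orbitMapL p).restrictScalars ℝ) ∘L A) +
      cc.smulRight (act (NormedSpace.exp (A v0)) p)).range = ⊤ := by
    rw [LinearMap.range_eq_top]
    intro w
    obtain ⟨X, hX, Y, hY, c, hw⟩ := exists_eq_act_add_act_add_smul hG hp hp0 hdim w
    refine ⟨(⟨X, hX⟩, ⟨Y, hY⟩, c), ?_⟩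
    simp only [hc0, hA0, one_smul, NormedSpace.exp_zero, act_one]
    rw [← hw, ← act_smul_left, ← act_add_left]
    rfl
  have hmap := hΨd.map_nhds_eq_of_surj hsurj
  have hΨ0 : cc v0 • act (NormedSpace.exp (A v0)) p = p := by simp [hc0, hA0]
  simp only [Pi.smul_apply', hΨ0] at hmap
  have hev : ∀ᶠ w in 𝓝 p, h w = 0 := by
    rw [← hmap, eventually_map]
    refine Eventually.of_forall fun v => ?_
    change h (cc v • act (NormedSpace.exp (A v)) p) = 0
    rw [hhom, hAapp, apply_act_exp_complex hh hinv v.1.2 v.2.1.2, h0, mul_zero]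
  set f : ℂ → ℂ := fun t => h (p + t • (w - p)) with hf
  have hfd : Differentiable ℂ f := hh.comp (by fun_prop)
  have hf0 : f =ᶠ[𝓝 0] fun _ => 0 := by
    have hc : Tendsto (fun t : ℂ => p + t • (w - p)) (𝓝 0) (𝓝 p) := by
      have : Continuous (fun t : ℂ => p + t • (w - p)) := by fun_prop
      have h2 := this.tendsto 0
      simpa using h2
    exact hc.eventually hev
  have hfz := AnalyticOnNhd.eq_of_eventuallyEq (fun z _ => hfd.analyticAt z)
    (fun z _ => analyticAt_const) hf0
  have := congrFun hfz 1
  simpa [hf] using this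

end CohomTwo

end

noncomputable section

open scoped Manifold ContDiff Matrix Matrix.Norms.L2Operator
open Filter Topology

namespace CohomTwo

open MeasureTheory

/-! ## The matrix coefficients of the action near their maximum -/

section Cusp

variable {d : ℕ} {G : Subgroup (SU d)}

/-- The curve exp(tX)v has constant speed ‖Xv‖, because exp(tX) is unitary and commutes with X. -/
theorem norm_act_exp_smul_sub_le {X : Mat d} (hX : X ∈ lieAlg G) (v : Cn d) {t : ℝ}
    (ht : t ∈ Set.Icc (0 : ℝ) 1) : ‖act (NormedSpace.exp (t • X)) v - v‖ ≤ ‖act X v‖ := by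
  have h1 := norm_image_sub_le_of_norm_deriv_le_segment'
    (f := fun t : ℝ => act (NormedSpace.exp (t • X)) v) (C := ‖act X v‖) (a := 0) (b := 1)
    (fun t _ => (hasDerivAt_act_exp' X v t).hasDerivWithinAt) (fun t _ => by
      obtain ⟨g, -, he⟩ := hX t
      have : act X (act (NormedSpace.exp (t • X)) v) = act (NormedSpace.exp (t • X)) (act X v) := by
        rw [← act_mul, ← act_mul]
        congr 1
        exact ((Commute.refl X).smul_right t).exp_right
      rw [this, ← he, norm_act (star_mul_self_of_SU g)]) t ht
  simp only [zero_smul, NormedSpace.exp_zero, act_one, sub_zero] at h1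
  exact h1.trans (mul_le_of_le_one_right (norm_nonneg _) ht.2)

theorem one_sub_re_inner_act (g : SU d) {z : Cn d} (hz1 : ‖z‖ = 1) :
    1 - (inner ℂ (act (g : Mat d) z) z).re = (1 / 2) * ‖act (g : Mat d) z - z‖ ^ 2 := by
  have h := norm_sub_sq (𝕜 := ℂ) (act (g : Mat d) z) z
  rw [norm_act (star_mul_self_of_SU g), hz1] at h
  have : RCLike.re (inner ℂ (act (g : Mat d) z) z) = (inner ℂ (act (g : Mat d) z) z).re := rfl
  rw [this] at h
  linarith

/-- Put y = exp(tX)z = z + tXz + r. The derivative of Im⟨y, z⟩ is −Im⟨y, Xz⟩, in which z contributes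
0 by the moment map, tXz contributes a real number, and r is bounded by ‖X‖‖Xz‖. So the imaginary
part is at most ‖X‖‖Xz‖², whereas 1 − Re = ½‖y − z‖² at t = 1 is at least ‖Xz‖²/8. -/
theorem abs_im_inner_act_exp_le {z : Cn d} (hz : z ∈ zeroLevel G) (hz1 : ‖z‖ = 1) {X : Mat d}
    (hX : X ∈ lieAlg G) (hX1 : ‖X‖ ≤ 1 / 2) :
    |(inner ℂ (act (NormedSpace.exp X) z) z).im| ≤
      8 * ‖X‖ * (1 - (inner ℂ (act (NormedSpace.exp X) z) z).re) := by
  set y : ℝ → Cn d := fun t => act (NormedSpace.exp (t • X)) z with hy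
  have hyd : ∀ t, HasDerivAt y (act X (y t)) t := hasDerivAt_act_exp' X z
  set r : ℝ → Cn d := fun t => y t - z - t • act X z with hr
  have hcomm : ∀ t, act X (y t) = act (NormedSpace.exp (t • X)) (act X z) := fun t => by
    rw [hy, ← act_mul, ← act_mul]
    congr 1
    exact ((Commute.refl X).smul_right t).exp_right
  have hrd : ∀ t, HasDerivAt r (act X (y t) - act X z) t := fun t => by
    have := ((hyd t).sub_const z).sub ((hasDerivAt_id t).smul_const (act X z))
    simp only [one_smul] at this
    exact this
  have hrb : ∀ t ∈ Set.Icc (0 : ℝ) 1, ‖r t‖ ≤ ‖X‖ * ‖act X z‖ := by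
    intro t ht
    have h1 := norm_image_sub_le_of_norm_deriv_le_segment' (f := r) (C := ‖X‖ * ‖act X z‖)
      (a := 0) (b := 1) (fun t _ => (hrd t).hasDerivWithinAt) (fun t ht => by
        rw [hcomm]
        exact (norm_act_exp_smul_sub_le hX _ ⟨ht.1, ht.2.le⟩).trans (norm_act_le _ _)) t ht
    have hr0 : r 0 = 0 := by simp [hr, hy]
    rw [hr0, sub_zero, sub_zero] at h1
    exact h1.trans (mul_le_of_le_one_right (by positivity) ht.2)
  set f : ℝ → ℝ := fun t => (inner ℂ (y t) z).im with hf
  have hfd : ∀ t, HasDerivAt f (-(inner ℂ (r t) (act X z)).im) t := by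
    intro t
    have h1 := (hyd t).inner ℂ (hasDerivAt_const t z)
    have h2 := Complex.imCLM.hasFDerivAt.comp_hasDerivAt t h1
    have h3 : (inner ℂ (act X (y t)) z).im = -(inner ℂ (r t) (act X z)).im := by
      have h4 : y t = r t + z + (t : ℂ) • act X z := by
        simp only [hr, Complex.coe_smul]
        abel
      rw [inner_act_lie hX]
      conv_lhs => rw [h4]
      rw [inner_add_left, inner_add_left, inner_self_act hz hX, inner_smul_left]
      have h5 : (inner ℂ (act X z) (act X z)).im = 0 := inner_self_im (𝕜 := ℂ) (act X z)
      rw [Complex.conj_ofReal, add_zero, Complex.neg_im, Complex.add_im, Complex.im_ofReal_mul, h5,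
        mul_zero, add_zero]
    simp only [inner_zero_right, zero_add, Complex.imCLM_apply, h3] at h2
    exact h2
  have him : |f 1| ≤ ‖X‖ * ‖act X z‖ ^ 2 := by
    have h1 := norm_image_sub_le_of_norm_deriv_le_segment' (f := f)
      (C := ‖X‖ * ‖act X z‖ * ‖act X z‖)
      (a := 0) (b := 1) (fun t _ => (hfd t).hasDerivWithinAt) (fun t ht => by
        rw [norm_neg]
        refine (Complex.abs_im_le_norm _).trans ((norm_inner_le_norm _ _).trans ?_)
        gcongr
        exact hrb t ⟨ht.1, ht.2.le⟩) 1 (by simp)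
    have hf0 : f 0 = 0 := by
      simp only [hf, hy, zero_smul, NormedSpace.exp_zero, act_one]
      exact inner_self_im (𝕜 := ℂ) z
    rw [hf0, sub_zero, sub_zero, mul_one, Real.norm_eq_abs] at h1
    linarith
  -- Since ‖X‖ ≤ 1/2, the remainder takes away at most half of Xz.
  have hy1 : ‖act X z‖ / 2 ≤ ‖y 1 - z‖ := by
    have h1 := hrb 1 (by simp)
    have h2 : act X z = (y 1 - z) - r 1 := by simp [hr]
    have h3 := norm_sub_le (y 1 - z) (r 1)
    rw [← h2] at h3
    have h4 : ‖X‖ * ‖act X z‖ ≤ 1 / 2 * ‖act X z‖ := by gcongr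
    linarith
  obtain ⟨g, hg, he⟩ := hX 1
  have hre := one_sub_re_inner_act g hz1
  have hy1' : y 1 = act (g : Mat d) z := by rw [hy, he]
  rw [one_smul] at he
  rw [← he, hre, ← hy1']
  have h5 : |(inner ℂ (y 1) z).im| ≤ ‖X‖ * ‖act X z‖ ^ 2 := him
  have h6 : ‖act X z‖ ^ 2 ≤ 4 * ‖y 1 - z‖ ^ 2 := by nlinarith [norm_nonneg (act X z)]
  have h7 : ‖X‖ * ‖act X z‖ ^ 2 ≤ ‖X‖ * (4 * ‖y 1 - z‖ ^ 2) := by gcongr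
  calc |(inner ℂ (y 1) z).im| ≤ ‖X‖ * (4 * ‖y 1 - z‖ ^ 2) := h5.trans h7
    _ = _ := by ring

/-- Elements of `G` near `1` are exponentials of small elements of the Lie algebra. -/
theorem eventually_eq_exp (hG : IsCompact (G : Set (SU d))) {η : ℝ} (hη : 0 < η) :
    ∀ᶠ g : G in 𝓝 1, ∃ X ∈ lieAlg G, ‖X‖ < η ∧ ((g : SU d) : Mat d) = NormedSpace.exp X := by
  set hΓ := isClosedGroup_matrices hG
  obtain ⟨P, hP⟩ := Submodule.exists_isCompl hΓ.lie
  set a : Mat d →L[ℝ] Mat d :=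
    LinearMap.toContinuousLinearMap (hΓ.lie.subtype ∘ₗ Submodule.projectionOnto _ _ hP) with ha
  have haapp : ∀ X, a X = (Submodule.projectionOnto _ _ hP X : Mat d) := fun X => rfl
  have ha1 : ∀ X ∈ hΓ.lie, a X = X := fun X hX => by
    rw [haapp, Submodule.projectionOnto_apply_left hP ⟨X, hX⟩]
  have hamem : ∀ X, a X ∈ hΓ.lie := fun X => by rw [haapp]; exact SetLike.coe_mem _
  have hU : {X | ‖a X‖ < η} ∈ 𝓝 (0 : Mat d) := by
    have : Tendsto (fun X => ‖a X‖) (𝓝 0) (𝓝 0) := by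
      have := (a.continuous.norm).tendsto 0
      simpa using this
    exact this.eventually (gt_mem_nhds hη)
  -- With a the projection to the Lie algebra along a complement and b = 0, the product is a single
  -- exponential.
  have h := hΓ.eventually_eq_exp_mul_exp a 0 (ContinuousLinearMap.id ℝ _ - a) (by simp) hamem
    (fun X => by simp)
    (fun X => by simp [ha1 _ (hamem X)]) (fun X hX h => by
      rw [← h]; simp [ha1 X hX]) hU
  have hcont : Tendsto (fun g : G => ((g : SU d) : Mat d)) (𝓝 1) (𝓝[matrices G] 1) := by
    refine tendsto_nhdsWithin_iff.2 ⟨?_, Eventually.of_forall fun g => ⟨g, g.2, rfl⟩⟩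
    exact (continuous_subtype_val.comp continuous_subtype_val).tendsto (1 : G)
  filter_upwards [hcont.eventually h] with g hg
  obtain ⟨X, hX, he⟩ := hg
  exact ⟨a X, hamem X, hX, by simpa using he⟩

theorem eventually_abs_im_inner_act_le (hG : IsCompact (G : Set (SU d))) {z : Cn d}
    (hz : z ∈ zeroLevel G) (hz1 : ‖z‖ = 1) {ε : ℝ} (hε : 0 < ε) :
    ∀ᶠ g : G in 𝓝 1, |(inner ℂ (act ((g : SU d) : Mat d) z) z).im| ≤
      ε * (1 - (inner ℂ (act ((g : SU d) : Mat d) z) z).re) := by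
  have hη : 0 < min (ε / 8) (1 / 2) := by positivity
  filter_upwards [eventually_eq_exp hG hη] with g ⟨X, hX, hXη, he⟩
  have h1 := abs_im_inner_act_exp_le hz hz1 hX (hXη.le.trans (min_le_right _ _))
  rw [← he] at h1
  refine h1.trans ?_
  have h2 : ‖X‖ < ε / 8 := hXη.trans_le (min_le_left _ _)
  have h3 := one_sub_re_inner_act (g : SU d) hz1
  rw [h3]
  gcongr
  linarith

/-- To first order, 1 − Re and Im add under multiplication near 1. The cross terms are at most a
fraction of the defects 1 − Re α and 1 − Re β, and the factor 4 absorbs them. -/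
theorem cusp_mul {α β : ℂ} {ε : ℝ} (hε0 : 0 < ε) (hε : ε ≤ 1 / 2) (hα : ‖α‖ ≤ 1) (hβ : ‖β‖ ≤ 1)
    (hα2 : 1 / 2 ≤ α.re) (hβ2 : 1 / 2 ≤ β.re)
    (h1 : |α.im| ≤ ε * (1 - α.re)) (h2 : |β.im| ≤ ε * (1 - β.re)) :
    |(α * β).im| ≤ 4 * ε * (1 - (α * β).re) := by
  have ha : α.re ≤ 1 := (Complex.re_le_norm _).trans hα
  have hb : β.re ≤ 1 := (Complex.re_le_norm _).trans hβ
  rw [Complex.mul_im, Complex.mul_re]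
  obtain ⟨h1a, h1b⟩ := abs_le.1 h1
  obtain ⟨h2a, h2b⟩ := abs_le.1 h2
  have h3 : |α.im * β.im| ≤ (1 - α.re) * (1 - β.re) / 4 := by
    rw [abs_mul]
    have h4 : |α.im| ≤ (1 - α.re) / 2 := h1.trans (by nlinarith)
    have h5 : |β.im| ≤ (1 - β.re) / 2 := h2.trans (by nlinarith)
    calc |α.im| * |β.im| ≤ (1 - α.re) / 2 * ((1 - β.re) / 2) := by gcongr
      _ = _ := by ring
  obtain ⟨h3a, h3b⟩ := abs_le.1 h3
  have h6 : ((1 - α.re) + (1 - β.re)) / 4 ≤ 1 - (α.re * β.re - α.im * β.im) := by nlinarith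
  have h7 : |α.re * β.im + α.im * β.re| ≤ ε * ((1 - α.re) + (1 - β.re)) := by
    refine (abs_add_le _ _).trans ?_
    rw [abs_mul, abs_mul, abs_of_nonneg (by linarith : 0 ≤ α.re),
      abs_of_nonneg (by linarith : 0 ≤ β.re)]
    have h8 : α.re * |β.im| ≤ 1 * (ε * (1 - β.re)) := by gcongr
    have h9 : |α.im| * β.re ≤ ε * (1 - α.re) * 1 :=
      mul_le_mul h1 hb (by linarith) (mul_nonneg hε0.le (by linarith))
    linarith
  refine h7.trans ?_
  nlinarith

end Cusp

/-- Outside the interior of the good set ‖1 − ζ‖ is positive on a compact set, hence bounded below.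
-/
theorem exists_forall_of_eventually_eq_one {Ω : Type*} [TopologicalSpace Ω] [CompactSpace Ω]
    {ζ : Ω → ℂ} (hζ : Continuous ζ) {P : Ω → Prop}
    (hP : ∀ x, ζ x = 1 → ∀ᶠ y in 𝓝 x, P y) : ∃ δ > 0, ∀ x, ‖1 - ζ x‖ < δ → P x := by
  set U := interior {x | P x}
  have hU : ∀ x ∈ Uᶜ, 0 < ‖1 - ζ x‖ := by
    intro x hx
    rw [norm_pos_iff, sub_ne_zero]
    intro h
    exact hx (mem_interior_iff_mem_nhds.2 (hP x h.symm))
  obtain ⟨δ, hδ, h⟩ := (isOpen_interior.isClosed_compl.isCompact (s := Uᶜ)).exists_forall_le'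
    (f := fun x => ‖1 - ζ x‖) (by fun_prop) hU
  refine ⟨δ, hδ, fun x hx => ?_⟩
  by_contra hPx
  exact absurd (h x fun hxU => hPx (interior_subset hxU)) (not_le.2 hx)

end CohomTwo

end

noncomputable section

open scoped Manifold ContDiff Matrix Matrix.Norms.L2Operator
open Filter Topology

namespace CohomTwo

open MeasureTheory

/-! ## Averaged powers of matrix coefficients -/

section Kernel

variable {d : ℕ} {G : Subgroup (SU d)}

theorem continuous_act_coe (z : Cn d) : Continuous fun g : G => act ((g : SU d) : Mat d) z :=
  (orbitMapL z).continuous.comp (continuous_subtype_val.comp continuous_subtype_val)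

theorem continuous_inner_act (z w : Cn d) :
    Continuous fun g : G => inner ℂ (act ((g : SU d) : Mat d) z) w :=
  (continuous_act_coe z).inner continuous_const

variable [MeasurableSpace G] [BorelSpace G]

/-- The average over `G` of the `n`-th power of `⟨g z, w⟩`. -/
def avgPow (ν : Measure G) (n : ℕ) (z w : Cn d) : ℂ :=
  ∫ g : G, (inner ℂ (act ((g : SU d) : Mat d) z) w) ^ n ∂ν

theorem differentiable_avgPow [CompactSpace G] (ν : Measure G) [IsProbabilityMeasure ν] (n : ℕ)
    (z : Cn d) : Differentiable ℂ (avgPow ν n z) := by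
  -- w ↦ (g ↦ ⟨gz, w⟩) is continuous linear into the Banach algebra C(G, ℂ), and integration is
  -- continuous linear out of it. The average is then a power map between two linear maps.
  set e : Cn d →L[ℂ] C(G, ℂ) := LinearMap.mkContinuous
    { toFun := fun w => ⟨fun g : G => inner ℂ (act ((g : SU d) : Mat d) z) w,
        continuous_inner_act z w⟩
      map_add' := fun u v => by
        ext g
        exact inner_add_right (𝕜 := ℂ) (act ((g : SU d) : Mat d) z) u v
      map_smul' := fun c v => by
        ext g
        exact inner_smul_right (𝕜 := ℂ) (act ((g : SU d) : Mat d) z) v c } ‖z‖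
    (fun w => by
      refine (ContinuousMap.norm_le _ (by positivity)).2 fun g => ?_
      refine (norm_inner_le_norm (𝕜 := ℂ) (act ((g : SU d) : Mat d) z) w).trans ?_
      rw [norm_act (star_mul_self_of_SU _)]) with he
  have hint : ∀ f : C(G, ℂ), Integrable f ν := fun f =>
    f.continuous.integrable_of_hasCompactSupport (HasCompactSupport.of_compactSpace f)
  set Λ : C(G, ℂ) →L[ℂ] ℂ := LinearMap.mkContinuous
    { toFun := fun f => ∫ g, f g ∂ν
      map_add' := fun f₁ f₂ => integral_add (hint f₁) (hint f₂)
      map_smul' := fun c f => integral_const_mul c f } 1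
    (fun f => by
      have := norm_integral_le_of_norm_le_const (μ := ν) (f := f) (C := ‖f‖)
        (Eventually.of_forall fun g => f.norm_coe_le_norm g)
      simpa using this) with hΛ
  have : avgPow ν n z = fun w => Λ ((e w) ^ n) := rfl
  rw [this]
  fun_prop

/-- Substitute g ↦ hg, which preserves the measure, and use that h is unitary. -/
theorem avgPow_act (ν : Measure G) [ν.IsMulLeftInvariant] (n : ℕ) (z w : Cn d) (h : G) :
    avgPow ν n z (act ((h : SU d) : Mat d) w) = avgPow ν n z w := by
  rw [avgPow, ← integral_mul_left_eq_self _ h]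
  refine integral_congr_ae (Eventually.of_forall fun g => ?_)
  simp only []
  congr 1
  rw [show (((h * g : G) : SU d) : Mat d) = ((h : SU d) : Mat d) * ((g : SU d) : Mat d) from rfl,
    act_mul, inner_act_act (star_mul_self_of_SU _)]

omit [BorelSpace G] in
theorem avgPow_smul (ν : Measure G) (n : ℕ) (z w : Cn d) (c : ℂ) :
    avgPow ν n z (c • w) = c ^ n * avgPow ν n z w := by
  simp only [avgPow, inner_smul_right, mul_pow]
  exact integral_const_mul _ _

omit [BorelSpace G] in
theorem norm_avgPow_le (ν : Measure G) [IsProbabilityMeasure ν] (n : ℕ) {z w : Cn d} {ρ : ℝ}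
    (h : ∀ g : G, ‖inner ℂ (act ((g : SU d) : Mat d) z) w‖ ≤ ρ) : ‖avgPow ν n z w‖ ≤ ρ ^ n := by
  have := norm_integral_le_of_norm_le_const (μ := ν) (C := ρ ^ n)
    (f := fun g : G => (inner ℂ (act ((g : SU d) : Mat d) z) w) ^ n)
    (Eventually.of_forall fun g => by rw [norm_pow]; gcongr; exact h g)
  rwa [probReal_univ, mul_one] at this

end Kernel

/-! ### Equality in Cauchy–Schwarz, and products of two matrix coefficients -/

theorem norm_one_sub_mul_le {α β : ℂ} (hα : ‖α‖ ≤ 1) : ‖1 - α * β‖ ≤ ‖1 - α‖ + ‖1 - β‖ := by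
  have : 1 - α * β = (1 - α) + α * (1 - β) := by ring
  rw [this]
  refine (norm_add_le _ _).trans ?_
  rw [norm_mul]
  have := mul_le_of_le_one_left (norm_nonneg (1 - β)) hα
  linarith

theorem norm_inner_act_le {d : ℕ} (g : SU d) {z w : Cn d} (hz : ‖z‖ = 1) (hw : ‖w‖ = 1) :
    ‖inner ℂ (act (g : Mat d) z) w‖ ≤ 1 := by
  refine (norm_inner_le_norm _ _).trans ?_
  rw [norm_act (star_mul_self_of_SU g), hz, hw, mul_one]

theorem norm_one_sub_inner_act_le {d : ℕ} (g : SU d) {z : Cn d} (hz : ‖z‖ = 1) :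
    ‖1 - inner ℂ (act (g : Mat d) z) z‖ ≤ ‖(g : Mat d) - 1‖ := by
  have h1 : (1 : ℂ) - inner ℂ (act (g : Mat d) z) z = - inner ℂ (act ((g : Mat d) - 1) z) z := by
    rw [act_sub_left, inner_sub_left, act_one, inner_self_eq_norm_sq_to_K, hz]
    simp
  rw [h1, norm_neg]
  refine (norm_inner_le_norm _ _).trans ?_
  have := norm_act_le ((g : Mat d) - 1) z
  rw [hz, mul_one] at this ⊢
  exact this

theorem exists_act_eq_smul_of_norm_inner {d : ℕ} (g : SU d) {z w : Cn d} (hz : ‖z‖ = 1)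
    (hw : ‖w‖ = 1) (h : ‖inner ℂ (act (g : Mat d) z) w‖ = 1) :
    ∃ c : ℂ, c ≠ 0 ∧ w = c • act (g : Mat d) z := by
  have hgz : ‖act (g : Mat d) z‖ = 1 := by rw [norm_act (star_mul_self_of_SU g), hz]
  have h1 := (norm_inner_eq_norm_iff (𝕜 := ℂ) (x := act (g : Mat d) z) (y := w)
    (by rw [← norm_ne_zero_iff, hgz]; exact one_ne_zero)
    (by rw [← norm_ne_zero_iff, hw]; exact one_ne_zero)).1 (by rw [h, hgz, hw, mul_one])
  exact h1

/-- Near an element that multiplies `z` by a phase, the matrix coefficient is that phase times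
a matrix coefficient near the identity. -/
theorem inner_act_mul_of_smul {d : ℕ} (g h : SU d) {z : Cn d} {c : ℂ}
    (hz : ‖z‖ = 1) (hc : z = c • act (h : Mat d) z) :
    inner ℂ (act (g : Mat d) z) z = inner ℂ (act (h : Mat d) z) z *
      inner ℂ (act ((g * h⁻¹ : SU d) : Mat d) z) z := by
  set b := inner ℂ z (act (h : Mat d) z) with hb
  have hh : act (h : Mat d) z = b • z := by
    have hn : ‖act (h : Mat d) z‖ = 1 := by rw [norm_act (star_mul_self_of_SU h), hz]
    have hcn : ‖c‖ = 1 := by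
      have := congrArg norm hc
      rw [norm_smul, hn, hz, mul_one] at this
      exact this.symm
    have hc0 : c ≠ 0 := by rw [← norm_ne_zero_iff, hcn]; exact one_ne_zero
    have h1 : act (h : Mat d) z = c⁻¹ • z := by
      rw [eq_inv_smul_iff₀ hc0]; exact hc.symm
    have h2 : b = c⁻¹ := by
      rw [hb, h1, inner_smul_right, inner_self_eq_norm_sq_to_K, hz]; simp
    rw [h1, h2]
  have h3 : act (g : Mat d) z = b • act ((g * h⁻¹ : SU d) : Mat d) z := by
    rw [← act_smul_right, ← hh, ← act_mul]
    congr 1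
    have : g = g * h⁻¹ * h := by group
    conv_lhs => rw [this]
    rfl
  rw [h3, inner_smul_left, hb, inner_conj_symm]

theorem eventually_half_le_re_inner_act {d : ℕ} {G : Subgroup (SU d)} {q : Cn d} (hq : ‖q‖ = 1) :
    ∀ᶠ g : G in 𝓝 1, 1 / 2 ≤ (inner ℂ (act ((g : SU d) : Mat d) q) q).re := by
  have h1 := (Complex.continuous_re.comp (continuous_inner_act (G := G) q q)).tendsto 1
  have h2 : (Complex.re ∘ fun g : G => inner ℂ (act ((g : SU d) : Mat d) q) q) 1 = 1 := by
    have : act (((1 : G) : SU d) : Mat d) q = q := act_one q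
    simp only [Function.comp, this, inner_self_eq_norm_sq_to_K, hq]
    simp
  rw [h2] at h1
  filter_upwards [h1.eventually (lt_mem_nhds (show (1 / 2 : ℝ) < 1 by norm_num))] with g hg
  exact hg.le

/-- The product of the normalised matrix coefficients at `z` and `p`. -/
def coeffMul {d : ℕ} {G : Subgroup (SU d)} (z p : Cn d) (u : G × G) : ℂ :=
  inner ℂ (act ((u.1 : SU d) : Mat d) z) z * inner ℂ (act ((u.2 : SU d) : Mat d) p) p

theorem norm_coeffMul_le {d : ℕ} {G : Subgroup (SU d)} {z p : Cn d} (hz : ‖z‖ = 1) (hp : ‖p‖ = 1)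
    (u : G × G) : ‖coeffMul z p u‖ ≤ 1 := by
  rw [coeffMul, norm_mul]
  exact mul_le_one₀ (norm_inner_act_le _ hz hz) (norm_nonneg _) (norm_inner_act_le _ hp hp)

theorem continuous_coeffMul {d : ℕ} {G : Subgroup (SU d)} (z p : Cn d) :
    Continuous (coeffMul (G := G) z p) :=
  ((continuous_inner_act z z).comp continuous_fst).mul
    ((continuous_inner_act p p).comp continuous_snd)

/-- If the product of two numbers in the unit disc is 1, both have modulus 1. By equality in
Cauchy–Schwarz the components of u multiply z and p by phases, and the product of these phases is 1.
So the behaviour of the coefficient near u is its behaviour near the identity. -/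
theorem coeffMul_mul_inv {d : ℕ} {G : Subgroup (SU d)} {z p : Cn d} (hz : ‖z‖ = 1) (hp : ‖p‖ = 1)
    {u : G × G} (hu : coeffMul z p u = 1) (v : G × G) :
    coeffMul z p (v * u⁻¹) = coeffMul z p v := by
  have hn : ‖inner ℂ (act ((u.1 : SU d) : Mat d) z) z‖ *
      ‖inner ℂ (act ((u.2 : SU d) : Mat d) p) p‖ = 1 := by
    rw [← norm_mul]
    have := congrArg norm hu
    rwa [norm_one] at this
  have hn1 := norm_inner_act_le (u.1 : SU d) hz hz
  have hn2 := norm_inner_act_le (u.2 : SU d) hp hp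
  obtain ⟨c1, -, hc1⟩ := exists_act_eq_smul_of_norm_inner (u.1 : SU d) hz hz
    (by nlinarith [norm_nonneg (inner ℂ (act ((u.1 : SU d) : Mat d) z) z)])
  obtain ⟨c2, -, hc2⟩ := exists_act_eq_smul_of_norm_inner (u.2 : SU d) hp hp
    (by nlinarith [norm_nonneg (inner ℂ (act ((u.2 : SU d) : Mat d) p) p)])
  have e1 := inner_act_mul_of_smul (v.1 : SU d) (u.1 : SU d) hz hc1
  have e2 := inner_act_mul_of_smul (v.2 : SU d) (u.2 : SU d) hp hc2
  have e3 : coeffMul z p v = coeffMul z p u * coeffMul z p (v * u⁻¹) := by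
    rw [coeffMul, coeffMul, e1, e2]
    exact mul_mul_mul_comm _ _ _ _
  rw [e3, hu, one_mul]

/-- The value 1 may be attained far from the identity, but `coeffMul_mul_inv` moves each such point
to (1, 1), where the estimates for the two factors combine by `cusp_mul`. Compactness makes δ
uniform. -/
theorem exists_cusp_coeffMul {d : ℕ} {G : Subgroup (SU d)} (hG : IsCompact (G : Set (SU d)))
    {z p : Cn d} (hz : z ∈ zeroLevel G) (hp : p ∈ zeroLevel G) (hz1 : ‖z‖ = 1) (hp1 : ‖p‖ = 1)
    {ε : ℝ} (hε : 0 < ε) : ∃ δ > 0, ∀ u : G × G, ‖1 - coeffMul z p u‖ < δ →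
      |(coeffMul z p u).im| ≤ ε * (1 - (coeffMul z p u).re) := by
  have : CompactSpace G := isCompact_iff_compactSpace.1 hG
  refine exists_forall_of_eventually_eq_one (continuous_coeffMul z p) fun u hu => ?_
  set η := min (ε / 4) (1 / 2) with hη
  have hη0 : 0 < η := by positivity
  have ht : Tendsto (fun v : G × G => v * u⁻¹) (𝓝 u) (𝓝 1) := by
    have h1 : Tendsto (fun v : G × G => v * u⁻¹) (𝓝 u) (𝓝 (u * u⁻¹)) :=
      (continuous_mul_const u⁻¹).tendsto u
    rwa [mul_inv_cancel] at h1
  have ht1 : Tendsto (fun v : G × G => (v * u⁻¹).1) (𝓝 u) (𝓝 1) :=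
    (continuous_fst.tendsto (1 : G × G)).comp ht
  have ht2 : Tendsto (fun v : G × G => (v * u⁻¹).2) (𝓝 u) (𝓝 1) :=
    (continuous_snd.tendsto (1 : G × G)).comp ht
  filter_upwards [ht1.eventually (eventually_abs_im_inner_act_le hG hz hz1 hη0),
    ht2.eventually (eventually_abs_im_inner_act_le hG hp hp1 hη0),
    ht1.eventually (eventually_half_le_re_inner_act hz1),
    ht2.eventually (eventually_half_le_re_inner_act hp1)] with v h1 h2 h3 h4
  have h5 := cusp_mul hη0 (min_le_right _ _)
    (norm_inner_act_le ((v * u⁻¹).1 : SU d) hz1 hz1)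
    (norm_inner_act_le ((v * u⁻¹).2 : SU d) hp1 hp1) h3 h4 h1 h2
  rw [← coeffMul_mul_inv hz1 hp1 hu v]
  refine h5.trans ?_
  have h7 : 0 ≤ 1 - (coeffMul z p (v * u⁻¹)).re := by
    have h8 := norm_coeffMul_le hz1 hp1 (v * u⁻¹)
    linarith [(Complex.re_le_norm (coeffMul z p (v * u⁻¹))).trans h8]
  have h9 : 4 * η ≤ ε := by
    have := min_le_left (ε / 4) (1 / 2 : ℝ)
    linarith
  exact mul_le_mul_of_nonneg_right h9 h7

/-- A product of two Haar balls of radius r/2 lies in the set, since ‖1 − αβ‖ ≤ ‖1 − α‖ + ‖1 − β‖ in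
the unit disc. -/
theorem exists_le_measure_coeffMul {d : ℕ} {G : Subgroup (SU d)} [MeasurableSpace G] [BorelSpace G]
    (ν : Measure G) [IsProbabilityMeasure ν] [ν.IsMulLeftInvariant]
    {z p : Cn d} (hz1 : ‖z‖ = 1) (hp1 : ‖p‖ = 1) :
    ∃ c > 0, ∃ D : ℕ, ∀ r : ℝ, 0 < r → r ≤ 1 →
      c * r ^ D ≤ (ν.prod ν).real {u | ‖1 - coeffMul z p u‖ < r} := by
  obtain ⟨c, hc, D, hball⟩ := exists_le_measure_ball ν
    (fun g : G => ((g : SU d) : Mat d))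
    (continuous_subtype_val.comp continuous_subtype_val) (fun g => norm_SU_le _)
    (fun g h u => by
      have h1 : ∀ a : G, (((u * a : G) : SU d) : Mat d) =
        ((u : SU d) : Mat d) * ((a : SU d) : Mat d) := fun a => rfl
      rw [h1, h1, ← mul_sub]
      exact CStarRing.norm_mem_unitary_mul _
        (Matrix.mem_specialUnitaryGroup_iff.1 (u : SU d).2).1) rfl
  refine ⟨c ^ 2 * (1 / 2) ^ (D + D), by positivity, D + D, fun r hr hr1 => ?_⟩
  have h1 := hball (r / 2) (by positivity) (by linarith)
  set B := {g : G | ‖((g : SU d) : Mat d) - 1‖ < r / 2} with hB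
  have h2 : B ×ˢ B ⊆ {u | ‖1 - coeffMul z p u‖ < r} := by
    rintro u ⟨hu1, hu2⟩
    have h3 := norm_one_sub_mul_le (β := inner ℂ (act ((u.2 : SU d) : Mat d) p) p)
      (norm_inner_act_le (u.1 : SU d) hz1 hz1)
    have h4 := norm_one_sub_inner_act_le (u.1 : SU d) hz1
    have h5 := norm_one_sub_inner_act_le (u.2 : SU d) hp1
    have hu1' : ‖((u.1 : SU d) : Mat d) - 1‖ < r / 2 := hu1
    have hu2' : ‖((u.2 : SU d) : Mat d) - 1‖ < r / 2 := hu2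
    exact lt_of_le_of_lt h3 (by linarith)
  refine le_trans ?_ (measureReal_mono h2)
  rw [measureReal_prod_prod]
  calc c ^ 2 * (1 / 2) ^ (D + D) * r ^ (D + D) = (c * (r / 2) ^ D) * (c * (r / 2) ^ D) := by
        rw [div_pow, div_pow, pow_add, pow_add, one_pow]; ring
    _ ≤ _ := by gcongr

/-- Two points of the zero level of the moment map are on the same complex line, up to `G`, if the
orbit of one of them has the largest possible dimension. -/
theorem exists_act_eq_smul {k : ℕ} {G : Subgroup (SU (k + 1))}
    (hG : IsCompact (G : Set (SU (k + 1)))) {z p : Cn (k + 1)}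
    (hz : z ∈ zeroLevel G) (hp : p ∈ zeroLevel G) (hz1 : ‖z‖ = 1) (hp1 : ‖p‖ = 1)
    (hdim : Module.finrank ℝ (orbitTangent G p) = k) :
    ∃ g ∈ G, ∃ c : ℂ, c ≠ 0 ∧ p = c • act (g : Mat (k + 1)) z := by
  by_contra hcon
  have hp0 : p ≠ 0 := by rw [← norm_ne_zero_iff, hp1]; exact one_ne_zero
  have : CompactSpace G := isCompact_iff_compactSpace.1 hG
  let _ : MeasurableSpace G := borel G
  have : BorelSpace G := ⟨rfl⟩
  set ν : Measure G := Measure.haarMeasure ⊤ with hν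
  have hprob : IsProbabilityMeasure ν := ⟨by
    have := Measure.haarMeasure_self (G := G) (K₀ := ⊤)
    simpa using this⟩
  -- If no element of G moves z into the line of p, Cauchy–Schwarz is strict for every g, and
  -- uniformly so by compactness.
  obtain ⟨ρ, hρ0, hρ1, hρ⟩ : ∃ ρ : ℝ, 0 ≤ ρ ∧ ρ < 1 ∧
      ∀ g : G, ‖inner ℂ (act ((g : SU (k + 1)) : Mat (k + 1)) z) p‖ ≤ ρ := by
    obtain ⟨g, -, hg⟩ := isCompact_univ.exists_isMaxOn (Set.univ_nonempty (α := G))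
      (continuous_inner_act z p).norm.continuousOn
    refine ⟨_, norm_nonneg _, lt_of_le_of_ne (norm_inner_act_le (g : SU (k + 1)) hz1 hp1) fun h => ?_,
      fun g' => hg (Set.mem_univ g')⟩
    obtain ⟨c, hc0, hc⟩ := exists_act_eq_smul_of_norm_inner (g : SU (k + 1)) hz1 hp1 h
    exact hcon ⟨g, g.2, c, hc0, hc⟩
  have hρ' : ∀ g : G, ‖inner ℂ (act ((g : SU (k + 1)) : Mat (k + 1)) p) z‖ ≤ ρ := by
    intro g
    have h1 : inner ℂ (act ((g : SU (k + 1)) : Mat (k + 1)) p) z =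
        inner ℂ p (act (((g⁻¹ : G) : SU (k + 1)) : Mat (k + 1)) z) := inner_act_left _ _ _
    rw [h1, ← inner_conj_symm, RCLike.norm_conj]
    exact hρ _
  -- the averaged powers have rank one
  have hrank : ∀ n, avgPow ν n z z * avgPow ν n p p = avgPow ν n p z * avgPow ν n z p := by
    intro n
    -- The combination is invariant, holomorphic, homogeneous of degree n and zero at w = p, hence
    -- zero everywhere; the identity sought is its value at w = z.
    have h1 := invariant_eq_zero hG hp hp0 hdim
      (h := fun w => avgPow ν n z w * avgPow ν n p p - avgPow ν n p w * avgPow ν n z p) (n := n)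
      (((differentiable_avgPow ν n z).mul_const _).sub ((differentiable_avgPow ν n p).mul_const _))
      (fun g hg w => by rw [avgPow_act ν n z w ⟨g, hg⟩, avgPow_act ν n p w ⟨g, hg⟩])
      (fun c w => by rw [avgPow_smul, avgPow_smul]; ring) (by ring) z
    exact sub_eq_zero.1 h1
  have hζm : Measurable (coeffMul (G := G) z p) :=
    ((continuous_inner_act z z).measurable.comp measurable_fst).mul
      ((continuous_inner_act p p).measurable.comp measurable_snd)
  obtain ⟨c, hc, D, hmass⟩ := exists_le_measure_coeffMul ν hz1 hp1
  refine not_forall_moment_le (ν.prod ν) hζm (norm_coeffMul_le hz1 hp1)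
    (fun ε hε => exists_cusp_coeffMul hG hz hp hz1 hp1 hε) hc D hmass hρ0 hρ1 (C := 1)
    (fun n => ?_)
  -- By Fubini the moments factor into the diagonal averages, and the rank one identity replaces
  -- these by the mixed ones. Bounding one mixed average by ρⁿ and the other by 1 is enough.
  have h1 : ∫ u, coeffMul z p u ^ n ∂(ν.prod ν) = avgPow ν n z z * avgPow ν n p p := by
    simp only [coeffMul, mul_pow]
    exact integral_prod_mul
      (fun g : G => (inner ℂ (act ((g : SU (k + 1)) : Mat (k + 1)) z) z) ^ n)
      (fun g : G => (inner ℂ (act ((g : SU (k + 1)) : Mat (k + 1)) p) p) ^ n)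
  rw [h1, hrank, norm_mul]
  exact mul_le_mul ((norm_avgPow_le ν n hρ').trans (pow_le_one₀ hρ0 hρ1.le))
    (norm_avgPow_le ν n hρ) (norm_nonneg _) zero_le_one

/-- All nonzero points of the zero level have orbits of codimension one among isotropic
submanifolds, as soon as one point has. -/
theorem finrank_orbitTangent_of_mem_zeroLevel {k : ℕ} {G : Subgroup (SU (k + 1))}
    (hG : IsCompact (G : Set (SU (k + 1)))) {z p : Cn (k + 1)}
    (hz : z ∈ zeroLevel G) (hp : p ∈ zeroLevel G) (hz0 : z ≠ 0)
    (hdim : Module.finrank ℝ (orbitTangent G p) = k) :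
    Module.finrank ℝ (orbitTangent G z) = k := by
  have hzn : ((‖z‖⁻¹ : ℝ) : ℂ) ≠ 0 := by simpa using hz0
  by_cases hp0 : p = 0
  -- The given point can be the origin only if k = 0. Then the ambient space is the line ℂz, and the
  -- tangent space of the orbit, being orthogonal to z, is zero.
  · have hk : k = 0 := by
      rw [← hdim, hp0]
      have : orbitTangent G (0 : Cn (k + 1)) = ⊥ := by
        rw [eq_bot_iff]
        intro w hw
        obtain ⟨X, -, rfl⟩ := (mem_orbitTangent hG).1 hw
        simp
      rw [this, finrank_bot]
    subst hk
    have : orbitTangent G z = ⊥ := by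
      rw [eq_bot_iff]
      intro w hw
      have h1 := inner_orbitTangent_self hG hz hw
      rw [PiLp.inner_apply, Fin.sum_univ_one] at h1
      have hsub : ∀ i : Fin (0 + 1), i = 0 := fun i => Fin.fin_one_eq_zero i
      have hz00 : z 0 ≠ 0 := fun h => hz0 (by ext i; rw [hsub i, h]; rfl)
      have h2 : w 0 = 0 := by simpa [hz00] using h1
      rw [Submodule.mem_bot]
      ext i
      rw [hsub i, h2]
      rfl
    rw [this, finrank_bot]
  · have hpn : ((‖p‖⁻¹ : ℝ) : ℂ) ≠ 0 := by simpa using hp0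
    have hunit : ∀ q : Cn (k + 1), q ≠ 0 → ‖((‖q‖⁻¹ : ℝ) : ℂ) • q‖ = 1 := fun q hq => by
      rw [norm_smul, Complex.norm_real, norm_inv, norm_norm,
        inv_mul_cancel₀ (norm_ne_zero_iff.2 hq)]
    obtain ⟨g, hg, c, hc0, hc⟩ := exists_act_eq_smul hG
      (smul_mem_zeroLevel hz ((‖z‖⁻¹ : ℝ) : ℂ)) (smul_mem_zeroLevel hp ((‖p‖⁻¹ : ℝ) : ℂ))
      (hunit z hz0) (hunit p hp0) (by rw [finrank_orbitTangent_smul hpn, hdim])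
    have h1 := congrArg (fun q => Module.finrank ℝ (orbitTangent G q)) hc
    simp only [finrank_orbitTangent_smul hpn, finrank_orbitTangent_smul hc0,
      finrank_orbitTangent_act hg, finrank_orbitTangent_smul hzn, hdim] at h1
    exact h1.symm

end CohomTwo

end

noncomputable section

open scoped Manifold ContDiff Matrix Matrix.Norms.L2Operator
open Filter Topology

namespace CohomTwo

/-! ## Plane curves -/

open ComplexConjugate

theorem hasDerivAt_integral_of_continuousOn {f : ℝ → ℝ} {I : Set ℝ} (hI : IsOpen I)
    (hI' : I.OrdConnected) (hf : ContinuousOn f I) {s x : ℝ} (hs : s ∈ I) (hx : x ∈ I) :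
    HasDerivAt (fun u => ∫ t in s..u, f t) (f x) x :=
  intervalIntegral.integral_hasDerivAt_right
    ((hf.mono (hI'.uIcc_subset hs hx)).intervalIntegrable)
    (hf.stronglyMeasurableAtFilter hI x hx) (hf.continuousAt (hI.mem_nhds hx))

theorem contDiffOn_integral {f : ℝ → ℝ} {I : Set ℝ} (hI : IsOpen I)
    (hI' : I.OrdConnected) (hf : ContDiffOn ℝ ∞ f I) {s : ℝ} (hs : s ∈ I) :
    ContDiffOn ℝ ∞ (fun u => ∫ t in s..u, f t) I := by
  have h := fun x hx => hasDerivAt_integral_of_continuousOn hI hI' hf.continuousOn hs (x := x) hx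
  rw [contDiffOn_infty_iff_deriv_of_isOpen hI]
  refine ⟨fun x hx => (h x hx).differentiableAt.differentiableWithinAt, ?_⟩
  exact hf.congr fun x hx => (h x hx).deriv

section Beta

variable {γ : ℝ → ℂ} {I : Set ℝ}

theorem contDiffOn_deriv_curve (hI : IsOpen I) (hγ : ContDiffOn ℝ ∞ γ I) :
    ContDiffOn ℝ ∞ (deriv γ) I :=
  ((contDiffOn_infty_iff_deriv_of_isOpen hI).1 hγ).2

theorem inner_I_mul (u v : ℂ) : inner ℝ u (Complex.I * v) = -(conj u * v).im := by
  simp [Complex.inner]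
  ring

theorem contDiffOn_im_conj_mul (hI : IsOpen I) (hγ : ContDiffOn ℝ ∞ γ I) :
    ContDiffOn ℝ ∞ (fun t => (conj (γ t) * deriv γ t).im) I := by
  have h1 : ContDiffOn ℝ ∞ (fun t => conj (γ t)) I :=
    Complex.conjCLE.contDiff.comp_contDiffOn hγ
  exact Complex.imCLM.contDiff.comp_contDiffOn (h1.mul (contDiffOn_deriv_curve hI hγ))

theorem contDiffOn_normSq (hγ : ContDiffOn ℝ ∞ γ I) : ContDiffOn ℝ ∞ (fun t => ‖γ t‖ ^ 2) I :=
  hγ.norm_sq ℝ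

theorem beta_eq (γ : ℝ → ℂ) (s : ℝ) :
    beta γ s = fun x => ∫ t in s..x, (conj (γ t) * deriv γ t).im := by
  funext x
  simp only [beta, inner_I_mul, intervalIntegral.integral_neg, neg_neg]

theorem betaTilde_eq (γ : ℝ → ℂ) (s : ℝ) :
    betaTilde γ s = fun x => ∫ t in s..x, ‖γ t‖ ^ 2 * (conj (γ t) * deriv γ t).im := by
  funext x
  simp only [betaTilde, inner_I_mul, mul_neg, intervalIntegral.integral_neg, neg_neg]

variable (hI : IsOpen I) (hI' : I.OrdConnected) (hγ : ContDiffOn ℝ ∞ γ I) {s x : ℝ}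
  (hs : s ∈ I)

include hI hI' hγ hs in
theorem hasDerivAt_beta (hx : x ∈ I) :
    HasDerivAt (beta γ s) (conj (γ x) * deriv γ x).im x := by
  rw [beta_eq]
  exact hasDerivAt_integral_of_continuousOn hI hI' (contDiffOn_im_conj_mul hI hγ).continuousOn hs hx

include hI hI' hγ hs in
theorem contDiffOn_beta : ContDiffOn ℝ ∞ (beta γ s) I := by
  rw [beta_eq]
  exact contDiffOn_integral hI hI' (contDiffOn_im_conj_mul hI hγ) hs

include hI hI' hγ hs in
theorem hasDerivAt_betaTilde (hx : x ∈ I) :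
    HasDerivAt (betaTilde γ s) (‖γ x‖ ^ 2 * (conj (γ x) * deriv γ x).im) x := by
  rw [betaTilde_eq]
  exact hasDerivAt_integral_of_continuousOn hI hI'
    ((contDiffOn_normSq hγ).mul (contDiffOn_im_conj_mul hI hγ)).continuousOn hs hx

include hI hI' hγ hs in
theorem contDiffOn_betaTilde : ContDiffOn ℝ ∞ (betaTilde γ s) I := by
  rw [betaTilde_eq]
  exact contDiffOn_integral hI hI' ((contDiffOn_normSq hγ).mul (contDiffOn_im_conj_mul hI hγ)) hs

end Beta

theorem hasDerivAt_normSq {γ : ℝ → ℂ} {γ' : ℂ} {x : ℝ} (h : HasDerivAt γ γ' x) :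
    HasDerivAt (fun t => ‖γ t‖ ^ 2) (2 * (conj (γ x) * γ').re) x := by
  have := h.norm_sq
  convert this using 2
  simp [Complex.inner]
  ring

theorem perp_eq {t : ℂ} (ht : t ≠ 0) (v : ℂ) :
    perp t v = ((v * conj t).im / ‖t‖ ^ 2 : ℝ) * (Complex.I * t) := by
  have hn : (‖t‖ ^ 2 : ℝ) ≠ 0 := by positivity
  have h1 : (t * conj t : ℂ) = ((‖t‖ ^ 2 : ℝ) : ℂ) := by rw [Complex.mul_conj']; push_cast; rfl
  have h2 : v * conj t = (inner ℝ t v : ℝ) + (v * conj t).im * Complex.I := by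
    have : inner ℝ t v = (v * conj t).re := by simp [Complex.inner]
    rw [this]
    exact (Complex.re_add_im _).symm
  have hnc : ((‖t‖ ^ 2 : ℝ) : ℂ) ≠ 0 := by exact_mod_cast hn
  rw [perp, Complex.real_smul]
  have hv : v = v * conj t * t / ((‖t‖ ^ 2 : ℝ) : ℂ) := by
    rw [eq_div_iff hnc, ← h1]; ring
  rw [Complex.ofReal_div, Complex.ofReal_div]
  linear_combination (t / ((‖t‖ ^ 2 : ℝ) : ℂ)) * h2 + hv

/-- The equation of a soliton curve, in scalar form. -/
theorem IsSolitonCurve.scalar_eq {k : ℕ} {a : ℝ} {γ : ℝ → ℂ} {I : Set ℝ}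
    (h : IsSolitonCurve k a γ I) {s : ℝ} (hs : s ∈ I) (h0 : γ s ≠ 0) :
    (deriv (deriv γ) s / deriv γ s).im + k * (deriv γ s / γ s).im +
      a * (conj (γ s) * deriv γ s).im = 0 := by
  have hd := h.2.1 s hs
  have h1 := h.2.2 s hs h0
  rw [curvatureVec, perp_eq hd, perp_eq hd] at h1
  have hn : ‖deriv γ s‖ ^ 2 ≠ 0 := by positivity
  have hg : ‖γ s‖ ^ 2 ≠ 0 := by positivity
  have h2 : (((1 / ‖deriv γ s‖ ^ 2) * ((deriv (deriv γ) s * conj (deriv γ s)).im / ‖deriv γ s‖ ^ 2)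
      - (k / ‖γ s‖ ^ 2) * ((γ s * conj (deriv γ s)).im / ‖deriv γ s‖ ^ 2)
      - a * ((γ s * conj (deriv γ s)).im / ‖deriv γ s‖ ^ 2) : ℝ) : ℂ) *
        (Complex.I * deriv γ s) = 0 := by
    simp only [Complex.real_smul] at h1
    push_cast at h1 ⊢
    linear_combination h1
  have h3 := (mul_eq_zero.1 h2).resolve_right (mul_ne_zero Complex.I_ne_zero hd)
  have h4 := Complex.ofReal_eq_zero.1 h3
  have e1 : (deriv (deriv γ) s / deriv γ s).im =
      (deriv (deriv γ) s * conj (deriv γ s)).im / ‖deriv γ s‖ ^ 2 := by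
    rw [← Complex.normSq_eq_norm_sq, Complex.div_im, Complex.mul_im, Complex.conj_re,
      Complex.conj_im]
    ring
  have e2 : (deriv γ s / γ s).im = -(γ s * conj (deriv γ s)).im / ‖γ s‖ ^ 2 := by
    rw [← Complex.normSq_eq_norm_sq, Complex.div_im, Complex.mul_im, Complex.conj_re,
      Complex.conj_im]
    ring
  have e3 : (conj (γ s) * deriv γ s).im = -(γ s * conj (deriv γ s)).im := by
    simp only [Complex.mul_im, Complex.conj_re, Complex.conj_im]
    ring
  rw [e1, e2, e3]
  have h5 : ‖deriv γ s‖ ^ 2 * ((1 / ‖deriv γ s‖ ^ 2) *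
      ((deriv (deriv γ) s * conj (deriv γ s)).im / ‖deriv γ s‖ ^ 2)
      - (k / ‖γ s‖ ^ 2) * ((γ s * conj (deriv γ s)).im / ‖deriv γ s‖ ^ 2)
      - a * ((γ s * conj (deriv γ s)).im / ‖deriv γ s‖ ^ 2)) = 0 := by rw [h4, mul_zero]
  rw [← h5]
  field_simp
  ring

/-- f/f̄ is exp(2i arg f), and the derivative of arg f is Im(f'/f). Using this quotient avoids
choosing a branch of the argument. -/
theorem hasDerivAt_div_conj {f : ℝ → ℂ} {f' : ℂ} {x : ℝ} (h : HasDerivAt f f' x) (h0 : f x ≠ 0) :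
    HasDerivAt (fun t => f t / conj (f t))
      ((2 * (f' / f x).im * Complex.I) * (f x / conj (f x))) x := by
  have hc : HasDerivAt (fun t => conj (f t)) (conj f') x :=
    (Complex.conjCLE : ℂ →L[ℝ] ℂ).hasFDerivAt.comp_hasDerivAt x h
  have h0' : conj (f x) ≠ 0 := by simpa using h0
  refine (h.div hc h0').congr_deriv ?_
  have h1 : (2 * (f' / f x).im * Complex.I : ℂ) = f' / f x - conj (f' / f x) := by
    rw [Complex.sub_conj]; push_cast; ring
  rw [h1, map_div₀]
  field_simp

/-- At a zero of γ the real factor t − x cancels between γ(t) and its conjugate, leaving difference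
quotients. So γ/γ̄ extends continuously although arg γ jumps by π. -/
theorem continuousAt_conj_quotient {γ : ℝ → ℂ} {x : ℝ} {γ' : ℂ} (h : HasDerivAt γ γ' x)
    (h0 : γ x = 0) (hd : γ' ≠ 0) :
    Tendsto (fun t => γ t / conj (γ t)) (𝓝[≠] x) (𝓝 (γ' / conj γ')) := by
  have h1 := hasDerivAt_iff_tendsto_slope.1 h
  have h2 : Tendsto (fun t => conj (slope γ x t)) (𝓝[≠] x) (𝓝 (conj γ')) :=
    (Complex.continuous_conj.tendsto _).comp h1
  have h3 := h1.div h2 (by simpa using hd)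
  refine h3.congr' ?_
  filter_upwards [self_mem_nhdsWithin] with t ht
  have ht' : ((t - x : ℝ) : ℂ) ≠ 0 := by exact_mod_cast sub_ne_zero.2 ht
  simp only [Pi.div_apply, slope, vsub_eq_sub, h0, sub_zero, Complex.real_smul, map_mul,
    Complex.conj_ofReal]
  rw [mul_div_mul_left]
  push_cast at ht' ⊢
  exact inv_ne_zero ht'

/-- The zeros are isolated, and a discrete subspace of ℝ is countable. -/
theorem countable_zeros_of_deriv_ne_zero {γ : ℝ → ℂ} {I : Set ℝ} (hI : IsOpen I)
    (hγ : ContDiffOn ℝ ∞ γ I) (hd : ∀ s ∈ I, deriv γ s ≠ 0) : {x ∈ I | γ x = 0}.Countable := by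
  have : DiscreteTopology {x | x ∈ I ∧ γ x = 0} := by
    rw [discreteTopology_subtype_iff]
    rintro x ⟨hx, -⟩
    have h1 : HasDerivAt γ (deriv γ x) x :=
      ((hγ.contDiffAt (hI.mem_nhds hx)).differentiableAt (by simp)).hasDerivAt
    have h2 := h1.eventually_ne (c := 0) (hd x hx)
    rw [← le_bot_iff, ← inf_principal_eq_bot.2 h2]
    refine le_inf inf_le_left (inf_le_right.trans (principal_mono.2 ?_))
    rintro y ⟨-, hy⟩
    exact hy
  exact Set.countable_coe_iff.1 (TopologicalSpace.separableSpace_iff_countable.1 inferInstance)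

open Classical in
/-- The angle function of a soliton curve is `-a β` up to a constant, also across zeros of the
curve. -/
theorem IsSolitonCurve.exists_angle {k : ℕ} {a : ℝ} {γ : ℝ → ℂ} {I : Set ℝ}
    (h : IsSolitonCurve k a γ I) (hI : IsOpen I) (hI' : I.OrdConnected) {s : ℝ} (hs : s ∈ I) :
    ∃ τ : ℝ, ∀ x ∈ I, γ x ≠ 0 →
      (γ x / conj (γ x)) ^ k * (deriv γ x / conj (deriv γ x)) =
        Complex.exp (2 * (τ - a * beta γ s x : ℝ) * Complex.I) := by
  obtain ⟨hγ, hd, -⟩ := id h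
  have hγd : ∀ x ∈ I, HasDerivAt γ (deriv γ x) x := fun x hx =>
    ((hγ.contDiffAt (hI.mem_nhds hx)).differentiableAt (by simp)).hasDerivAt
  have hγdd : ∀ x ∈ I, HasDerivAt (deriv γ) (deriv (deriv γ) x) x := fun x hx =>
    (((contDiffOn_deriv_curve hI hγ).contDiffAt (hI.mem_nhds hx)).differentiableAt
      (by simp)).hasDerivAt
  -- q is the continuous extension of γ/γ̄ over the zeros of γ, and U below is exp 2i(k arg γ + arg
  -- γ' + aβ).
  set q : ℝ → ℂ := fun x => if γ x = 0 then deriv γ x / conj (deriv γ x) else γ x / conj (γ x)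
    with hq
  set U : ℝ → ℂ := fun x => q x ^ k * (deriv γ x / conj (deriv γ x)) *
    Complex.exp (2 * (a * beta γ s x : ℝ) * Complex.I) with hU
  have hne : ∀ x ∈ I, γ x ≠ 0 → q =ᶠ[𝓝 x] fun x => γ x / conj (γ x) := by
    intro x hx h0
    filter_upwards [(hγd x hx).continuousAt.eventually_ne h0] with y hy
    simp [hq, hy]
  have hqc : ∀ x ∈ I, ContinuousAt q x := by
    intro x hx
    by_cases h0 : γ x = 0
    · rw [continuousAt_iff_punctured_nhds]
      have h1 : q x = deriv γ x / conj (deriv γ x) := by simp [hq, h0]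
      rw [h1]
      refine (continuousAt_conj_quotient (hγd x hx) h0 (hd x hx)).congr' ?_
      filter_upwards [(hγd x hx).eventually_ne (c := 0) (hd x hx)] with y hy
      simp [hq, hy]
    · exact ((hasDerivAt_div_conj (hγd x hx) h0).continuousAt).congr (hne x hx h0).symm
  have hβ : ∀ x ∈ I, HasDerivAt
      (fun x => Complex.exp (2 * (a * beta γ s x : ℝ) * Complex.I))
      ((2 * (a * (conj (γ x) * deriv γ x).im : ℝ) * Complex.I) *
        Complex.exp (2 * (a * beta γ s x : ℝ) * Complex.I)) x := by
    intro x hx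
    have h1 := ((hasDerivAt_beta hI hI' hγ hs hx).const_mul a).ofReal_comp
    have h2 := ((h1.const_mul 2).mul_const Complex.I).cexp
    rw [mul_comm] at h2
    exact h2
  have hUc : ContinuousOn U I := by
    intro x hx
    refine ContinuousAt.continuousWithinAt ?_
    exact (((hqc x hx).pow k).mul (hasDerivAt_div_conj (hγdd x hx) (hd x hx)).continuousAt).mul
      (hβ x hx).continuousAt
  have hUd : ∀ x ∈ I, γ x ≠ 0 → HasDerivAt U 0 x := by
    intro x hx h0
    have h1 : HasDerivAt (fun t => (γ t / conj (γ t)) ^ k)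
        (k * (2 * (deriv γ x / γ x).im * Complex.I) * (γ x / conj (γ x)) ^ k) x := by
      have h2 := (hasDerivAt_div_conj (hγd x hx) h0).pow k
      refine h2.congr_deriv ?_
      cases k with
      | zero => simp
      | succ n => rw [Nat.add_sub_cancel, pow_succ]; ring
    have h2 := (h1.mul (hasDerivAt_div_conj (hγdd x hx) (hd x hx))).mul (hβ x hx)
    have h3 : HasDerivAt U _ x := h2.congr_of_eventuallyEq (by
      filter_upwards [hne x hx h0] with y hy
      simp only [hU, hy, Pi.mul_apply])
    refine h3.congr_deriv ?_
    have h4 := congrArg (fun r : ℝ => (r : ℂ)) (h.scalar_eq hx h0)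
    push_cast at h4
    simp only [Pi.mul_apply]
    push_cast
    linear_combination (2 * Complex.I * (γ x / conj (γ x)) ^ k *
      (deriv γ x / conj (deriv γ x)) *
      Complex.exp (2 * (a * beta γ s x) * Complex.I)) * h4
  have hconst : ∀ x ∈ I, U x = U s := by
    intro x hx
    have hsub := hI'.uIcc_subset hs hx
    -- U is continuous and has derivative zero off a countable set, so one constant serves the whole
    -- interval, on both sides of every zero of γ.
    have h1 := MeasureTheory.integral_eq_of_hasDerivAt_off_countable U (fun _ => 0)
      (countable_zeros_of_deriv_ne_zero hI hγ hd) (hUc.mono hsub)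
      (fun y hy => hUd y (hsub ⟨hy.1.1.le, hy.1.2.le⟩) fun h0 =>
        hy.2 ⟨hsub ⟨hy.1.1.le, hy.1.2.le⟩, h0⟩) (by simp)
    simp only [intervalIntegral.integral_zero] at h1
    exact (sub_eq_zero.1 h1.symm)
  have hunit : ∀ z : ℂ, z ≠ 0 → ‖z / conj z‖ = 1 := fun z hz => by
    rw [norm_div, RCLike.norm_conj, div_self (norm_ne_zero_iff.2 hz)]
  have hUs : ‖U s‖ = 1 := by
    have hqs : ‖q s‖ = 1 := by
      simp only [hq]
      split_ifs with h0
      · exact hunit _ (hd s hs)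
      · exact hunit _ h0
    simp only [hU]
    rw [norm_mul, norm_mul, norm_pow, hqs, hunit _ (hd s hs)]
    have : (2 * (a * beta γ s s : ℝ) * Complex.I : ℂ) = ((2 * (a * beta γ s s) : ℝ) : ℂ) * Complex.I := by
      push_cast; ring
    rw [this, Complex.norm_exp_ofReal_mul_I]
    simp
  refine ⟨(U s).arg / 2, fun x hx h0 => ?_⟩
  have h1 := hconst x hx
  have h2 : U s = Complex.exp ((U s).arg * Complex.I) := by
    have := Complex.norm_mul_exp_arg_mul_I (U s)
    rw [hUs] at this
    simpa using this.symm
  have h3 : q x = γ x / conj (γ x) := by simp [hq, h0]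
  rw [h2] at h1
  simp only [hU, h3] at h1
  have h4 : (2 * (((U s).arg / 2 - a * beta γ s x : ℝ) : ℂ) * Complex.I : ℂ) =
      (U s).arg * Complex.I - 2 * (a * beta γ s x : ℝ) * Complex.I := by push_cast; ring
  rw [h4, Complex.exp_sub, eq_div_iff (Complex.exp_ne_zero _)]
  exact h1

end CohomTwo

end

noncomputable section

open scoped Manifold ContDiff Matrix Matrix.Norms.L2Operator
open Filter Topology

namespace CohomTwo

open ComplexConjugate

/-! ## The trivial extension of the action -/

section Pair

variable {n : ℕ}

@[simp] theorem pair_castSucc (z : Cn n) (w : ℂ) (i : Fin n) : pair z w i.castSucc = z i := by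
  simp [pair]

@[simp] theorem pair_last (z : Cn n) (w : ℂ) : pair z w (Fin.last n) = w := by
  simp [pair]

theorem Cn_succ_ext {u v : Cn (n + 1)} (h : ∀ i : Fin n, u i.castSucc = v i.castSucc)
    (hl : u (Fin.last n) = v (Fin.last n)) : u = v := by
  ext i
  exact Fin.lastCases hl h i

theorem pair_add (z z' : Cn n) (w w' : ℂ) : pair (z + z') (w + w') = pair z w + pair z' w' :=
  Cn_succ_ext (fun i => by simp) (by simp)

theorem pair_smul (c : ℂ) (z : Cn n) (w : ℂ) : pair (c • z) (c * w) = c • pair z w :=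
  Cn_succ_ext (fun i => by simp) (by simp)

theorem inner_pair (z z' : Cn n) (w w' : ℂ) :
    inner ℂ (pair z w) (pair z' w') = inner ℂ z z' + conj w * w' := by
  rw [PiLp.inner_apply, Fin.sum_univ_castSucc]
  simp [PiLp.inner_apply, mul_comm]

theorem norm_pair_sq (z : Cn n) (w : ℂ) : ‖pair z w‖ ^ 2 = ‖z‖ ^ 2 + ‖w‖ ^ 2 := by
  rw [EuclideanSpace.norm_sq_eq, EuclideanSpace.norm_sq_eq, Fin.sum_univ_castSucc]
  simp

theorem norm_pair_zero (z : Cn n) : ‖pair z 0‖ = ‖z‖ := by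
  have := norm_pair_sq z 0
  rw [norm_zero] at this
  exact (pow_left_inj₀ (norm_nonneg _) (norm_nonneg _) two_ne_zero).1 (by linarith)

/-- `pair` as a linear map. -/
def pairL (n : ℕ) : (Cn n × ℂ) →L[ℂ] Cn (n + 1) :=
  LinearMap.toContinuousLinearMap
    { toFun := fun p => pair p.1 p.2
      map_add' := fun _ _ => pair_add _ _ _ _
      map_smul' := fun _ _ => pair_smul _ _ _ }

@[simp] theorem pairL_apply (p : Cn n × ℂ) : pairL n p = pair p.1 p.2 := rfl

theorem pair_injective {z z' : Cn n} {w w' : ℂ} (h : pair z w = pair z' w') : z = z' ∧ w = w' := by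
  refine ⟨?_, ?_⟩
  · ext i
    have := congrArg (fun u => u i.castSucc) h
    simpa using this
  · have := congrArg (fun u => u (Fin.last n)) h
    simpa using this

/-- The block diagonal matrices, as a ring homomorphism. -/
def blockHom (n : ℕ) : (Mat n × Mat 1) →+* Mat (n + 1) where
  toFun p := Matrix.reindex finSumFinEquiv finSumFinEquiv (Matrix.fromBlocks p.1 0 0 p.2)
  map_one' := by simp
  map_zero' := by simp
  map_mul' p q := by simp [Matrix.submatrix_mul_equiv, Matrix.fromBlocks_multiply]
  map_add' p q := by
    have h : Matrix.fromBlocks (p.1 + q.1) 0 0 (p.2 + q.2) =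
        Matrix.fromBlocks p.1 0 0 p.2 + Matrix.fromBlocks q.1 0 0 q.2 := by
      rw [Matrix.fromBlocks_add]; simp
    simp only [Prod.fst_add, Prod.snd_add, h]
    rfl

theorem extMatrix_eq (A : Mat n) : extMatrix A = blockHom n (A, 1) := rfl

theorem blockHom_castSucc_castSucc (A : Mat n) (B : Mat 1) (i j : Fin n) :
    blockHom n (A, B) i.castSucc j.castSucc = A i j := by
  have h : ∀ i : Fin n, finSumFinEquiv.symm (i.castSucc) = Sum.inl i := fun i => by
    rw [Equiv.symm_apply_eq]; rfl
  simp [blockHom, h]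

theorem blockHom_last (A : Mat n) (B : Mat 1) (j : Fin n) :
    blockHom n (A, B) (Fin.last n) j.castSucc = 0 ∧ blockHom n (A, B) j.castSucc (Fin.last n) = 0 ∧
    blockHom n (A, B) (Fin.last n) (Fin.last n) = B 0 0 := by
  have h : ∀ i : Fin n, finSumFinEquiv.symm (i.castSucc) = Sum.inl i := fun i => by
    rw [Equiv.symm_apply_eq]; rfl
  have h' : finSumFinEquiv.symm (Fin.last n) = Sum.inr (0 : Fin 1) := by
    rw [Equiv.symm_apply_eq]; rfl
  simp [blockHom, h, h']

theorem act_blockHom (A : Mat n) (B : Mat 1) (z : Cn n) (w : ℂ) :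
    act (blockHom n (A, B)) (pair z w) = pair (act A z) (B 0 0 * w) := by
  refine Cn_succ_ext (fun i => ?_) ?_
  · simp only [act, Matrix.mulVec, dotProduct, Fin.sum_univ_castSucc,
      blockHom_castSucc_castSucc, (blockHom_last A B _).2.1, pair_castSucc, zero_mul, add_zero]
  · simp only [act, Matrix.mulVec, dotProduct, Fin.sum_univ_castSucc, pair_castSucc, pair_last,
      (blockHom_last A B _).1, zero_mul, Finset.sum_const_zero, zero_add]
    congr 1
    have h' : finSumFinEquiv.symm (Fin.last n) = Sum.inr (0 : Fin 1) := by
      rw [Equiv.symm_apply_eq]; rfl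
    simp [blockHom, h']

theorem act_extMatrix (A : Mat n) (z : Cn n) (w : ℂ) :
    act (extMatrix A) (pair z w) = pair (act A z) w := by
  rw [extMatrix_eq, act_blockHom]
  simp

theorem continuous_blockHom : Continuous (blockHom n) := by
  have : Continuous fun p : Mat n × Mat 1 => Matrix.fromBlocks p.1 0 0 p.2 :=
    Continuous.matrix_fromBlocks continuous_fst continuous_const continuous_const continuous_snd
  exact this.matrix_reindex _ _

theorem exp_blockHom (X : Mat n) :
    NormedSpace.exp (blockHom n (X, 0)) = extMatrix (NormedSpace.exp X) := by
  let _ : NormedAlgebra ℚ (Mat n) := NormedAlgebra.restrictScalars ℚ ℂ _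
  let _ : NormedAlgebra ℚ (Mat 1) := NormedAlgebra.restrictScalars ℚ ℂ _
  have h : NormedSpace.exp ((X, 0) : Mat n × Mat 1) = (NormedSpace.exp X, 1) := by
    refine Prod.ext ?_ ?_
    · exact Prod.fst_exp _
    · rw [Prod.snd_exp]; exact NormedSpace.exp_zero
  rw [extMatrix_eq, ← h]
  exact (NormedSpace.map_exp (blockHom n) continuous_blockHom _).symm

theorem blockHom_smul (t : ℝ) (X : Mat n) : t • blockHom n (X, 0) = blockHom n (t • X, 0) := by
  have h : Matrix.fromBlocks (t • X) 0 0 (0 : Mat 1) = t • Matrix.fromBlocks X 0 0 (0 : Mat 1) := by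
    rw [Matrix.fromBlocks_smul]; simp
  change t • Matrix.reindex finSumFinEquiv finSumFinEquiv (Matrix.fromBlocks X 0 0 (0 : Mat 1)) =
    Matrix.reindex finSumFinEquiv finSumFinEquiv (Matrix.fromBlocks (t • X) 0 0 (0 : Mat 1))
  rw [h]
  rfl

variable {G : Subgroup (SU n)}

theorem blockHom_mem_lieAlg_ext {X : Mat n} (hX : X ∈ lieAlg G) :
    blockHom n (X, 0) ∈ lieAlg (ext G) := by
  intro t
  obtain ⟨g, hg, he⟩ := hX t
  refine ⟨extHom n g, ⟨g, hg, rfl⟩, ?_⟩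
  rw [blockHom_smul, exp_blockHom, ← he]
  rfl

/-- The last row and column of exp(tX') do not depend on t, so those entries of X', being their
derivatives at 0, vanish. The remaining block exponentiates into G. -/
theorem exists_of_mem_lieAlg_ext {X' : Mat (n + 1)} (hX : X' ∈ lieAlg (ext G)) :
    ∃ X ∈ lieAlg G, X' = blockHom n (X, 0) := by
  have hent : ∀ i j, HasDerivAt (fun t : ℝ => NormedSpace.exp (t • X') i j) (X' i j) 0 := by
    intro i j
    have h1 := hasDerivAt_exp'_smul_zero X'
    exact hasDerivAt_pi.1 (hasDerivAt_pi.1 h1 i) j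
  choose g' hg' he' using hX
  choose g hg hgg using fun t => Subgroup.mem_map.1 (hg' t)
  have he : ∀ t : ℝ, NormedSpace.exp (t • X') = blockHom n ((g t : Mat n), 1) := fun t => by
    rw [← he' t, ← hgg t]; rfl
  have hzero : ∀ i j, (∀ t : ℝ, NormedSpace.exp (t • X') i j = NormedSpace.exp ((0 : ℝ) • X') i j) →
      X' i j = 0 := by
    intro i j h
    have h1 : (fun t : ℝ => NormedSpace.exp (t • X') i j) =
        fun _ => NormedSpace.exp ((0 : ℝ) • X') i j := funext h
    have h2 := hent i j
    rw [h1] at h2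
    exact h2.unique (hasDerivAt_const _ _)
  have hX' : X' = blockHom n (Matrix.of fun i j => X' i.castSucc j.castSucc, 0) := by
    ext i j
    refine Fin.lastCases ?_ (fun i => ?_) i <;> refine Fin.lastCases ?_ (fun j => ?_) j
    · rw [hzero _ _ fun t => ?_]
      · have h' : finSumFinEquiv.symm (Fin.last n) = Sum.inr (0 : Fin 1) := by
          rw [Equiv.symm_apply_eq]; rfl
        simp [blockHom, h']
      · have h' : finSumFinEquiv.symm (Fin.last n) = Sum.inr (0 : Fin 1) := by
          rw [Equiv.symm_apply_eq]; rfl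
        rw [he, he]
        simp [blockHom, h']
    · rw [(blockHom_last _ _ _).1]
      exact hzero _ _ fun t => by rw [he, he, (blockHom_last _ _ _).1, (blockHom_last _ _ _).1]
    · rw [(blockHom_last _ _ _).2.1]
      exact hzero _ _ fun t => by rw [he, he, (blockHom_last _ _ _).2.1, (blockHom_last _ _ _).2.1]
    · rw [blockHom_castSucc_castSucc]; rfl
  refine ⟨_, fun t => ⟨g t, hg t, ?_⟩, hX'⟩
  have h1 := he t
  rw [hX', blockHom_smul, exp_blockHom, extMatrix_eq] at h1
  ext i j
  have h2 := congrArg (fun M => M i.castSucc j.castSucc) h1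
  simp only [blockHom_castSucc_castSucc] at h2
  exact h2.symm

/-- The inclusion of `ℂⁿ` in `ℂⁿ⁺¹`, as a real linear map. -/
def inclL (n : ℕ) : Cn n →ₗ[ℝ] Cn (n + 1) where
  toFun z := pair z 0
  map_add' z z' := by simpa using pair_add z z' 0 0
  map_smul' c z := by
    have := pair_smul (c : ℂ) z 0
    rw [mul_zero] at this
    simpa using this

@[simp] theorem inclL_apply (z : Cn n) : inclL n z = pair z 0 := rfl

theorem orbitTangent_ext (z : Cn n) (w : ℂ) :
    orbitTangent (ext G) (pair z w) = (orbitTangent G z).map (inclL n) := by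
  rw [orbitTangent, orbitTangent, Submodule.map_span, ← Set.image_comp]
  congr 1
  ext u
  constructor
  · rintro ⟨X', hX', rfl⟩
    obtain ⟨X, hX, rfl⟩ := exists_of_mem_lieAlg_ext hX'
    exact ⟨X, hX, by simp [act_blockHom]⟩
  · rintro ⟨X, hX, rfl⟩
    exact ⟨_, blockHom_mem_lieAlg_ext hX, by simp [act_blockHom]⟩

theorem finrank_orbitTangent_ext (z : Cn n) (w : ℂ) :
    Module.finrank ℝ (orbitTangent (ext G) (pair z w)) = Module.finrank ℝ (orbitTangent G z) := by
  rw [orbitTangent_ext]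
  exact (Submodule.equivMapOfInjective (inclL n) (fun z z' h => (pair_injective h).1) _).finrank_eq.symm

theorem pair_mem_axis {z : Cn n} {w : ℂ} : pair z w ∈ axis n ↔ z = 0 := by
  constructor
  · rintro ⟨w', h⟩
    exact (pair_injective h).1
  · rintro rfl
    exact ⟨w, rfl⟩

end Pair

/-! ## The holomorphic volume form -/

section HolVol

variable {d : ℕ}

theorem holVol_eq_det (v : Fin d → Cn d) :
    holVol v = Matrix.det (Matrix.of fun i j => v i j) := by
  rw [holVol, ← Matrix.det_transpose]
  rfl

theorem holVol_act (A : Mat d) (v : Fin d → Cn d) :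
    holVol (fun i => act A (v i)) = A.det * holVol v := by
  rw [holVol, holVol, ← Matrix.det_mul]
  congr 1

theorem norm_holVol {v : Fin d → Cn d} (hv : Orthonormal ℂ v) : ‖holVol v‖ = 1 := by
  rw [orthonormal_iff_ite] at hv
  set U : Mat d := Matrix.of fun i j => v j i with hU
  have h1 : Uᴴ * U = 1 := by
    ext i j
    rw [Matrix.mul_apply, Matrix.one_apply, ← hv i j, PiLp.inner_apply]
    refine Finset.sum_congr rfl fun l _ => ?_
    simp [hU, mul_comm]
  have h2 := congrArg Matrix.det h1
  rw [Matrix.det_mul, Matrix.det_conjTranspose, Matrix.det_one] at h2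
  have h3 := congrArg norm h2
  rw [norm_mul, norm_star, norm_one] at h3
  have h4 : holVol v = U.det := rfl
  rw [h4]
  nlinarith [norm_nonneg U.det]

theorem holVol_smul (c : Fin d → ℂ) (v : Fin d → Cn d) :
    holVol (fun i => c i • v i) = (∏ i, c i) * holVol v := by
  rw [holVol_eq_det, holVol_eq_det]
  exact Matrix.det_mul_column c (Matrix.of fun i j => v i j)

theorem holVol_eq_alternating (v : Fin d → Cn d) :
    holVol v = (Matrix.detRowAlternating.compLinearMap (WithLp.linearEquiv 2 ℂ (Fin d → ℂ)).toLinearMap)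
      v := by
  rw [holVol_eq_det]
  rfl

/-- Changing the last two vectors of a frame within their complex span. -/
theorem holVol_snoc_snoc {k : ℕ} (ν : Fin k → Cn (k + 2)) (u v : Cn (k + 2)) (a b c e : ℂ) :
    holVol (Fin.snoc (α := fun _ => Cn (k + 2)) (Fin.snoc (α := fun _ => Cn (k + 2)) ν
      (a • u + b • v)) (c • u + e • v)) =
    (a * e - b * c) * holVol (Fin.snoc (α := fun _ => Cn (k + 2))
      (Fin.snoc (α := fun _ => Cn (k + 2)) ν u) v) := by
  set f := (Matrix.detRowAlternating.compLinearMap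
    (WithLp.linearEquiv 2 ℂ (Fin (k + 2) → ℂ)).toLinearMap) with hf
  set F : Cn (k + 2) → Cn (k + 2) → (Fin (k + 2) → Cn (k + 2)) := fun x y =>
    Fin.snoc (α := fun _ => Cn (k + 2)) (Fin.snoc (α := fun _ => Cn (k + 2)) ν x) y with hF
  have hlast : ∀ x y y', F x y' = Function.update (F x y) (Fin.last (k + 1)) y' := by
    intro x y y'
    simp [hF, Fin.update_snoc_last]
  have hpre : ∀ x x' y, F x' y = Function.update (F x y) (Fin.last k).castSucc x' := by
    intro x x' y
    simp only [hF]
    rw [← Fin.snoc_update]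
    simp [Fin.update_snoc_last]
  have hl : ∀ x (r s : ℂ) y y', f (F x (r • y + s • y')) = r * f (F x y) + s * f (F x y') := by
    intro x r s y y'
    rw [hlast x 0 (r • y + s • y'), f.map_update_add, f.map_update_smul, f.map_update_smul,
      ← hlast, ← hlast, smul_eq_mul, smul_eq_mul]
  have hp : ∀ x x' (r s : ℂ) y, f (F (r • x + s • x') y) = r * f (F x y) + s * f (F x' y) := by
    intro x x' r s y
    rw [hpre 0 (r • x + s • x') y, f.map_update_add, f.map_update_smul, f.map_update_smul,
      ← hpre, ← hpre, smul_eq_mul, smul_eq_mul]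
  have hne : (Fin.last k).castSucc ≠ Fin.last (k + 1) := (Fin.castSucc_lt_last _).ne
  have heq : ∀ x, f (F x x) = 0 := fun x =>
    f.map_eq_zero_of_eq (F x x) (by simp [hF]) hne
  have hswap : f (F v u) = -f (F u v) := by
    have h := heq (u + v)
    have h1 := hl (u + v) 1 1 u v
    have h2 := hp u v 1 1 u
    have h3 := hp u v 1 1 v
    simp only [one_smul, one_mul] at h1 h2 h3
    rw [h1, h2, h3, heq, heq] at h
    linear_combination h
  rw [holVol_eq_alternating, holVol_eq_alternating]
  change f (F (a • u + b • v) (c • u + e • v)) = (a * e - b * c) * f (F u v)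
  rw [hl, hp, hp, heq, heq, hswap]
  ring

/-- The square determines the volume up to sign, and reversing one basis vector changes that sign
without changing the plane. The dimension d + 1 guarantees a vector to reverse. -/
theorem HasLagrangianAngle.of_sq {T : Submodule ℝ (Cn (d + 1))} {θ : ℝ}
    {e : Fin (d + 1) → Cn (d + 1)} (he : Orthonormal ℝ e)
    (hT : Submodule.span ℝ (Set.range e) = T)
    (h : holVol e ^ 2 = Complex.exp (2 * θ * Complex.I)) : HasLagrangianAngle T θ := by
  have h1 : holVol e ^ 2 = Complex.exp (θ * Complex.I) ^ 2 := by
    rw [h, sq, ← Complex.exp_add]; congr 1; ring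
  rcases sq_eq_sq_iff_eq_or_eq_neg.1 h1 with h2 | h2
  · exact ⟨e, he, hT, h2⟩
  · set c : Fin (d + 1) → ℝ := fun i => if i = 0 then -1 else 1 with hc
    have hcc : ∀ i, c i * c i = 1 := fun i => by simp only [hc]; split_ifs <;> norm_num
    refine ⟨fun i => c i • e i, ?_, ?_, ?_⟩
    · rw [orthonormal_iff_ite] at he ⊢
      intro i j
      rw [real_inner_smul_left, real_inner_smul_right, he]
      split_ifs with hij
      · rw [hij, mul_one, hcc]
      · simp
    · rw [← hT]
      refine le_antisymm (Submodule.span_le.2 ?_) (Submodule.span_le.2 ?_)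
      · rintro _ ⟨i, rfl⟩
        exact Submodule.smul_mem _ _ (Submodule.subset_span ⟨i, rfl⟩)
      · rintro _ ⟨i, rfl⟩
        have : e i = c i • (c i • e i) := by rw [smul_smul, hcc, one_smul]
        rw [this]
        exact Submodule.smul_mem _ _ (Submodule.subset_span ⟨i, rfl⟩)
    · have h3 := holVol_smul (fun i => (c i : ℂ)) e
      simp only [Complex.coe_smul] at h3
      rw [h3, h2]
      have : ∏ i, (c i : ℂ) = -1 := by
        have h4 : ∀ i, (c i : ℂ) = if i = 0 then -1 else 1 := fun i => by
          simp only [hc]; split_ifs <;> simp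
        simp [h4]
      rw [this]
      ring

end HolVol

end CohomTwo

end

noncomputable section

open scoped Manifold ContDiff Matrix Matrix.Norms.L2Operator
open Filter Topology

namespace CohomTwo

open ComplexConjugate

/-! ## Adapted isomorphisms -/

variable {k : ℕ} {G : Subgroup (SU (k + 1))}

/-- The frame `(ν₁, 0), …, (ν_k, 0), u, v`. -/
def frame (ν : Fin k → Cn (k + 1)) (u v : Cn (k + 2)) : Fin (k + 2) → Cn (k + 2) :=
  Fin.snoc (α := fun _ => Cn (k + 2)) (Fin.snoc (α := fun _ => Cn (k + 2)) (fun i => pair (ν i) 0) u) v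

theorem forall_fin_add_two {P : Fin (k + 2) → Prop} (h : ∀ i : Fin k, P i.castSucc.castSucc)
    (h1 : P (Fin.last k).castSucc) (h2 : P (Fin.last (k + 1))) : ∀ i, P i :=
  fun i => Fin.lastCases h2 (fun i => Fin.lastCases h1 h i) i

@[simp] theorem frame_castSucc (ν : Fin k → Cn (k + 1)) (u v : Cn (k + 2)) (i : Fin k) :
    frame ν u v i.castSucc.castSucc = pair (ν i) 0 := by simp [frame]

@[simp] theorem frame_last_castSucc (ν : Fin k → Cn (k + 1)) (u v : Cn (k + 2)) :
    frame ν u v (Fin.last k).castSucc = u := by simp [frame]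

@[simp] theorem frame_last (ν : Fin k → Cn (k + 1)) (u v : Cn (k + 2)) :
    frame ν u v (Fin.last (k + 1)) = v := by simp [frame]

theorem orthonormal_frame {ν : Fin k → Cn (k + 1)} (hν : Orthonormal ℂ ν) {u v : Cn (k + 2)}
    (hu : ‖u‖ = 1) (hv : ‖v‖ = 1) (huv : inner ℂ u v = 0)
    (hνu : ∀ i, inner ℂ (pair (ν i) 0) u = 0) (hνv : ∀ i, inner ℂ (pair (ν i) 0) v = 0) :
    Orthonormal ℂ (frame ν u v) := by
  refine orthonormal_snoc (orthonormal_snoc ?_ hu hνu) hv fun i => ?_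
  · rw [orthonormal_iff_ite] at hν ⊢
    intro i j
    rw [inner_pair, hν]
    simp
  · refine Fin.lastCases ?_ (fun i => ?_) i
    · simpa using huv
    · simpa using hνv i

theorem holVol_frame_combination (ν : Fin k → Cn (k + 1)) (u v : Cn (k + 2)) (a b c e : ℂ) :
    holVol (frame ν (a • u + b • v) (c • u + e • v)) = (a * e - b * c) * holVol (frame ν u v) :=
  holVol_snoc_snoc _ u v a b c e

theorem holVol_frame_smul_smul (ν : Fin k → Cn (k + 1)) (u v : Cn (k + 2)) (a e : ℂ) :
    holVol (frame ν (a • u) (e • v)) = a * e * holVol (frame ν u v) := by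
  have h := holVol_frame_combination ν u v a 0 0 e
  rwa [zero_smul, zero_smul, zero_add, add_zero, zero_mul, sub_zero] at h

theorem holVol_frame_smul (ν : Fin k → Cn (k + 1)) (u v : Cn (k + 2)) (c : ℂ) :
    holVol (frame (fun i => c • ν i) u v) = c ^ k * holVol (frame ν u v) := by
  have h := holVol_smul (Fin.snoc (α := fun _ => ℂ) (Fin.snoc (α := fun _ => ℂ)
    (fun _ : Fin k => c) 1) 1) (frame ν u v)
  rw [Fin.prod_univ_castSucc, Fin.prod_univ_castSucc] at h
  simp only [Fin.snoc_castSucc, Fin.snoc_last, Finset.prod_const, Finset.card_univ,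
    Fintype.card_fin, mul_one] at h
  rw [← h]
  congr 1
  funext i
  revert i
  refine forall_fin_add_two (fun i => ?_) ?_ ?_
  · have := pair_smul c (ν i) 0
    rw [mul_zero] at this
    simp [this]
  · simp
  · simp

theorem holVol_frame_act (g : SU (k + 1)) (ν : Fin k → Cn (k + 1)) (u v : Cn (k + 1)) (a b : ℂ) :
    holVol (frame (fun i => act (g : Mat (k + 1)) (ν i)) (pair (act (g : Mat (k + 1)) u) a)
      (pair (act (g : Mat (k + 1)) v) b)) = holVol (frame ν (pair u a) (pair v b)) := by
  have h := holVol_act (extMatrix (g : Mat (k + 1))) (frame ν (pair u a) (pair v b))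
  have hdet : (extMatrix (g : Mat (k + 1))).det = 1 :=
    (Matrix.mem_specialUnitaryGroup_iff.1 (extMatrix_mem g)).2
  rw [hdet, one_mul] at h
  rw [← h]
  congr 1
  funext i
  revert i
  refine forall_fin_add_two (fun i => ?_) ?_ ?_ <;> simp [act_extMatrix]

theorem norm_lastVec (n : ℕ) : ‖lastVec n‖ = 1 := by
  have := norm_pair_sq (0 : Cn n) 1
  rw [norm_zero, norm_one] at this
  refine (pow_left_inj₀ (norm_nonneg _) zero_le_one two_ne_zero).1 ?_
  rw [lastVec]
  linarith

/-- After normalising V the frame is unitary. This is why an adapted isomorphism has ‖V‖ = 1. -/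
theorem norm_holVol_frame_lastVec {ν : Fin k → Cn (k + 1)} (hν : Orthonormal ℂ ν)
    {V : Cn (k + 1)} (hV0 : V ≠ 0) (hV : ∀ i, inner ℂ (ν i) V = 0) :
    ‖holVol (frame ν (pair V 0) (lastVec (k + 1)))‖ = ‖V‖ := by
  set V₁ : Cn (k + 1) := ((‖V‖⁻¹ : ℝ) : ℂ) • V with hV₁
  have hn : ‖V‖ ≠ 0 := norm_ne_zero_iff.2 hV0
  have hn1 : ‖V₁‖ = 1 := by
    rw [hV₁, norm_smul, Complex.norm_real, norm_inv, norm_norm, inv_mul_cancel₀ hn]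
  have hVV : V = (‖V‖ : ℂ) • V₁ := by
    rw [hV₁, smul_smul]
    have : (‖V‖ : ℂ) ≠ 0 := by exact_mod_cast hn
    push_cast
    rw [mul_inv_cancel₀ this, one_smul]
  have h1 := holVol_frame_smul_smul ν (pair V₁ 0) (lastVec (k + 1)) (‖V‖ : ℂ) 1
  rw [one_smul, ← pair_smul, ← hVV, mul_zero, mul_one] at h1
  rw [h1, norm_mul, norm_holVol, mul_one]
  · simp
  · refine orthonormal_frame hν (by rw [norm_pair_zero, hn1]) (norm_lastVec _) ?_ ?_ ?_
    · simp [lastVec, inner_pair]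
    · intro i
      rw [inner_pair, hV₁, inner_smul_right, hV]
      simp
    · intro i
      simp [lastVec, inner_pair]

theorem map_incl_span (ν : Fin k → Cn (k + 1)) :
    (Submodule.span ℝ (Set.range ν)).map (inclL (k + 1)) =
      Submodule.span ℝ (Set.range fun i => pair (ν i) 0) := by
  rw [Submodule.map_span, ← Set.range_comp]
  rfl

theorem orthonormal_real_of_complex {ι : Type*} {d : ℕ} {ν : ι → Cn d} (h : Orthonormal ℂ ν) :
    Orthonormal ℝ ν := by
  classical
  rw [orthonormal_iff_ite] at h ⊢
  intro i j
  rw [real_inner_eq_re, h i j]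
  split_ifs <;> simp

/-- The data that an adapted isomorphism provides. -/
structure AdaptedData (G : Subgroup (SU (k + 1))) (V : Cn (k + 1)) (ν : Fin k → Cn (k + 1)) :
    Prop where
  mem : V ∈ zeroLevel G
  norm_eq : ‖V‖ = 1
  orthonormal : Orthonormal ℂ ν
  inner_eq : ∀ i, inner ℂ (ν i) V = 0
  span_eq : Submodule.span ℝ (Set.range ν) = orbitTangent G V
  holVol_sq : holVol (frame ν (pair V 0) (lastVec (k + 1))) ^ 2 = 1

/-- The vectors of the given basis have last coordinate 0; read in ℂ^(k+1) they are unitary by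
isotropy. The volume ±1 then fixes the length of V. -/
theorem IsAdapted.exists_data (hG : IsCompact (G : Set (SU (k + 1)))) {z' : Cn (k + 1)}
    (hz : z' ∈ zeroLevel G) {Φ : (Submodule.span ℂ {z'}) ≃ₗ[ℂ] ℂ}
    (h : IsAdapted G z' Φ) : ∃ ν, AdaptedData G (Φ.symm 1 : Cn (k + 1)) ν := by
  obtain ⟨ν, hν, hspan, hvol⟩ := h
  set V : Cn (k + 1) := (Φ.symm 1 : Cn (k + 1)) with hV
  obtain ⟨c, hc⟩ := Submodule.mem_span_singleton.1 (Φ.symm 1).2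
  have hVz : V ∈ zeroLevel G := by
    rw [hV, ← hc]; exact smul_mem_zeroLevel hz c
  have hV0 : V ≠ 0 := by
    intro h
    have h1 : Φ.symm 1 = 0 := Subtype.ext h
    have h2 : (1 : ℂ) = 0 := by simpa using congrArg Φ h1
    exact one_ne_zero h2
  rw [orbitTangent_ext] at hspan
  have hmem : ∀ i, ∃ u ∈ orbitTangent G V, pair u 0 = ν i := by
    intro i
    have : ν i ∈ (orbitTangent G V).map (inclL (k + 1)) := hspan ▸ Submodule.subset_span ⟨i, rfl⟩
    exact this
  choose ν' hν'mem hν' using hmem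
  have hνeq : ν = fun i => pair (ν' i) 0 := funext fun i => (hν' i).symm
  have hν'o : Orthonormal ℝ ν' := by
    rw [orthonormal_iff_ite] at hν ⊢
    intro i j
    rw [← hν i j, real_inner_eq_re, real_inner_eq_re, ← hν', ← hν', inner_pair]
    simp
  have hν'c : Orthonormal ℂ ν' := orthonormal_complex_of_real hν'o fun i j =>
    inner_im_orbitTangent hG hVz (hν'mem i) (hν'mem j)
  have hin : ∀ i, inner ℂ (ν' i) V = 0 := fun i => inner_orbitTangent_self hG hVz (hν'mem i)
  have hvol' : holVol (frame ν' (pair V 0) (lastVec (k + 1))) = 1 ∨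
      holVol (frame ν' (pair V 0) (lastVec (k + 1))) = -1 := by
    rw [hνeq] at hvol
    exact hvol
  refine ⟨ν', hVz, ?_, hν'c, hin, ?_, ?_⟩
  · rw [← norm_holVol_frame_lastVec hν'c hV0 hin]
    rcases hvol' with h | h <;> simp [h]
  · have hinj : Function.Injective (inclL (k + 1)) := fun a b h => (pair_injective h).1
    apply Submodule.map_injective_of_injective hinj
    rw [map_incl_span, ← hspan, hνeq]
  · rcases hvol' with h | h <;> simp [h]

theorem orbitTangent_smul {d : ℕ} (G : Subgroup (SU d)) (c : ℂ) (z : Cn d) :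
    orbitTangent G (c • z) = (orbitTangent G z).map
      ((c • LinearMap.id : Cn d →ₗ[ℂ] Cn d).restrictScalars ℝ) := by
  rw [orbitTangent, orbitTangent, Submodule.map_span, ← Set.image_comp]
  congr 2
  funext X
  simp [act_smul_right]

/-- An adapted isomorphism exists. -/
theorem exists_isAdapted (hG : IsCompact (G : Set (SU (k + 1)))) {z' : Cn (k + 1)}
    (hz : z' ∈ zeroLevel G) (hz0 : z' ≠ 0)
    (hdim : Module.finrank ℝ (orbitTangent G z') = k) :
    ∃ Φ : (Submodule.span ℂ {z'}) ≃ₗ[ℂ] ℂ, IsAdapted G z' Φ := by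
  have hn : ‖z'‖ ≠ 0 := norm_ne_zero_iff.2 hz0
  have hnc : ((‖z'‖⁻¹ : ℝ) : ℂ) ≠ 0 := by exact_mod_cast inv_ne_zero hn
  set z₁ : Cn (k + 1) := ((‖z'‖⁻¹ : ℝ) : ℂ) • z' with hz₁
  have hz₁n : ‖z₁‖ = 1 := by
    rw [hz₁, norm_smul, Complex.norm_real, norm_inv, norm_norm, inv_mul_cancel₀ hn]
  have hz₁0 : z₁ ≠ 0 := by rw [← norm_ne_zero_iff, hz₁n]; exact one_ne_zero
  have hz₁z : z₁ ∈ zeroLevel G := smul_mem_zeroLevel hz _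
  obtain ⟨ν, hν, hspan⟩ := exists_orthonormal_orbitTangent
    (show Module.finrank ℝ (orbitTangent G z₁) = k by rw [hz₁, finrank_orbitTangent_smul hnc, hdim])
  have hmem : ∀ i, ν i ∈ orbitTangent G z₁ := fun i =>
    hspan ▸ Submodule.subset_span (Set.mem_range_self i)
  have hνc : Orthonormal ℂ ν := orthonormal_complex_of_real hν fun i j =>
    inner_im_orbitTangent hG hz₁z (hmem i) (hmem j)
  have hin : ∀ i, inner ℂ (ν i) z₁ = 0 := fun i => inner_orbitTangent_self hG hz₁z (hmem i)
  set D := holVol (frame ν (pair z₁ 0) (lastVec (k + 1))) with hD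
  have hD1 : ‖D‖ = 1 := by rw [hD, norm_holVol_frame_lastVec hνc hz₁0 hin, hz₁n]
  have hD0 : D ≠ 0 := by rw [← norm_ne_zero_iff, hD1]; exact one_ne_zero
  -- Rotating the line by a phase w multiplies the volume by w^(k+1): k factors from the basis of
  -- the tangent space and one from V. A root of D⁻¹ therefore makes the volume equal to 1.
  obtain ⟨w, hw⟩ := IsAlgClosed.exists_pow_nat_eq D⁻¹ (Nat.succ_pos k)
  have hw1 : ‖w‖ = 1 := by
    have := congrArg norm hw
    rw [norm_pow, norm_inv, hD1, inv_one] at this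
    exact (pow_eq_one_iff_of_nonneg (norm_nonneg _) (Nat.succ_ne_zero k)).1 this
  have hw0 : w ≠ 0 := by rw [← norm_ne_zero_iff, hw1]; exact one_ne_zero
  set s : ℂ := w * ((‖z'‖⁻¹ : ℝ) : ℂ) with hs
  have hs0 : s ≠ 0 := mul_ne_zero hw0 hnc
  have hsz : s • z' = w • z₁ := by rw [hs, hz₁, smul_smul]
  set Φ : (Submodule.span ℂ {z'}) ≃ₗ[ℂ] ℂ :=
    (LinearEquiv.toSpanNonzeroSingleton ℂ _ z' hz0).symm.trans
      (LinearEquiv.smulOfNeZero ℂ ℂ s⁻¹ (inv_ne_zero hs0)) with hΦ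
  have hΦ1 : (Φ.symm 1 : Cn (k + 1)) = w • z₁ := by
    have h1 : Φ.symm 1 = LinearEquiv.toSpanNonzeroSingleton ℂ _ z' hz0 s := by
      rw [LinearEquiv.symm_apply_eq, hΦ, LinearEquiv.trans_apply, LinearEquiv.symm_apply_apply]
      simp [hs0]
    rw [h1, ← hsz]
    rfl
  refine ⟨Φ, fun i => pair (w • ν i) 0, ?_, ?_, ?_⟩
  · rw [orthonormal_iff_ite] at hν ⊢
    intro i j
    rw [← hν i j, real_inner_eq_re, real_inner_eq_re, inner_pair, inner_smul_left,
      inner_smul_right, ← mul_assoc, Complex.conj_mul', hw1]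
    simp
  · rw [hΦ1, orbitTangent_ext, orbitTangent_smul, ← hspan, Submodule.map_span, ← Set.range_comp,
      map_incl_span (((w • LinearMap.id : Cn (k + 1) →ₗ[ℂ] Cn (k + 1)).restrictScalars ℝ) ∘ ν)]
    rfl
  · left
    rw [hΦ1]
    have h1 := holVol_frame_smul_smul ν (pair z₁ 0) (lastVec (k + 1)) w 1
    rw [one_smul, ← pair_smul, mul_zero] at h1
    change holVol (frame (fun i => w • ν i) (pair (w • z₁) 0) (lastVec (k + 1))) = 1
    rw [holVol_frame_smul, h1, ← hD]
    have h2 : w ^ (k + 1) * D = 1 := by rw [hw, inv_mul_cancel₀ hD0]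
    linear_combination h2

end CohomTwo

end

noncomputable section

open scoped Manifold ContDiff Matrix Matrix.Norms.L2Operator
open Filter Topology

namespace CohomTwo

/-! ## Manifolds given by local parametrisations -/

section LocalParam

variable {E E' F : Type*} [NormedAddCommGroup E] [NormedSpace ℝ E]
  [NormedAddCommGroup E'] [NormedSpace ℝ E'] [NormedAddCommGroup F] [NormedSpace ℝ F]

/-- A smooth parametrisation of a relatively open part of `A`, together with a smooth inverse that
is defined on an open subset of the ambient space. -/
structure LocalParam (E : Type*) [NormedAddCommGroup E] [NormedSpace ℝ E] (A : Set E') where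
  param : E → E'
  coord : E' → E
  dom : Set E
  nhd : Set E'
  isOpen_dom : IsOpen dom
  isOpen_nhd : IsOpen nhd
  contDiffOn_param : ContDiffOn ℝ ∞ param dom
  contDiffOn_coord : ContDiffOn ℝ ∞ coord nhd
  param_mem : ∀ u ∈ dom, param u ∈ A
  param_mem_nhd : ∀ u ∈ dom, param u ∈ nhd
  coord_mem : ∀ w ∈ A, w ∈ nhd → coord w ∈ dom
  coord_param : ∀ u ∈ dom, coord (param u) = u
  param_coord : ∀ w ∈ A, w ∈ nhd → param (coord w) = w

variable {A : Set E'}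

open Classical in
/-- The chart of `A` defined by a local parametrisation. -/
def LocalParam.chart (P : LocalParam E A) (p : A) : OpenPartialHomeomorph A E where
  toFun w := P.coord w
  -- Where the parametrisation leaves A, the inverse takes the arbitrary value p; this never happens
  -- on the target.
  invFun u := if h : P.param u ∈ A then ⟨P.param u, h⟩ else p
  source := {w | (w : E') ∈ P.nhd}
  target := P.dom
  map_source' w hw := P.coord_mem w w.2 hw
  map_target' u hu := by
    rw [dif_pos (P.param_mem u hu)]
    exact P.param_mem_nhd u hu
  left_inv' w hw := by
    have h := P.param_coord w w.2 hw
    have h' : P.param (P.coord w) ∈ A := by rw [h]; exact w.2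
    rw [dif_pos h']
    exact Subtype.ext h
  right_inv' u hu := by
    rw [dif_pos (P.param_mem u hu)]
    exact P.coord_param u hu
  open_source := P.isOpen_nhd.preimage continuous_subtype_val
  open_target := P.isOpen_dom
  continuousOn_toFun := P.contDiffOn_coord.continuousOn.comp continuous_subtype_val.continuousOn
    fun _ h => h
  continuousOn_invFun := by
    rw [IsInducing.subtypeVal.continuousOn_iff]
    refine P.contDiffOn_param.continuousOn.congr fun u hu => ?_
    simp only [Function.comp_apply]
    rw [dif_pos (P.param_mem u hu)]

open Classical in
theorem LocalParam.coe_chart_symm (P : LocalParam E A) (p : A) {u : E} (hu : u ∈ P.dom) :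
    ((P.chart p).symm u : E') = P.param u := by
  change ((if h : P.param u ∈ A then (⟨P.param u, h⟩ : A) else p : A) : E') = P.param u
  rw [dif_pos (P.param_mem u hu)]

/-- The charted space structure given by local parametrisations around every point. -/
@[reducible] def chartedSpaceOfLocalParam (P : A → LocalParam E A)
    (hP : ∀ p : A, (p : E') ∈ (P p).nhd) : ChartedSpace E A where
  atlas := Set.range fun p : A => (P p).chart p
  chartAt p := (P p).chart p
  mem_chart_source p := hP p
  chart_mem_atlas p := ⟨p, rfl⟩

/-- A transition map is the coordinate of one parametrisation after another parametrisation. It is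
smooth because coordinates are smooth on open subsets of the ambient space. -/
theorem isManifold_of_localParam (P : A → LocalParam E A)
    (hP : ∀ p : A, (p : E') ∈ (P p).nhd) :
    letI := chartedSpaceOfLocalParam P hP
    IsManifold 𝓘(ℝ, E) ∞ A := by
  let _ := chartedSpaceOfLocalParam P hP
  refine isManifold_of_contDiffOn _ _ _ ?_
  rintro _ _ ⟨p, rfl⟩ ⟨q, rfl⟩
  have hsub : ∀ u, u ∈ (((P p).chart p).symm ≫ₕ (P q).chart q).source →
      u ∈ (P p).dom ∧ (P p).param u ∈ (P q).nhd := by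
    intro u hu
    rw [OpenPartialHomeomorph.trans_source] at hu
    have h1 : u ∈ (P p).dom := hu.1
    refine ⟨h1, ?_⟩
    have h2 : (((P p).chart p).symm u : E') ∈ (P q).nhd := hu.2
    rwa [LocalParam.coe_chart_symm _ _ h1] at h2
  have h : ContDiffOn ℝ ∞ ((P q).coord ∘ (P p).param)
      (((P p).chart p).symm ≫ₕ (P q).chart q).source :=
    (P q).contDiffOn_coord.comp ((P p).contDiffOn_param.mono fun u hu => (hsub u hu).1)
      fun u hu => (hsub u hu).2
  refine (h.congr ?_).mono (Set.inter_subset_left)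
  intro u hu
  change (P q).coord (((P p).chart p).symm u) = _
  rw [LocalParam.coe_chart_symm _ _ (hsub u hu).1]
  rfl

theorem comp_chart_symm_eventuallyEq {F : Type*} (P : A → LocalParam E A)
    (hP : ∀ p : A, (p : E') ∈ (P p).nhd) (f : E' → F) (p : A) :
    (fun u => f (((P p).chart p).symm u)) =ᶠ[𝓝 ((P p).coord p)] f ∘ (P p).param := by
  filter_upwards [(P p).isOpen_dom.mem_nhds ((P p).coord_mem p p.2 (hP p))] with u hu
  rw [LocalParam.coe_chart_symm _ _ hu]
  rfl

theorem contMDiff_of_localParam (P : A → LocalParam E A)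
    (hP : ∀ p : A, (p : E') ∈ (P p).nhd) {f : E' → F} (hf : ∀ p ∈ A, ContDiffAt ℝ ∞ f p) :
    letI := chartedSpaceOfLocalParam P hP
    ContMDiff 𝓘(ℝ, E) 𝓘(ℝ, F) ∞ (fun p : A => f p) := by
  let _ := chartedSpaceOfLocalParam P hP
  intro p
  rw [contMDiffAt_iff]
  refine ⟨(hf p p.2).continuousAt.comp continuous_subtype_val.continuousAt, ?_⟩
  have hd := (P p).coord_mem p p.2 (hP p)
  have h1 : ContDiffAt ℝ ∞ (f ∘ (P p).param) ((P p).coord p) := by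
    refine ContDiffAt.comp _ ?_ ((P p).contDiffOn_param.contDiffAt ((P p).isOpen_dom.mem_nhds hd))
    rw [(P p).param_coord p p.2 (hP p)]
    exact hf p p.2
  exact (h1.congr_of_eventuallyEq (comp_chart_symm_eventuallyEq P hP f p)).contDiffWithinAt

theorem mfderiv_of_localParam (P : A → LocalParam E A)
    (hP : ∀ p : A, (p : E') ∈ (P p).nhd) {f : E' → F} (hf : ∀ p ∈ A, ContDiffAt ℝ ∞ f p) (p : A) :
    letI := chartedSpaceOfLocalParam P hP
    (mfderiv 𝓘(ℝ, E) 𝓘(ℝ, F) (fun p : A => f p) p : E →L[ℝ] F) =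
      fderiv ℝ (f ∘ (P p).param) ((P p).coord p) := by
  let _ := chartedSpaceOfLocalParam P hP
  have h := ((contMDiff_of_localParam P hP hf) p).mdifferentiableAt (by simp)
  rw [h.mfderiv]
  simp only [writtenInExtChartAt, mfld_simps, fderivWithin_univ]
  exact (comp_chart_symm_eventuallyEq P hP f p).fderiv_eq

end LocalParam

end CohomTwo

end

noncomputable section

open scoped Manifold ContDiff Matrix Matrix.Norms.L2Operator
open Filter Topology

namespace CohomTwo

/-! ## The mean curvature of a Lagrangian immersion and its Lagrangian angle -/

variable {d : ℕ}

/-- The derivative of the determinant at the identity is the trace. -/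
theorem hasDerivAt_det_of_eq_one {B : ℝ → Matrix (Fin d) (Fin d) ℂ}
    {B' : Matrix (Fin d) (Fin d) ℂ} {t : ℝ} (hB : ∀ i j, HasDerivAt (fun s => B s i j) (B' i j) t)
    (h1 : B t = 1) : HasDerivAt (fun s => (B s).det) B'.trace t := by
  let D : ContinuousMultilinearMap ℂ (fun _ : Fin d => Fin d → ℂ) ℂ :=
    { (Matrix.detRowAlternating : (Fin d → ℂ) [⋀^Fin d]→ₗ[ℂ] ℂ).toMultilinearMap with
      cont := Continuous.matrix_det (A := fun A : Matrix (Fin d) (Fin d) ℂ => A) continuous_id }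
  have hB' : HasDerivAt (fun s => (B s : Fin d → Fin d → ℂ)) (B' : Fin d → Fin d → ℂ) t :=
    hasDerivAt_pi.2 fun i => hasDerivAt_pi.2 fun j => hB i j
  have h2 := ((D.hasFDerivAt (x := (B t : Fin d → Fin d → ℂ))).restrictScalars ℝ).comp_hasDerivAt t hB'
  refine h2.congr_deriv ?_
  refine (D.linearDeriv_apply (B t) B').trans ?_
  rw [h1, Matrix.trace]
  refine Finset.sum_congr rfl fun i _ => ?_
  change ((1 : Matrix (Fin d) (Fin d) ℂ).updateRow i (B' i)).det = _
  rw [← Matrix.cramer_transpose_apply, Matrix.transpose_one, Matrix.cramer_one]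
  rfl

theorem two_le_infty : (2 : WithTop ℕ∞) ≤ ∞ := ENat.LEInfty.out

/-- The holomorphic volume of vectors in a Lagrangian plane has the phase of the plane. -/
theorem HasLagrangianAngle.im_holVol {T : Submodule ℝ (Cn d)} {θ : ℝ}
    (h : HasLagrangianAngle T θ) {v : Fin d → Cn d} (hv : ∀ i, v i ∈ T) :
    (Complex.exp (-(θ * Complex.I)) * holVol v).im = 0 := by
  obtain ⟨e, he, hspan, hvol⟩ := h
  have h1 : ∀ i, ∃ r : Fin d → ℝ, ∑ j, r j • e j = v i := fun i => by
    have := hv i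
    rw [← hspan, Submodule.mem_span_range_iff_exists_fun] at this
    exact this
  choose r hr using h1
  have h2 : (Matrix.of fun i j => v j i) = (Matrix.of fun i j => e j i) *
      (Matrix.of fun i j => (r j i : ℂ)) := by
    ext i j
    simp only [Matrix.mul_apply, Matrix.of_apply, ← hr j]
    simp [mul_comm]
  have h3 : (Matrix.of fun i j => (r j i : ℂ)).det = (((Matrix.of fun i j => r j i).det : ℝ) : ℂ) := by
    rw [show (Matrix.of fun i j => (r j i : ℂ)) =
      (Complex.ofRealHom.mapMatrix (Matrix.of fun i j => r j i)) from rfl, ← RingHom.map_det]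
    rfl
  rw [holVol, h2, Matrix.det_mul, h3]
  change (Complex.exp _ * (holVol e * _)).im = 0
  rw [hvol, ← mul_assoc, ← Complex.exp_add, neg_add_cancel, Complex.exp_zero, one_mul,
    Complex.ofReal_im]

/-- A vector with real coefficients with respect to a unitary frame lies in its real span. -/
theorem mem_span_of_kaehler_eq_zero {e : Fin d → Cn d} (he : Orthonormal ℂ e) {v : Cn d}
    (hv : ∀ i, kaehler (e i) v = 0) : v ∈ Submodule.span ℝ (Set.range e) := by
  let o : OrthonormalBasis (Fin d) ℂ (Cn d) := OrthonormalBasis.mk he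
    (he.linearIndependent.span_eq_top_of_card_eq_finrank' (by simp)).ge
  have ho : ⇑o = e := OrthonormalBasis.coe_mk _ _
  rw [← o.sum_repr' v, ho]
  refine Submodule.sum_mem _ fun i _ => ?_
  have h1 : inner ℂ (e i) v = (((inner ℂ (e i) v).re : ℝ) : ℂ) := by
    apply Complex.ext
    · simp
    · rw [Complex.ofReal_im]; exact hv i
  rw [h1]
  have h2 : (((inner ℂ (e i) v).re : ℝ) : ℂ) • e i = (inner ℂ (e i) v).re • e i :=
    Complex.coe_smul _ _
  rw [h2]
  exact Submodule.smul_mem _ _ (Submodule.subset_span ⟨i, rfl⟩)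

/-- The Gram matrix factors as Eᴴ times the matrix of v. Measuring a moving frame against the fixed
frame e makes the matrix the identity at the base point when e is unitary, where the derivative of
the determinant is a trace. -/
theorem holVol_orthonormal_conj_mul {e : Fin d → Cn d} (v : Fin d → Cn d) :
    (Matrix.of fun i j => (inner ℂ (e i) (v j) : ℂ)).det =
      (starRingEnd ℂ) (holVol e) * holVol v := by
  have h1 : (Matrix.of fun i j => (inner ℂ (e i) (v j) : ℂ)) =
      (Matrix.of fun i j => e j i)ᴴ * (Matrix.of fun i j => v j i) := by
    ext i j
    simp [Matrix.mul_apply, PiLp.inner_apply, mul_comm]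
  rw [h1, Matrix.det_mul, Matrix.det_conjTranspose]
  rfl

/-- If the Lagrangian angle of a Lagrangian immersion is `-⟨φ, Jv⟩ + c`, then its mean curvature is
the normal part of `v`. -/
theorem exists_normalPart_of_angle {φ : EuclideanSpace ℝ (Fin d) → Cn d}
    {U : Set (EuclideanSpace ℝ (Fin d))} (hU : IsOpen U) (hφ : ContDiffOn ℝ ∞ φ U)
    {v : Cn d} {c : ℝ}
    (hlag : ∀ x ∈ U, ∀ s t, kaehler (fderiv ℝ φ x s) (fderiv ℝ φ x t) = 0)
    (hang : ∀ x ∈ U, HasLagrangianAngle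
      (LinearMap.range (fderiv ℝ φ x : EuclideanSpace ℝ (Fin d) →ₗ[ℝ] Cn d))
      (-inner ℝ (φ x) (Complex.I • v) + c))
    {x₀ : EuclideanSpace ℝ (Fin d)} (hx₀ : x₀ ∈ U) :
    ∃ e : Fin d → EuclideanSpace ℝ (Fin d), Orthonormal ℝ (fun i => fderiv ℝ φ x₀ (e i)) ∧
      ∃ H, IsNormalPart (LinearMap.range (fderiv ℝ φ x₀ : EuclideanSpace ℝ (Fin d) →ₗ[ℝ] Cn d))
        (∑ i, fderiv ℝ (fderiv ℝ φ) x₀ (e i) (e i)) H ∧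
      IsNormalPart (LinearMap.range (fderiv ℝ φ x₀ : EuclideanSpace ℝ (Fin d) →ₗ[ℝ] Cn d)) v H := by
  obtain ⟨f, hf, hspan, hvol⟩ := hang x₀ hx₀
  have hfT : ∀ i, ∃ s, fderiv ℝ φ x₀ s = f i := fun i => by
    have : f i ∈ LinearMap.range (fderiv ℝ φ x₀ : EuclideanSpace ℝ (Fin d) →ₗ[ℝ] Cn d) :=
      hspan ▸ Submodule.subset_span ⟨i, rfl⟩
    exact this
  choose e he using hfT
  have hfe : (fun i => fderiv ℝ φ x₀ (e i)) = f := funext he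
  have hfC : Orthonormal ℂ f := orthonormal_complex_of_real hf fun i j => by
    rw [← he i, ← he j]; exact hlag x₀ hx₀ _ _
  have hdφ : HasFDerivAt φ (fderiv ℝ φ x₀) x₀ :=
    ((hφ.contDiffAt (hU.mem_nhds hx₀)).differentiableAt (by simp)).hasFDerivAt
  have hddφ : HasFDerivAt (fderiv ℝ φ) (fderiv ℝ (fderiv ℝ φ) x₀) x₀ :=
    (((hφ.contDiffAt (hU.mem_nhds hx₀)).fderiv_right (m := 1) (by rw [one_add_one_eq_two]; exact two_le_infty)).differentiableAt
      (by simp)).hasFDerivAt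
  have hsymm : ∀ s t, fderiv ℝ (fderiv ℝ φ) x₀ s t = fderiv ℝ (fderiv ℝ φ) x₀ t s := by
    have := (hφ.contDiffAt (hU.mem_nhds hx₀)).isSymmSndFDerivAt (by rw [minSmoothness_of_isRCLikeNormedField]; exact two_le_infty)
    exact fun s t => this s t
  set D2 := fderiv ℝ (fderiv ℝ φ) x₀ with hD2
  have hline : ∀ s : EuclideanSpace ℝ (Fin d), HasDerivAt (fun t : ℝ => x₀ + t • s) s 0 := fun s => by
    simpa using ((hasDerivAt_id (0 : ℝ)).smul_const s).const_add x₀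
  have hline0 : ∀ s : EuclideanSpace ℝ (Fin d), x₀ + (0 : ℝ) • s = x₀ := fun s => by simp
  have hnear : ∀ s : EuclideanSpace ℝ (Fin d), ∀ᶠ t : ℝ in 𝓝 0, x₀ + t • s ∈ U := fun s =>
    (hline s).continuousAt.eventually (by simpa using hU.mem_nhds hx₀)
  have hdφs : ∀ s u, HasDerivAt (fun t : ℝ => fderiv ℝ φ (x₀ + t • s) u) (D2 s u) 0 := by
    intro s u
    have h1 : HasFDerivAt (fderiv ℝ φ) D2 (x₀ + (0 : ℝ) • s) := by rw [hline0]; exact hddφ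
    have h2 := h1.comp_hasDerivAt (0 : ℝ) (hline s)
    exact h2.clm_apply (hasDerivAt_const _ u) |>.congr_deriv (by simp)
  -- the derivative of the Lagrangian condition
  have hA : ∀ s u w, kaehler (D2 s u) (fderiv ℝ φ x₀ w) + kaehler (fderiv ℝ φ x₀ u) (D2 s w) = 0 := by
    intro s u w
    have h1 := (hdφs s u).inner ℂ (hdφs s w)
    have h2 := Complex.imCLM.hasFDerivAt.comp_hasDerivAt (0 : ℝ) h1
    have h3 : (Complex.imCLM ∘ fun t : ℝ => inner ℂ (fderiv ℝ φ (x₀ + t • s) u)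
        (fderiv ℝ φ (x₀ + t • s) w)) =ᶠ[𝓝 0] fun _ => 0 := by
      filter_upwards [hnear s] with t ht
      exact hlag _ ht u w
    have h4 := h2.unique ((hasDerivAt_const (0 : ℝ) (0 : ℝ)).congr_of_eventuallyEq h3)
    simp only [hline0, map_add] at h4
    rw [add_comm]
    exact h4
  -- the derivative of the angle condition
  have hB : ∀ s, (∑ j, inner ℂ (f j) (D2 s (e j))).im = kaehler (fderiv ℝ φ x₀ s) v := by
    intro s
    -- At t = 0 the matrix is the identity because f is unitary, so the determinant has the trace as
    -- its derivative.
    have h1 : HasDerivAt (fun t : ℝ => (Matrix.of fun i j =>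
        (inner ℂ (f i) (fderiv ℝ φ (x₀ + t • s) (e j)) : ℂ)).det)
        (Matrix.of fun i j => (inner ℂ (f i) (D2 s (e j)) : ℂ)).trace 0 := by
      refine hasDerivAt_det_of_eq_one (fun i j => ?_) ?_
      · have h := (hasDerivAt_const (0 : ℝ) (f i)).inner ℂ (hdφs s (e j))
        simpa using h
      · ext i j
        rw [Matrix.of_apply, hline0, he, orthonormal_iff_ite.1 hfC, Matrix.one_apply]
    have hθ : HasDerivAt (fun t : ℝ => -inner ℝ (φ (x₀ + t • s)) (Complex.I • v) + c)
        (kaehler (fderiv ℝ φ x₀ s) v) 0 := by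
      have h2 : HasFDerivAt φ (fderiv ℝ φ x₀) (x₀ + (0 : ℝ) • s) := by rw [hline0]; exact hdφ
      have h3 := ((h2.comp_hasDerivAt (0 : ℝ) (hline s)).inner ℝ
        (hasDerivAt_const (0 : ℝ) (Complex.I • v))).neg.add_const c
      refine h3.congr_deriv ?_
      rw [inner_zero_right, zero_add, real_inner_eq_re, inner_smul_right]
      simp [kaehler]
    set θ : ℝ → ℝ := fun t => -inner ℝ (φ (x₀ + t • s)) (Complex.I • v) + c with hθdef
    have h2 : HasDerivAt (fun t : ℝ => Complex.exp (-((θ t : ℂ) * Complex.I)))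
        (Complex.exp (-((θ 0 : ℂ) * Complex.I)) *
          (-((kaehler (fderiv ℝ φ x₀ s) v : ℂ) * Complex.I))) 0 :=
      ((hθ.ofReal_comp.mul_const Complex.I).neg).cexp
    have hθ0 : θ 0 = -inner ℝ (φ x₀) (Complex.I • v) + c := by simp only [hθdef, hline0]
    have hdet0 : (Matrix.of fun i j =>
        (inner ℂ (f i) (fderiv ℝ φ (x₀ + (0 : ℝ) • s) (e j)) : ℂ)).det = 1 := by
      have : (Matrix.of fun i j => (inner ℂ (f i) (fderiv ℝ φ (x₀ + (0 : ℝ) • s) (e j)) : ℂ)) =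
          1 := by
        ext i j
        rw [Matrix.of_apply, hline0, he, orthonormal_iff_ite.1 hfC, Matrix.one_apply]
      rw [this, Matrix.det_one]
    have h3 := ((h2.mul h1).const_mul (holVol f))
    have h4 := Complex.imCLM.hasFDerivAt.comp_hasDerivAt (0 : ℝ) h3
    have hff : holVol f * (starRingEnd ℂ) (holVol f) = 1 := by
      rw [Complex.mul_conj', norm_holVol hfC]; simp
    have h5 : (Complex.imCLM ∘ fun t : ℝ => holVol f * (Complex.exp (-((θ t : ℂ) * Complex.I)) *
        (Matrix.of fun i j => (inner ℂ (f i) (fderiv ℝ φ (x₀ + t • s) (e j)) : ℂ)).det))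
        =ᶠ[𝓝 0] fun _ => 0 := by
      filter_upwards [hnear s] with t ht
      simp only [Function.comp_apply, Complex.imCLM_apply]
      rw [holVol_orthonormal_conj_mul]
      have h6 := (hang _ ht).im_holVol (v := fun j => fderiv ℝ φ (x₀ + t • s) (e j))
        (fun j => ⟨e j, rfl⟩)
      rw [← h6]
      congr 1
      linear_combination (Complex.exp (-((θ t : ℂ) * Complex.I)) *
        holVol fun j => fderiv ℝ φ (x₀ + t • s) (e j)) * hff
    have h6 := h4.unique ((hasDerivAt_const (0 : ℝ) (0 : ℝ)).congr_of_eventuallyEq h5)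
    rw [hdet0, hvol, hθ0] at h6
    set w := -inner ℝ (φ x₀) (Complex.I • v) + c
    have hw : Complex.exp ((w : ℂ) * Complex.I) * Complex.exp (-((w : ℂ) * Complex.I)) = 1 := by
      rw [← Complex.exp_add, add_neg_cancel, Complex.exp_zero]
    rw [Complex.imCLM_apply] at h6
    set τ := (Matrix.of fun i j => (inner ℂ (f i) (D2 s (e j)) : ℂ)).trace with hτ
    have h7 : Complex.exp ((w : ℂ) * Complex.I) * (Complex.exp (-((w : ℂ) * Complex.I)) *
        -((kaehler (fderiv ℝ φ x₀ s) v : ℂ) * Complex.I) * 1 +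
        Complex.exp (-((w : ℂ) * Complex.I)) * τ) =
        -((kaehler (fderiv ℝ φ x₀ s) v : ℂ) * Complex.I) + τ := by
      linear_combination (-((kaehler (fderiv ℝ φ x₀ s) v : ℂ) * Complex.I) + τ) * hw
    rw [h7] at h6
    have h8 : τ.im = kaehler (fderiv ℝ φ x₀ s) v := by
      simp at h6
      linarith
    rw [← h8, hτ, Matrix.trace]
    rfl
  set S := ∑ i, D2 (e i) (e i) with hS
  -- By the differentiated Lagrangian condition and the symmetry of the second derivative, ω(f_l, S)
  -- is the imaginary part of the trace in direction e_l, which is dθ(e_l) = ω(f_l, v). A vector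
  -- ω-orthogonal to a Lagrangian plane lies in it, so S and v have the same normal part.
  have hSv : S - v ∈ Submodule.span ℝ (Set.range f) := by
    refine mem_span_of_kaehler_eq_zero hfC fun l => ?_
    have h1 := hB (e l)
    rw [he] at h1
    have h2 : kaehler (f l) S = (∑ j, inner ℂ (f j) (D2 (e l) (e j))).im := by
      rw [kaehler, hS, inner_sum, Complex.im_sum, Complex.im_sum]
      refine Finset.sum_congr rfl fun j _ => ?_
      have h3 := hA (e j) (e j) (e l)
      rw [he, he, hsymm (e j) (e l)] at h3
      have h4 : kaehler (D2 (e j) (e j)) (f l) = - kaehler (f l) (D2 (e j) (e j)) := by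
        rw [kaehler, kaehler, ← inner_conj_symm, Complex.conj_im]
      rw [h4] at h3
      change kaehler (f l) (D2 (e j) (e j)) = kaehler (f j) (D2 (e l) (e j))
      linarith
    rw [kaehler, inner_sub_right, Complex.sub_im]
    change kaehler (f l) S - kaehler (f l) v = 0
    rw [h2, h1, sub_self]
  have hvN : ∃ N, v - N ∈ Submodule.span ℝ (Set.range f) ∧
      ∀ t ∈ Submodule.span ℝ (Set.range f), inner ℝ t N = 0 := by
    refine ⟨v - (Submodule.span ℝ (Set.range f)).starProjection v, ?_, fun t ht => ?_⟩
    · rw [sub_sub_cancel]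
      exact Submodule.starProjection_apply_mem _ _
    · rw [real_inner_comm]
      exact Submodule.starProjection_inner_eq_zero v t ht
  obtain ⟨N, hN, hN'⟩ := hvN
  refine ⟨e, by rw [hfe]; exact hf, N, ?_, ?_⟩
  · rw [← hspan]
    refine ⟨?_, hN'⟩
    have : S - N = (S - v) + (v - N) := by abel
    rw [this]
    exact Submodule.add_mem _ hSv hN
  · rw [← hspan]
    exact ⟨hN, hN'⟩

/-! ### From the angle to the translator equation on a manifold -/

variable {M : Type} [TopologicalSpace M] [ChartedSpace (EuclideanSpace ℝ (Fin d)) M]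

/-- The differential in a chart differs from the differential by an isomorphism. -/
theorem exists_fderiv_inChart [IsManifold 𝓘(ℝ, EuclideanSpace ℝ (Fin d)) ∞ M] {ι : M → Cn d}
    (hι : ContMDiff 𝓘(ℝ, EuclideanSpace ℝ (Fin d)) 𝓘(ℝ, Cn d) ∞ ι) (p : M)
    {x : EuclideanSpace ℝ (Fin d)} (hx : x ∈ (chartAt (EuclideanSpace ℝ (Fin d)) p).target) :
    ∃ B : EuclideanSpace ℝ (Fin d) →L[ℝ] EuclideanSpace ℝ (Fin d), Function.Surjective B ∧
      fderiv ℝ (inChart ι p) x =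
        (dmap ι ((chartAt (EuclideanSpace ℝ (Fin d)) p).symm x)).comp B := by
  have : IsManifold 𝓘(ℝ, EuclideanSpace ℝ (Fin d)) 1 M := IsManifold.of_le (n := ∞) (by simp)
  set e := chartAt (EuclideanSpace ℝ (Fin d)) p with he
  have he' := mdifferentiable_chart (I := 𝓘(ℝ, EuclideanSpace ℝ (Fin d))) p
  have h1 := he'.mdifferentiableAt_symm hx
  have h2 : MDifferentiableAt 𝓘(ℝ, EuclideanSpace ℝ (Fin d)) 𝓘(ℝ, Cn d) ι (e.symm x) :=
    (hι _).mdifferentiableAt (by simp)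
  refine ⟨mfderiv 𝓘(ℝ, EuclideanSpace ℝ (Fin d)) 𝓘(ℝ, EuclideanSpace ℝ (Fin d)) e.symm x, ?_, ?_⟩
  · exact he'.symm.mfderiv_surjective hx
  · rw [← mfderiv_eq_fderiv]
    exact mfderiv_comp x h2 h1

/-- A Lagrangian immersion with Lagrangian angle `-⟨ι, Jv⟩ + c` is a translator with velocity
`v`. -/
theorem isLagrangianTranslator_of_angle [IsManifold 𝓘(ℝ, EuclideanSpace ℝ (Fin d)) ∞ M]
    {ι : M → Cn d} (hι : IsLagrangianImmersion ι) {v : Cn d} {c : ℝ}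
    (hang : ∀ p, HasLagrangianAngle (tangentPlane ι p) (-inner ℝ (ι p) (Complex.I • v) + c)) :
    IsLagrangianTranslator ι v := by
  refine ⟨hι, fun p => ?_, c, hang⟩
  set e := chartAt (EuclideanSpace ℝ (Fin d)) p with he
  have hφ : ContDiffOn ℝ ∞ (inChart ι p) e.target := by
    have h1 : ContMDiffOn 𝓘(ℝ, EuclideanSpace ℝ (Fin d)) 𝓘(ℝ, Cn d) ∞ (inChart ι p) e.target :=
      hι.1.comp_contMDiffOn (contMDiffOn_chart_symm)
    exact h1.contDiffOn
  have hr : ∀ x ∈ e.target, LinearMap.range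
      (fderiv ℝ (inChart ι p) x : EuclideanSpace ℝ (Fin d) →ₗ[ℝ] Cn d) =
      tangentPlane ι (e.symm x) := by
    intro x hx
    obtain ⟨B, hB, hc⟩ := exists_fderiv_inChart hι.1 p hx
    rw [hc, tangentPlane]
    ext w
    constructor
    · rintro ⟨u, rfl⟩
      exact ⟨B u, rfl⟩
    · rintro ⟨u, rfl⟩
      obtain ⟨u', rfl⟩ := hB u
      exact ⟨u', rfl⟩
  obtain ⟨f, hf, H, hH, hH'⟩ := exists_normalPart_of_angle e.open_target hφ (v := v) (c := c)
    (fun x hx s t => by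
      obtain ⟨B, -, hc⟩ := exists_fderiv_inChart hι.1 p hx
      rw [hc]
      exact hι.2.2 _ _ _)
    (fun x hx => by
      rw [hr x hx]
      exact hang _) (mem_chart_target _ p)
  have hT : LinearMap.range (fderiv ℝ (inChart ι p) (e p) : EuclideanSpace ℝ (Fin d) →ₗ[ℝ] Cn d) =
      tangentPlane ι p := by
    rw [hr _ (mem_chart_target _ p), e.left_inv (mem_chart_source _ p)]
  rw [hT] at hH hH'
  exact ⟨H, ⟨f, hf, hH⟩, hH'⟩

/-- For velocity 0 the vector H is both tangent and normal, hence zero. -/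
theorem IsLagrangianTranslator.isSpecialLagrangian {ι : M → Cn d}
    (h : IsLagrangianTranslator ι 0) : IsSpecialLagrangian ι := by
  obtain ⟨h1, h2, c, h3⟩ := h
  refine ⟨h1, fun p => ?_, c, fun p => ?_⟩
  · obtain ⟨H, hH, hN⟩ := h2 p
    have hmem : H ∈ tangentPlane ι p := by simpa using hN.1
    have h0 : H = 0 := by simpa using hN.2 H hmem
    rwa [h0] at hH
  · simpa using h3 p

end CohomTwo

end

noncomputable section

open scoped Manifold ContDiff Matrix Matrix.Norms.L2Operator
open Filter Topology

namespace CohomTwo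

/-! ## Local parametrisations of an orbit -/

variable {d k : ℕ} {G : Subgroup (SU d)}

/-- The orbit of `V`. -/
def orbit (G : Subgroup (SU d)) (V : Cn d) : Set (Cn d) :=
  {w | ∃ g ∈ G, act (g : Mat d) V = w}

/-- The linear combinations of `X₁, …, X_k`. -/
def combL (X : Fin k → Mat d) : EuclideanSpace ℝ (Fin k) →L[ℝ] Mat d :=
  ∑ j, (EuclideanSpace.proj j : EuclideanSpace ℝ (Fin k) →L[ℝ] ℝ).smulRight (X j)

theorem combL_apply (X : Fin k → Mat d) (u : EuclideanSpace ℝ (Fin k)) :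
    combL X u = ∑ j, u j • X j := by
  simp [combL]

/-- The parametrisation `u ↦ exp(∑ uⱼ Xⱼ) V` of the orbit of `V`. -/
def orbitParam (X : Fin k → Mat d) (V : Cn d) (u : EuclideanSpace ℝ (Fin k)) : Cn d :=
  act (NormedSpace.exp (combL X u)) V

@[simp] theorem orbitParam_zero (X : Fin k → Mat d) (V : Cn d) : orbitParam X V 0 = V := by
  simp [orbitParam, NormedSpace.exp_zero, act_one]

theorem contDiff_orbitParam (X : Fin k → Mat d) (V : Cn d) {n : WithTop ℕ∞} :
    ContDiff ℝ n (orbitParam X V) := by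
  have h1 : ContDiff ℝ n (NormedSpace.exp : Mat d → Mat d) :=
    contDiff_iff_contDiffAt.2 fun x => (NormedSpace.exp_analytic (𝕂 := ℝ) x).contDiffAt
  exact ((orbitMapL V).restrictScalars ℝ).contDiff.comp (h1.comp (combL X).contDiff)

theorem hasFDerivAt_orbitParam (X : Fin k → Mat d) (V : Cn d) :
    HasFDerivAt (orbitParam X V) (((orbitMapL V).restrictScalars ℝ).comp (combL X)) 0 := by
  have h1 : HasFDerivAt (NormedSpace.exp : Mat d → Mat d) (ContinuousLinearMap.id ℝ (Mat d))
      (combL X 0) := by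
    rw [map_zero]
    exact hasStrictFDerivAt_exp'_zero.hasFDerivAt
  have h2 := ((orbitMapL V).restrictScalars ℝ).hasFDerivAt.comp (0 : EuclideanSpace ℝ (Fin k))
    (h1.comp (0 : EuclideanSpace ℝ (Fin k)) (combL X).hasFDerivAt)
  exact h2

theorem act_combL (X : Fin k → Mat d) (V : Cn d) (u : EuclideanSpace ℝ (Fin k)) :
    act (combL X u) V = ∑ j, u j • act (X j) V := by
  rw [combL_apply]
  refine (map_sum ((orbitMapL V).restrictScalars ℝ) (fun j => u j • X j) Finset.univ).trans ?_
  exact Finset.sum_congr rfl fun j _ => act_real_smul_left _ _ _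

theorem orbitParam_mem (hG : IsCompact (G : Set (SU d))) {X : Fin k → Mat d}
    (hX : ∀ j, X j ∈ lieAlg G) (V : Cn d) (u : EuclideanSpace ℝ (Fin k)) :
    orbitParam X V u ∈ orbit G V := by
  have h1 : combL X u ∈ (isClosedGroup_matrices hG).lie := by
    rw [combL_apply]
    exact Submodule.sum_mem _ fun j _ => Submodule.smul_mem _ _ (hX j)
  obtain ⟨g, hg, he⟩ := (isClosedGroup_matrices hG).exp_mem h1
  exact ⟨g, hg, congrArg (fun A => act A V) he⟩

/-- A generator in the stabiliser fixes `V` under exponentiation. -/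
theorem act_exp_eq_self {Y : Mat d} {V : Cn d} (h : act Y V = 0) :
    act (NormedSpace.exp Y) V = V := by
  have h1 : ∀ t : ℝ, HasDerivAt (fun t : ℝ => act (NormedSpace.exp (t • Y)) V) 0 t := by
    intro t
    have h2 := ((orbitMapL V).restrictScalars ℝ).hasFDerivAt.comp_hasDerivAt t
      (hasDerivAt_exp_smul_const Y t)
    refine h2.congr_deriv ?_
    change act (NormedSpace.exp (t • Y) * Y) V = 0
    rw [act_mul, h, act_zero_right]
  have h2 := is_const_of_deriv_eq_zero (fun t => (h1 t).differentiableAt) (fun t => (h1 t).deriv) 1 0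
  simpa [NormedSpace.exp_zero, act_one] using h2

/-- Orthonormal coordinates along a family. -/
def coordL (ν : Fin k → Cn d) : Cn d →L[ℝ] EuclideanSpace ℝ (Fin k) :=
  (EuclideanSpace.equiv (Fin k) ℝ).symm.toContinuousLinearMap.comp
    (ContinuousLinearMap.pi fun j => innerSL ℝ (ν j))

/-- Split the Lie algebra part of Y into its combination of the X_j, read off from the components
along ν, and a rest that annihilates V. Near 1 an element of G is exp of the first times exp of the
second, and the second factor fixes V. -/
theorem eventually_act_eq_orbitParam (hG : IsCompact (G : Set (SU d))) {V : Cn d}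
    {ν : Fin k → Cn d} (hν : Orthonormal ℝ ν)
    (hspan : Submodule.span ℝ (Set.range ν) = orbitTangent G V) {X : Fin k → Mat d}
    (hX : ∀ j, X j ∈ lieAlg G) (hXν : ∀ j, act (X j) V = ν j)
    {U : Set (EuclideanSpace ℝ (Fin k))} (hU : U ∈ 𝓝 0) :
    ∀ᶠ g in 𝓝[matrices G] (1 : Mat d), ∃ u ∈ U, act g V = orbitParam X V u := by
  set hΓ := isClosedGroup_matrices hG
  obtain ⟨P, hP⟩ := Submodule.exists_isCompl hΓ.lie
  set π : Mat d →L[ℝ] Mat d :=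
    LinearMap.toContinuousLinearMap (hΓ.lie.subtype ∘ₗ Submodule.projectionOnto _ _ hP)
  have hπapp : ∀ X, π X = (Submodule.projectionOnto _ _ hP X : Mat d) := fun X => rfl
  have hπ1 : ∀ X ∈ hΓ.lie, π X = X := fun X hX => by
    rw [hπapp, Submodule.projectionOnto_apply_left hP ⟨X, hX⟩]
  have hπmem : ∀ X, π X ∈ hΓ.lie := fun X => by rw [hπapp]; exact SetLike.coe_mem _
  set C : Mat d →L[ℝ] EuclideanSpace ℝ (Fin k) :=
    (coordL ν).comp (((orbitMapL V).restrictScalars ℝ).comp π) with hC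
  have hCapp : ∀ Y j, C Y j = inner ℝ (ν j) (act (π Y) V) := fun Y j => rfl
  have hmem : ∀ u, combL X u ∈ hΓ.lie := fun u => by
    rw [combL_apply]
    exact Submodule.sum_mem _ fun j _ => Submodule.smul_mem _ _ (hX j)
  have hstab : ∀ Y, act (π Y - combL X (C Y)) V = 0 := by
    intro Y
    have h1 : act (π Y) V ∈ Submodule.span ℝ (Set.range ν) := by
      rw [hspan, mem_orbitTangent hG]
      exact ⟨π Y, hπmem Y, rfl⟩
    obtain ⟨r, hr⟩ := (Submodule.mem_span_range_iff_exists_fun ℝ).1 h1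
    rw [act_sub_left, act_combL, sub_eq_zero, ← hr]
    refine Finset.sum_congr rfl fun j _ => ?_
    rw [hXν, hCapp, ← hr, hν.inner_right_fintype]
  have hU' : {Y | C Y ∈ U} ∈ 𝓝 (0 : Mat d) := by
    refine C.continuous.continuousAt.preimage_mem_nhds ?_
    rwa [map_zero]
  have h := hΓ.eventually_eq_exp_mul_exp ((combL X).comp C) (π - (combL X).comp C)
    (ContinuousLinearMap.id ℝ _ - π) (by abel) (fun Y => hmem _)
    (fun Y => Submodule.sub_mem _ (hπmem Y) (hmem _))
    (fun Y => by simp [hπ1 _ (hπmem Y)])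
    (fun Y hY h => by rw [← h]; simp [hπ1 Y hY]) hU'
  filter_upwards [h] with g hg
  obtain ⟨Y, hY, rfl⟩ := hg
  refine ⟨C Y, hY, ?_⟩
  rw [act_mul]
  have h2 : act (NormedSpace.exp ((π - (combL X).comp C) Y)) V = V := act_exp_eq_self (hstab Y)
  rw [h2]
  rfl

/-- If gV is near V, then g need only be near the stabiliser, not near 1. Dividing by a stabiliser
element reduces to the previous lemma; the remaining elements form a compact set whose image misses
V. -/
theorem exists_isOpen_act_eq_orbitParam (hG : IsCompact (G : Set (SU d))) {V : Cn d}
    {ν : Fin k → Cn d} (hν : Orthonormal ℝ ν)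
    (hspan : Submodule.span ℝ (Set.range ν) = orbitTangent G V) {X : Fin k → Mat d}
    (hX : ∀ j, X j ∈ lieAlg G) (hXν : ∀ j, act (X j) V = ν j)
    {U : Set (EuclideanSpace ℝ (Fin k))} (hU : U ∈ 𝓝 0) :
    ∃ W : Set (Cn d), IsOpen W ∧ V ∈ W ∧ ∀ w ∈ orbit G V, w ∈ W → ∃ u ∈ U, w = orbitParam X V u := by
  have : CompactSpace G := isCompact_iff_compactSpace.1 hG
  set N : Set G := interior {g : G | ∃ u ∈ U, act ((g : SU d) : Mat d) V = orbitParam X V u}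
  have hcont : Continuous fun g : G => act ((g : SU d) : Mat d) V := continuous_act_coe V
  have hN : ∀ g₀ : G, act ((g₀ : SU d) : Mat d) V = V → g₀ ∈ N := by
    intro g₀ hg₀
    rw [mem_interior_iff_mem_nhds]
    have hinv : act (((g₀⁻¹ : G) : SU d) : Mat d) V = V := by
      conv_lhs => rw [← hg₀]
      rw [← act_mul]
      have : (((g₀⁻¹ : G) : SU d) : Mat d) * ((g₀ : SU d) : Mat d) = 1 := by
        have : (g₀⁻¹ * g₀ : G) = 1 := inv_mul_cancel g₀
        exact congrArg (fun g : G => ((g : SU d) : Mat d)) this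
      rw [this, act_one]
    have ht : Tendsto (fun g : G => (((g * g₀⁻¹ : G) : SU d) : Mat d)) (𝓝 g₀)
        (𝓝[matrices G] 1) := by
      refine tendsto_nhdsWithin_iff.2 ⟨?_, Eventually.of_forall fun g => ⟨_, (g * g₀⁻¹).2, rfl⟩⟩
      have h1 : Continuous fun g : G => (((g * g₀⁻¹ : G) : SU d) : Mat d) :=
        continuous_subtype_val.comp (continuous_subtype_val.comp (continuous_mul_const _))
      have h2 := h1.tendsto g₀
      rw [mul_inv_cancel] at h2
      exact h2
    filter_upwards [ht.eventually (eventually_act_eq_orbitParam hG hν hspan hX hXν hU)] with g hg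
    obtain ⟨u, hu, he⟩ := hg
    refine ⟨u, hu, ?_⟩
    rw [← he]
    change _ = act (((g : SU d) : Mat d) * (((g₀⁻¹ : G) : SU d) : Mat d)) V
    rw [act_mul, hinv]
  have hK : IsCompact ((fun g : G => act ((g : SU d) : Mat d) V) '' Nᶜ) :=
    (isOpen_interior.isClosed_compl.isCompact).image hcont
  refine ⟨_, hK.isClosed.isOpen_compl, ?_, ?_⟩
  · rintro ⟨g, hg, hgV⟩
    exact hg (hN g hgV)
  · rintro w ⟨g, hg, rfl⟩ hw
    have : (⟨g, hg⟩ : G) ∈ N := by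
      by_contra h
      exact hw ⟨⟨g, hg⟩, h, rfl⟩
    exact (interior_subset this : (⟨g, hg⟩ : G) ∈ {g : G | ∃ u ∈ U,
      act ((g : SU d) : Mat d) V = orbitParam X V u})

/-- A local parametrisation of the orbit of `V` around `V`. -/
theorem exists_localParam_orbit (hG : IsCompact (G : Set (SU d))) {V : Cn d}
    {ν : Fin k → Cn d} (hν : Orthonormal ℝ ν)
    (hspan : Submodule.span ℝ (Set.range ν) = orbitTangent G V) {X : Fin k → Mat d}
    (hX : ∀ j, X j ∈ lieAlg G) (hXν : ∀ j, act (X j) V = ν j) :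
    ∃ P : LocalParam (EuclideanSpace ℝ (Fin k)) (orbit G V),
      P.param = orbitParam X V ∧ V ∈ P.nhd ∧ P.coord V = 0 := by
  set φ := orbitParam X V
  set F : EuclideanSpace ℝ (Fin k) → EuclideanSpace ℝ (Fin k) := coordL ν ∘ φ with hF
  -- Analytic regularity is used because it holds on a neighbourhood as soon as it holds at a point.
  -- For ∞ each order of differentiability could have its own neighbourhood.
  have hFc : ContDiffAt ℝ ω F 0 :=
    ((coordL ν).contDiff.comp (contDiff_orbitParam X V)).contDiffAt
  have hFd : HasFDerivAt F (ContinuousLinearEquiv.refl ℝ (EuclideanSpace ℝ (Fin k)) :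
      EuclideanSpace ℝ (Fin k) →L[ℝ] EuclideanSpace ℝ (Fin k)) 0 := by
    refine ((coordL ν).hasFDerivAt.comp (0 : EuclideanSpace ℝ (Fin k))
      (hasFDerivAt_orbitParam X V)).congr_fderiv ?_
    ext u j
    change inner ℝ (ν j) (act (combL X u) V) = u j
    rw [act_combL]
    simp_rw [hXν]
    rw [hν.inner_right_fintype]
  have hn : (ω : WithTop ℕ∞) ≠ 0 := by simp
  set S := hFc.localInverse hFd hn with hS
  have hSc : ContDiffAt ℝ ω S (F 0) := hFc.to_localInverse hFd hn
  have hleft : ∀ᶠ u in 𝓝 (0 : EuclideanSpace ℝ (Fin k)), S (F u) = u :=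
    (hFc.hasStrictFDerivAt' hFd hn).eventually_left_inverse
  obtain ⟨N, hNsub, hNo, hN0⟩ := mem_nhds_iff.1 (hSc.eventually (by simp))
  obtain ⟨U₀, hU₀sub, hU₀o, hU₀0⟩ := mem_nhds_iff.1 hleft
  have hφc : Continuous φ := (contDiff_orbitParam X V (n := 0)).continuous
  obtain ⟨W₁, hW₁o, hVW₁, hW₁⟩ := exists_isOpen_act_eq_orbitParam hG hν hspan hX hXν
    (hU₀o.mem_nhds hU₀0)
  set W : Set (Cn d) := W₁ ∩ coordL ν ⁻¹' N with hW
  have hWo : IsOpen W := hW₁o.inter (hNo.preimage (coordL ν).continuous)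
  have hφ0 : φ 0 = V := orbitParam_zero X V
  have hVW : V ∈ W := by
    refine ⟨hVW₁, ?_⟩
    change coordL ν V ∈ N
    rw [← hφ0]
    exact hN0
  have hcp : ∀ u ∈ U₀ ∩ φ ⁻¹' W, S (coordL ν (φ u)) = u := fun u hu => hU₀sub hu.1
  have hkey : ∀ w ∈ orbit G V, w ∈ W → ∃ u ∈ U₀, w = φ u := fun w hw hwW => hW₁ w hw hwW.1
  refine ⟨{ param := φ
            coord := fun w => S (coordL ν w)
            dom := U₀ ∩ φ ⁻¹' W
            nhd := W
            isOpen_dom := hU₀o.inter (hWo.preimage hφc)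
            isOpen_nhd := hWo
            contDiffOn_param := (contDiff_orbitParam X V).contDiffOn
            contDiffOn_coord := fun w hw => ?_
            param_mem := fun u _ => orbitParam_mem hG hX V u
            param_mem_nhd := fun u hu => hu.2
            coord_mem := fun w hw hwW => ?_
            coord_param := hcp
            param_coord := fun w hw hwW => ?_ }, rfl, hVW, ?_⟩
  · have h1 : ContDiffAt ℝ ω S (coordL ν w) := hNsub hw.2
    exact ((h1.of_le le_top).comp w (coordL ν).contDiff.contDiffAt).contDiffWithinAt
  · obtain ⟨u, hu, rfl⟩ := hkey w hw hwW
    rw [hcp u ⟨hu, hwW⟩]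
    exact ⟨hu, hwW⟩
  · obtain ⟨u, hu, rfl⟩ := hkey w hw hwW
    rw [hcp u ⟨hu, hwW⟩]
  · have := hcp 0 ⟨hU₀0, by change φ 0 ∈ W; rwa [hφ0]⟩
    rwa [hφ0] at this

end CohomTwo

end

noncomputable section

open scoped Manifold ContDiff Matrix Matrix.Norms.L2Operator
open Filter Topology

namespace CohomTwo

open ComplexConjugate

/-! ## The Ansatz as a map on orbit times parameters -/

variable {k : ℕ}

/-- A smooth regular curve on an open interval, with a base point. -/
structure IsRegularCurve (γ : ℝ → ℂ) (I : Set ℝ) (s : ℝ) : Prop where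
  isOpen : IsOpen I
  ordConnected : I.OrdConnected
  mem : s ∈ I
  contDiffOn : ContDiffOn ℝ ∞ γ I
  deriv_ne_zero : ∀ x ∈ I, deriv γ x ≠ 0

theorem IsRegularCurve.hasDerivAt {γ : ℝ → ℂ} {I : Set ℝ} {s : ℝ} (h : IsRegularCurve γ I s) {x : ℝ}
    (hx : x ∈ I) : HasDerivAt γ (deriv γ x) x :=
  ((h.contDiffOn.contDiffAt (h.isOpen.mem_nhds hx)).differentiableAt (by simp)).hasDerivAt

/-- The map `(w, x, y) ↦ (γ(x) ξ(y) w, F̌₂(x, y))`. -/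
def orbitMap (γ ξ : ℝ → ℂ) (s₁ s₂ : ℝ) (p : Cn (k + 1) × ℝ × ℝ) : Cn (k + 2) :=
  pair ((γ p.2.1 * ξ p.2.2) • p.1) (profileMap γ ξ s₁ s₂ p.2.1 p.2.2).2

theorem coe_symm_eq_smul {z' : Cn (k + 1)} (Φ : (Submodule.span ℂ {z'}) ≃ₗ[ℂ] ℂ) (c : ℂ) :
    (Φ.symm c : Cn (k + 1)) = c • (Φ.symm 1 : Cn (k + 1)) := by
  have : Φ.symm c = c • Φ.symm 1 := by rw [← map_smul, smul_eq_mul, mul_one]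
  rw [this]
  rfl

theorem ansatz_eq {z' : Cn (k + 1)} (Φ : (Submodule.span ℂ {z'}) ≃ₗ[ℂ] ℂ) (γ ξ : ℝ → ℂ)
    (s₁ s₂ : ℝ) (g : Mat (k + 1)) (x y : ℝ) :
    ansatz Φ γ ξ s₁ s₂ g x y = orbitMap γ ξ s₁ s₂ (act g (Φ.symm 1 : Cn (k + 1)), x, y) := by
  rw [ansatz, act_extMatrix, coe_symm_eq_smul, act_smul_right]
  rfl

section Derivatives

variable {γ ξ : ℝ → ℂ} {I₁ I₂ : Set ℝ} {s₁ s₂ : ℝ}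
  (hγ : IsRegularCurve γ I₁ s₁) (hξ : IsRegularCurve ξ I₂ s₂)

include hγ hξ

theorem contDiffAt_orbitMap {p : Cn (k + 1) × ℝ × ℝ} (hx : p.2.1 ∈ I₁) (hy : p.2.2 ∈ I₂) :
    ContDiffAt ℝ ∞ (orbitMap γ ξ s₁ s₂ : Cn (k + 1) × ℝ × ℝ → Cn (k + 2)) p := by
  have hX : ContDiffAt ℝ ∞ (fun p : Cn (k + 1) × ℝ × ℝ => p.2.1) p :=
    contDiffAt_fst.comp p contDiffAt_snd
  have hY : ContDiffAt ℝ ∞ (fun p : Cn (k + 1) × ℝ × ℝ => p.2.2) p :=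
    contDiffAt_snd.comp p contDiffAt_snd
  have c1 : ∀ {f : ℝ → ℂ}, ContDiffOn ℝ ∞ f I₁ →
      ContDiffAt ℝ ∞ (fun p : Cn (k + 1) × ℝ × ℝ => f p.2.1) p := fun h =>
    (h.contDiffAt (hγ.isOpen.mem_nhds hx)).comp p hX
  have c2 : ∀ {f : ℝ → ℂ}, ContDiffOn ℝ ∞ f I₂ →
      ContDiffAt ℝ ∞ (fun p : Cn (k + 1) × ℝ × ℝ => f p.2.2) p := fun h =>
    (h.contDiffAt (hξ.isOpen.mem_nhds hy)).comp p hY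
  have ofR : ∀ {f : ℝ → ℝ} {I : Set ℝ}, ContDiffOn ℝ ∞ f I → ContDiffOn ℝ ∞ (fun t => (f t : ℂ)) I :=
    fun h => Complex.ofRealCLM.contDiff.comp_contDiffOn h
  have hfst : ContDiffAt ℝ ∞ (fun p : Cn (k + 1) × ℝ × ℝ => (γ p.2.1 * ξ p.2.2) • p.1) p :=
    ((c1 hγ.contDiffOn).mul (c2 hξ.contDiffOn)).smul contDiffAt_fst
  have hsnd : ContDiffAt ℝ ∞
      (fun p : Cn (k + 1) × ℝ × ℝ => (profileMap γ ξ s₁ s₂ p.2.1 p.2.2).2) p := by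
    have h1 := c1 (ofR (contDiffOn_normSq hγ.contDiffOn))
    have h2 := c2 (ofR (contDiffOn_normSq hξ.contDiffOn))
    have h3 := c1 (ofR (contDiffOn_beta hγ.isOpen hγ.ordConnected hγ.contDiffOn hγ.mem))
    have h4 := c2 (ofR (contDiffOn_beta hξ.isOpen hξ.ordConnected hξ.contDiffOn hξ.mem))
    have h5 := ((contDiffAt_const (c := (1 / 2 : ℂ))).mul (h2.sub h1)).add
      ((contDiffAt_const (c := Complex.I)).mul (h4.sub h3))
    refine h5.congr_of_eventuallyEq (Eventually.of_forall fun p => ?_)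
    simp [profileMap]
  exact ((pairL (k + 1)).restrictScalars ℝ).contDiff.contDiffAt.comp p (hfst.prodMk hsnd)

theorem contDiffAt_primitive {p : Cn (k + 1) × ℝ × ℝ} (hx : p.2.1 ∈ I₁) (hy : p.2.2 ∈ I₂) :
    ContDiffAt ℝ ∞ (fun p : Cn (k + 1) × ℝ × ℝ => primitive γ ξ s₁ s₂ p.2.1 p.2.2) p := by
  have hX : ContDiffAt ℝ ∞ (fun p : Cn (k + 1) × ℝ × ℝ => p.2.1) p :=
    contDiffAt_fst.comp p contDiffAt_snd
  have hY : ContDiffAt ℝ ∞ (fun p : Cn (k + 1) × ℝ × ℝ => p.2.2) p :=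
    contDiffAt_snd.comp p contDiffAt_snd
  have c1 : ∀ {f : ℝ → ℝ}, ContDiffOn ℝ ∞ f I₁ →
      ContDiffAt ℝ ∞ (fun p : Cn (k + 1) × ℝ × ℝ => f p.2.1) p := fun h =>
    (h.contDiffAt (hγ.isOpen.mem_nhds hx)).comp p hX
  have c2 : ∀ {f : ℝ → ℝ}, ContDiffOn ℝ ∞ f I₂ →
      ContDiffAt ℝ ∞ (fun p : Cn (k + 1) × ℝ × ℝ => f p.2.2) p := fun h =>
    (h.contDiffAt (hξ.isOpen.mem_nhds hy)).comp p hY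
  have h1 := c1 (contDiffOn_normSq hγ.contDiffOn)
  have h2 := c2 (contDiffOn_normSq hξ.contDiffOn)
  have h3 := c1 (contDiffOn_beta hγ.isOpen hγ.ordConnected hγ.contDiffOn hγ.mem)
  have h4 := c2 (contDiffOn_beta hξ.isOpen hξ.ordConnected hξ.contDiffOn hξ.mem)
  have h5 := c1 (contDiffOn_betaTilde hγ.isOpen hγ.ordConnected hγ.contDiffOn hγ.mem)
  have h6 := c2 (contDiffOn_betaTilde hξ.isOpen hξ.ordConnected hξ.contDiffOn hξ.mem)
  exact ((((contDiffAt_const (c := -(1 / 2 : ℝ))).mul (h1.sub h2)).mul (h3.sub h4)).add h5).add h6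

variable {w : ℝ → Cn (k + 1)} {w' : Cn (k + 1)} {x y : ℝ → ℝ} {x' y' t : ℝ}

/-- The function β is chosen so that ½|γ|² + iβ_γ has derivative γ̄γ'. This produces the last
coordinates −γ̄γ' and ξ̄ξ' of the two parameter velocities. -/
theorem hasDerivAt_orbitMap (hw : HasDerivAt w w' t) (hx : HasDerivAt x x' t)
    (hy : HasDerivAt y y' t) (hxI : x t ∈ I₁) (hyI : y t ∈ I₂) :
    HasDerivAt (fun τ => orbitMap γ ξ s₁ s₂ (w τ, x τ, y τ))
      (pair ((γ (x t) * ξ (y t)) • w') 0 +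
        x' • pair ((deriv γ (x t) * ξ (y t)) • w t) (-(conj (γ (x t)) * deriv γ (x t))) +
        y' • pair ((γ (x t) * deriv ξ (y t)) • w t) (conj (ξ (y t)) * deriv ξ (y t))) t := by
  have dγ : HasDerivAt (fun τ => γ (x τ)) (x' • deriv γ (x t)) t :=
    (hγ.hasDerivAt hxI).scomp t hx
  have dξ : HasDerivAt (fun τ => ξ (y τ)) (y' • deriv ξ (y t)) t :=
    (hξ.hasDerivAt hyI).scomp t hy
  have dnγ := hasDerivAt_normSq dγ
  have dnξ := hasDerivAt_normSq dξ
  have dbγ := (hasDerivAt_beta hγ.isOpen hγ.ordConnected hγ.contDiffOn hγ.mem hxI).scomp t hx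
  have dbξ := (hasDerivAt_beta hξ.isOpen hξ.ordConnected hξ.contDiffOn hξ.mem hyI).scomp t hy
  have dsnd := (((dnξ.sub dnγ).const_mul (1 / 2 : ℝ)).ofReal_comp).add
    (((dbξ.sub dbγ).ofReal_comp).const_mul Complex.I)
  have dfst := (dγ.mul dξ).smul hw
  have h := ((pairL (k + 1)).restrictScalars ℝ).hasFDerivAt.comp_hasDerivAt t (dfst.prodMk dsnd)
  refine h.congr_deriv ?_
  have hp : ∀ (r : ℝ) (z : Cn (k + 1)) (u : ℂ), r • pair z u = pair ((r : ℂ) • z) ((r : ℂ) * u) := by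
    intro r z u
    rw [pair_smul, Complex.coe_smul]
  rw [hp, hp, ← pair_add, ← pair_add]
  change pair _ _ = pair _ _
  congr 1
  · simp only [Complex.real_smul, smul_smul, add_smul, Pi.mul_apply]
    rw [add_assoc]
    congr 1
    congr 1
    · congr 1; ring
    · congr 1; ring
  · have e1 : conj (γ (x t)) * x' • deriv γ (x t) = (x' : ℂ) * (conj (γ (x t)) * deriv γ (x t)) := by
      rw [Complex.real_smul]; ring
    have e2 : conj (ξ (y t)) * y' • deriv ξ (y t) = (y' : ℂ) * (conj (ξ (y t)) * deriv ξ (y t)) := by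
      rw [Complex.real_smul]; ring
    rw [e1, e2]
    set P := conj (γ (x t)) * deriv γ (x t)
    set Q := conj (ξ (y t)) * deriv ξ (y t)
    apply Complex.ext <;> simp <;> ring

theorem hasDerivAt_primitive (hx : HasDerivAt x x' t)
    (hy : HasDerivAt y y' t) (hxI : x t ∈ I₁) (hyI : y t ∈ I₂) :
    HasDerivAt (fun τ => primitive γ ξ s₁ s₂ (x τ) (y τ))
      (-(x' * (conj (γ (x t)) * deriv γ (x t)).re - y' * (conj (ξ (y t)) * deriv ξ (y t)).re) *
          (beta γ s₁ (x t) - beta ξ s₂ (y t)) -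
        1 / 2 * (‖γ (x t)‖ ^ 2 - ‖ξ (y t)‖ ^ 2) *
          (x' * (conj (γ (x t)) * deriv γ (x t)).im - y' * (conj (ξ (y t)) * deriv ξ (y t)).im) +
        x' * (‖γ (x t)‖ ^ 2 * (conj (γ (x t)) * deriv γ (x t)).im) +
        y' * (‖ξ (y t)‖ ^ 2 * (conj (ξ (y t)) * deriv ξ (y t)).im)) t := by
  have dnγ := (hasDerivAt_normSq (hγ.hasDerivAt hxI)).scomp t hx
  have dnξ := (hasDerivAt_normSq (hξ.hasDerivAt hyI)).scomp t hy
  have dbγ := (hasDerivAt_beta hγ.isOpen hγ.ordConnected hγ.contDiffOn hγ.mem hxI).scomp t hx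
  have dbξ := (hasDerivAt_beta hξ.isOpen hξ.ordConnected hξ.contDiffOn hξ.mem hyI).scomp t hy
  have dtγ := (hasDerivAt_betaTilde hγ.isOpen hγ.ordConnected hγ.contDiffOn hγ.mem hxI).scomp t hx
  have dtξ := (hasDerivAt_betaTilde hξ.isOpen hξ.ordConnected hξ.contDiffOn hξ.mem hyI).scomp t hy
  have h := ((((dnγ.sub dnξ).const_mul (-(1 / 2 : ℝ))).mul (dbγ.sub dbξ)).add dtγ).add dtξ
  refine h.congr_deriv ?_
  simp only [smul_eq_mul, Pi.sub_apply, Function.comp_apply]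
  ring

omit hγ hξ in
/-- The Liouville form on the velocity of the Ansatz. -/
theorem liouville_orbitMap {v v' : Cn (k + 1)} {x y x' y' : ℝ} (hv : ‖v‖ = 1)
    (hvv' : inner ℂ v v' = 0) :
    liouville (orbitMap γ ξ s₁ s₂ (v, x, y))
      (pair ((γ x * ξ y) • v') 0 +
        x' • pair ((deriv γ x * ξ y) • v) (-(conj (γ x) * deriv γ x)) +
        y' • pair ((γ x * deriv ξ y) • v) (conj (ξ y) * deriv ξ y)) =
      -(x' * (conj (γ x) * deriv γ x).re - y' * (conj (ξ y) * deriv ξ y).re) *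
          (beta γ s₁ x - beta ξ s₂ y) -
        1 / 2 * (‖γ x‖ ^ 2 - ‖ξ y‖ ^ 2) *
          (x' * (conj (γ x) * deriv γ x).im - y' * (conj (ξ y) * deriv ξ y).im) +
        x' * (‖γ x‖ ^ 2 * (conj (γ x) * deriv γ x).im) +
        y' * (‖ξ y‖ ^ 2 * (conj (ξ y) * deriv ξ y).im) := by
  have hvv : inner ℂ v v = 1 := by rw [inner_self_eq_norm_sq_to_K, hv]; simp
  have hsm : ∀ (r : ℝ) (z : Cn (k + 2)), r • z = (r : ℂ) • z := fun r z => (Complex.coe_smul r z).symm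
  rw [liouville, orbitMap, inner_add_right, inner_add_right, hsm, hsm, inner_smul_right,
    inner_smul_right, inner_pair, inner_pair, inner_pair]
  simp only [inner_smul_left, inner_smul_right, hvv, hvv', mul_zero, mul_one, add_zero, zero_add]
  have hA : conj ((profileMap γ ξ s₁ s₂ x y).2) = ((1 / 2 * (‖ξ y‖ ^ 2 - ‖γ x‖ ^ 2) : ℝ) : ℂ) -
      Complex.I * ((beta ξ s₂ y - beta γ s₁ x : ℝ) : ℂ) := by
    simp only [profileMap, map_add, map_mul, Complex.conj_ofReal, Complex.conj_I]
    ring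
  rw [hA]
  have e1 : (deriv γ x * ξ y) * conj (γ x * ξ y) =
      ((‖ξ y‖ ^ 2 : ℝ) : ℂ) * (conj (γ x) * deriv γ x) := by
    push_cast
    rw [← Complex.conj_mul', map_mul]
    ring
  have e2 : (γ x * deriv ξ y) * conj (γ x * ξ y) =
      ((‖γ x‖ ^ 2 : ℝ) : ℂ) * (conj (ξ y) * deriv ξ y) := by
    push_cast
    rw [← Complex.conj_mul', map_mul]
    ring
  rw [e1, e2]
  set P := conj (γ x) * deriv γ x
  set Q := conj (ξ y) * deriv ξ y
  simp only [Complex.add_im, Complex.mul_im, Complex.sub_im, Complex.sub_re, Complex.mul_re,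
    Complex.ofReal_re, Complex.ofReal_im, Complex.I_re, Complex.I_im, Complex.neg_im,
    Complex.neg_re, Complex.add_re]
  ring

end Derivatives

/-! ## The frame of the tangent plane -/

/-- A linear map that sends the standard basis to positive multiples of a unitary frame. -/
theorem lagrangian_of_unitary_frame {d : ℕ} {L : EuclideanSpace ℝ (Fin d) →L[ℝ] Cn d}
    {e : Fin d → Cn d} (he : Orthonormal ℂ e) {r : Fin d → ℝ} (hr : ∀ j, r j ≠ 0)
    (hL : ∀ v, L v = ∑ j, ((v j * r j : ℝ) : ℂ) • e j) :
    Function.Injective L ∧ (∀ u v, kaehler (L u) (L v) = 0) ∧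
      Submodule.span ℝ (Set.range e) =
        LinearMap.range (L : EuclideanSpace ℝ (Fin d) →ₗ[ℝ] Cn d) := by
  have hin : ∀ v i, inner ℂ (e i) (L v) = ((v i * r i : ℝ) : ℂ) := fun v i => by
    rw [hL, he.inner_right_fintype]
  refine ⟨fun u v huv => ?_, fun u v => ?_, le_antisymm ?_ ?_⟩
  · ext i
    have h1 := hin u i
    rw [huv, hin v i, Complex.ofReal_inj] at h1
    exact (mul_right_cancel₀ (hr i) h1).symm
  · rw [kaehler, hL u, sum_inner, Complex.im_sum]
    refine Finset.sum_eq_zero fun j _ => ?_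
    rw [inner_smul_left, hin, Complex.conj_ofReal, ← Complex.ofReal_mul, Complex.ofReal_im]
  · rw [Submodule.span_le]
    rintro _ ⟨i, rfl⟩
    refine ⟨(r i)⁻¹ • EuclideanSpace.single i 1, ?_⟩
    change L _ = _
    rw [hL, Finset.sum_eq_single i]
    · simp [hr i]
    · intro j _ hj
      simp [hj]
    · simp
  · rintro _ ⟨v, rfl⟩
    change L v ∈ _
    rw [hL]
    refine Submodule.sum_mem _ fun j _ => ?_
    rw [Complex.coe_smul]
    exact Submodule.smul_mem _ _ (Submodule.subset_span ⟨j, rfl⟩)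

theorem div_norm_sq (z : ℂ) : (z / ‖z‖) ^ 2 = z / conj z := by
  by_cases hz : z = 0
  · simp [hz]
  have h1 : (‖z‖ : ℂ) ≠ 0 := by exact_mod_cast norm_ne_zero_iff.2 hz
  have h2 : conj z ≠ 0 := (map_ne_zero _).2 hz
  rw [div_pow, div_eq_div_iff (pow_ne_zero 2 h1) h2, ← Complex.mul_conj']
  ring

/-- The unitary frame of the tangent plane of the Ansatz. -/
theorem exists_unitary_frame {G : Subgroup (SU (k + 1))} {V : Cn (k + 1)}
    {ν : Fin k → Cn (k + 1)} (hD : AdaptedData G V ν) {g : SU (k + 1)} {a b a' b' : ℂ}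
    (ha : a ≠ 0) (hb : b ≠ 0) (ha' : a' ≠ 0) (hb' : b' ≠ 0) :
    ∃ (e : Fin (k + 2) → Cn (k + 2)) (r : Fin (k + 2) → ℝ), Orthonormal ℂ e ∧ (∀ j, r j ≠ 0) ∧
      holVol e ^ 2 = ((a / conj a) ^ k * (a' / conj a')) * ((b / conj b) ^ k * (b' / conj b')) ∧
      ∀ v : Fin (k + 2) → ℝ, ∑ j, ((v j * r j : ℝ) : ℂ) • e j =
        pair ((a * b) • ∑ i, v (i.castSucc.castSucc) • act (g : Mat (k + 1)) (ν i)) 0 +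
        v (Fin.last k).castSucc • pair ((a' * b) • act (g : Mat (k + 1)) V) (-(conj a * a')) +
        v (Fin.last (k + 1)) • pair ((a * b') • act (g : Mat (k + 1)) V) (conj b * b') := by
  set gV := act (g : Mat (k + 1)) V with hgV
  set gν : Fin k → Cn (k + 1) := fun i => act (g : Mat (k + 1)) (ν i) with hgν
  have hg := star_mul_self_of_SU g
  have hVV : inner ℂ gV gV = 1 := by
    rw [hgV, inner_act_act hg, inner_self_eq_norm_sq_to_K, hD.norm_eq]; simp
  have hνV : ∀ i, inner ℂ (gν i) gV = 0 := fun i => by rw [hgV, hgν, inner_act_act hg, hD.inner_eq]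
  have hνν : Orthonormal ℂ gν := by
    have := hD.orthonormal
    rw [orthonormal_iff_ite] at this ⊢
    intro i j
    rw [hgν, inner_act_act hg, this]
  -- Both parameter velocities carry the same factor √R in their lengths, and in their Hermitian
  -- product the contributions of the two coordinates cancel.
  set R : ℝ := ‖a‖ ^ 2 + ‖b‖ ^ 2 with hR
  have hRpos : 0 < R := by positivity
  have hRC : (R : ℂ) = conj a * a + conj b * b := by
    rw [hR, Complex.conj_mul', Complex.conj_mul']; push_cast; rfl
  set ux := pair ((a' * b) • gV) (-(conj a * a')) with hux
  set uy := pair ((a * b') • gV) (conj b * b') with huy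
  have hxx : ‖ux‖ = ‖a'‖ * √R := by
    rw [← sq_eq_sq₀ (norm_nonneg _) (by positivity), mul_pow, Real.sq_sqrt hRpos.le, hux,
      norm_pair_sq, norm_smul, norm_neg, norm_mul, norm_mul, hgV, norm_act hg, hD.norm_eq,
      RCLike.norm_conj, hR]
    ring
  have hyy : ‖uy‖ = ‖b'‖ * √R := by
    rw [← sq_eq_sq₀ (norm_nonneg _) (by positivity), mul_pow, Real.sq_sqrt hRpos.le, huy,
      norm_pair_sq, norm_smul, norm_mul, norm_mul, hgV, norm_act hg, hD.norm_eq,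
      RCLike.norm_conj, hR]
    ring
  have hx0 : ‖ux‖ ≠ 0 := by rw [hxx]; positivity
  have hy0 : ‖uy‖ ≠ 0 := by rw [hyy]; positivity
  have hc0 : ‖a * b‖ ≠ 0 := norm_ne_zero_iff.2 (mul_ne_zero ha hb)
  have hxy : inner ℂ ux uy = 0 := by
    rw [hux, huy, inner_pair, inner_smul_left, inner_smul_right, hVV]
    simp only [map_mul, map_neg, Complex.conj_conj]
    ring
  set w : ℂ := (a * b) / ‖a * b‖ with hw
  have hw1 : ‖w‖ = 1 := by
    rw [hw, norm_div, Complex.norm_real, norm_norm, div_self hc0]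
  set e := frame (fun i => w • gν i) (((‖ux‖⁻¹ : ℝ) : ℂ) • ux) (((‖uy‖⁻¹ : ℝ) : ℂ) • uy) with he
  set r : Fin (k + 2) → ℝ := Fin.snoc (α := fun _ => ℝ) (Fin.snoc (α := fun _ => ℝ)
    (fun _ : Fin k => ‖a * b‖) ‖ux‖) ‖uy‖ with hr
  have hwν : Orthonormal ℂ fun i => w • gν i := by
    rw [orthonormal_iff_ite] at hνν ⊢
    intro i j
    rw [inner_smul_left, inner_smul_right, hνν, ← mul_assoc, Complex.conj_mul', hw1]
    simp
  have hvol : holVol (frame gν (pair gV 0) (lastVec (k + 1))) ^ 2 = 1 := by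
    have h1 := holVol_frame_act g ν V 0 0 1
    rw [act_zero_right] at h1
    change holVol (frame gν (pair gV 0) (lastVec (k + 1))) = _ at h1
    rw [h1]
    exact hD.holVol_sq
  refine ⟨e, r, orthonormal_frame hwν ?_ ?_ ?_ ?_ ?_, ?_, ?_, fun v => ?_⟩
  · rw [norm_smul, Complex.norm_real, norm_inv, norm_norm, inv_mul_cancel₀ hx0]
  · rw [norm_smul, Complex.norm_real, norm_inv, norm_norm, inv_mul_cancel₀ hy0]
  · rw [inner_smul_left, inner_smul_right, hxy]; simp
  · intro i
    rw [inner_smul_right, hux, inner_pair, inner_smul_left, inner_smul_right, hνV]; simp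
  · intro i
    rw [inner_smul_right, huy, inner_pair, inner_smul_left, inner_smul_right, hνV]; simp
  · refine forall_fin_add_two (fun i => ?_) ?_ ?_
    · simpa only [hr, Fin.snoc_castSucc] using hc0
    · simpa only [hr, Fin.snoc_castSucc, Fin.snoc_last] using hx0
    · simpa only [hr, Fin.snoc_last] using hy0
  · have h1 : frame gν ux uy = frame gν ((a' * b) • pair gV 0 + (-(conj a * a')) • lastVec (k + 1))
        ((a * b') • pair gV 0 + (conj b * b') • lastVec (k + 1)) := by
      have : ∀ α β : ℂ, pair (α • gV) β = α • pair gV 0 + β • lastVec (k + 1) := fun α β => by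
        rw [lastVec, ← pair_smul, ← pair_smul, ← pair_add]; simp
      rw [hux, huy, this, this]
    rw [he, holVol_frame_smul, holVol_frame_smul_smul, h1, holVol_frame_combination, mul_pow,
      mul_pow, mul_pow, mul_pow, hvol, hxx, hyy]
    -- In the basis (gV, 0), e_m the two parameter velocities have determinant a'b'R. Division by
    -- their lengths leaves the phases of a' and b', and the orbit directions add the k-th power of
    -- the phase w of ab.
    have h2 : a' * b * (conj b * b') - -(conj a * a') * (a * b') = a' * b' * R := by
      rw [hRC]; ring
    rw [h2]
    have hsR : ((√R : ℝ) : ℂ) ^ 2 = R := by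
      rw [← Complex.ofReal_pow, Real.sq_sqrt hRpos.le]
    have hR0 : (R : ℂ) ≠ 0 := by exact_mod_cast hRpos.ne'
    have hn1 : (‖a'‖ : ℂ) ≠ 0 := by exact_mod_cast norm_ne_zero_iff.2 ha'
    have hn2 : (‖b'‖ : ℂ) ≠ 0 := by exact_mod_cast norm_ne_zero_iff.2 hb'
    have hsR0 : ((√R : ℝ) : ℂ) ≠ 0 := by exact_mod_cast (Real.sqrt_pos.2 hRpos).ne'
    have h3 : (w ^ k) ^ 2 = (a / conj a) ^ k * (b / conj b) ^ k := by
      rw [← pow_mul, mul_comm k 2, pow_mul, hw, div_norm_sq, map_mul, mul_div_mul_comm, mul_pow]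
    rw [h3, ← div_norm_sq a', ← div_norm_sq b']
    push_cast
    have h4 : ((‖a'‖ * √R : ℂ)⁻¹ * (‖b'‖ * √R : ℂ)⁻¹) ^ 2 * (a' * b' * R) ^ 2 =
        (a' / ‖a'‖) ^ 2 * (b' / ‖b'‖) ^ 2 := by
      rw [← hsR]
      field_simp
    linear_combination (a / conj a) ^ k * (b / conj b) ^ k * h4
  · rw [Fin.sum_univ_castSucc, Fin.sum_univ_castSucc]
    simp only [he, hr, frame_castSucc, frame_last_castSucc, frame_last, Fin.snoc_castSucc,
      Fin.snoc_last]
    have hs : ∀ (s n : ℝ) (u : Cn (k + 2)), n ≠ 0 →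
        ((s * n : ℝ) : ℂ) • ((n⁻¹ : ℝ) : ℂ) • u = s • u := by
      intro s n u hn
      rw [smul_smul, ← Complex.ofReal_mul, mul_assoc, mul_inv_cancel₀ hn, mul_one, Complex.coe_smul]
    rw [hs _ _ _ hx0, hs _ _ _ hy0]
    congr 2
    have h5 : ∀ i, (((v i.castSucc.castSucc * ‖a * b‖ : ℝ)) : ℂ) • pair (w • gν i) 0 =
        pair ((a * b) • v i.castSucc.castSucc • gν i) 0 := by
      intro i
      have hc : (‖a * b‖ : ℂ) ≠ 0 := by exact_mod_cast hc0
      rw [← pair_smul, mul_zero, smul_smul, ← Complex.coe_smul, smul_smul]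
      congr 2
      rw [hw]
      push_cast
      field_simp
    rw [Finset.sum_congr rfl fun i _ => h5 i, Finset.smul_sum]
    exact (map_sum (inclL (k + 1)) _ _).symm

end CohomTwo

end

noncomputable section

open scoped Manifold ContDiff Matrix Matrix.Norms.L2Operator
open Filter Topology

namespace CohomTwo

/-! ## The manifold orbit times parameters -/

variable {k : ℕ}

/-- Splitting off the last two coordinates. -/
def splitL (k : ℕ) : EuclideanSpace ℝ (Fin (k + 2)) ≃L[ℝ] EuclideanSpace ℝ (Fin k) × ℝ × ℝ :=
  LinearEquiv.toContinuousLinearEquiv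
    { toFun := fun v => (WithLp.toLp 2 fun i => v i.castSucc.castSucc, v (Fin.last k).castSucc,
        v (Fin.last (k + 1)))
      invFun := fun p => WithLp.toLp 2 (Fin.snoc (α := fun _ => ℝ)
        (Fin.snoc (α := fun _ => ℝ) p.1.ofLp p.2.1) p.2.2)
      map_add' := fun _ _ => rfl
      map_smul' := fun _ _ => rfl
      left_inv := fun v => by
        ext i
        revert i
        refine forall_fin_add_two (fun i => ?_) ?_ ?_ <;> simp
      right_inv := fun p => by
        refine Prod.ext ?_ (Prod.ext ?_ ?_)
        · ext i; simp
        · simp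
        · simp }

variable {n : ℕ} {G : Subgroup (SU n)} {V : Cn n}

theorem act_mem_orbit {g : SU n} (hg : g ∈ G) {w : Cn n} (hw : w ∈ orbit G V) :
    act (g : Mat n) w ∈ orbit G V := by
  obtain ⟨h, hh, rfl⟩ := hw
  exact ⟨g * h, G.mul_mem hg hh, act_mul (g : Mat n) (h : Mat n) V⟩

theorem act_star_act (g : SU n) (w : Cn n) : act (star (g : Mat n)) (act (g : Mat n) w) = w := by
  rw [← act_mul, star_mul_self_of_SU, act_one]

theorem act_act_star (g : SU n) (w : Cn n) : act (g : Mat n) (act (star (g : Mat n)) w) = w := by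
  rw [← act_mul, SU_mul_star_self, act_one]

/-- The local parametrisation around `g V` of the product of the orbit of `V` with a domain in the
plane. -/
def LocalParam.ofOrbit (Q : LocalParam (EuclideanSpace ℝ (Fin k)) (orbit G V)) {g : SU n}
    (hg : g ∈ G) {Ω : Set (ℝ × ℝ)} (hΩ : IsOpen Ω) :
    LocalParam (EuclideanSpace ℝ (Fin (k + 2))) (orbit G V ×ˢ Ω) where
  param v := (act (g : Mat n) (Q.param (splitL k v).1), (splitL k v).2)
  coord p := (splitL k).symm (Q.coord (act (star (g : Mat n)) p.1), p.2)
  dom := splitL k ⁻¹' (Q.dom ×ˢ Ω)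
  nhd := {p | act (star (g : Mat n)) p.1 ∈ Q.nhd ∧ p.2 ∈ Ω}
  isOpen_dom := (Q.isOpen_dom.prod hΩ).preimage (splitL k).continuous
  isOpen_nhd := (Q.isOpen_nhd.preimage ((actL n (star (g : Mat n))).continuous.comp
    continuous_fst)).inter (hΩ.preimage continuous_snd)
  contDiffOn_param := by
    refine ContDiffOn.prodMk ?_ (contDiff_snd.comp (splitL k).contDiff).contDiffOn
    refine ((actL n (g : Mat n)).restrictScalars ℝ).contDiff.comp_contDiffOn ?_
    exact Q.contDiffOn_param.comp (contDiff_fst.comp (splitL k).contDiff).contDiffOn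
      fun v hv => hv.1
  contDiffOn_coord := by
    refine (splitL k).symm.contDiff.comp_contDiffOn (ContDiffOn.prodMk ?_ contDiff_snd.contDiffOn)
    exact Q.contDiffOn_coord.comp
      (((actL n (star (g : Mat n))).restrictScalars ℝ).contDiff.comp contDiff_fst).contDiffOn
      fun p hp => hp.1
  param_mem v hv := ⟨act_mem_orbit hg (Q.param_mem _ hv.1), hv.2⟩
  param_mem_nhd v hv := by
    refine ⟨?_, hv.2⟩
    rw [act_star_act]
    exact Q.param_mem_nhd _ hv.1
  coord_mem p hp hp' := by
    change splitL k ((splitL k).symm _) ∈ Q.dom ×ˢ Ω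
    rw [ContinuousLinearEquiv.apply_symm_apply]
    exact ⟨Q.coord_mem _ (act_mem_orbit (G.inv_mem hg) hp.1) hp'.1, hp'.2⟩
  coord_param v hv := by
    rw [act_star_act, Q.coord_param _ hv.1]
    exact (splitL k).symm_apply_apply v
  param_coord p hp hp' := by
    have h : Q.param (Q.coord (act (star (g : Mat n)) p.1)) = act (star (g : Mat n)) p.1 :=
      Q.param_coord _ (act_mem_orbit (G.inv_mem hg) hp.1) hp'.1
    rw [ContinuousLinearEquiv.apply_symm_apply, h, act_act_star]

/-- The product of an orbit with a domain in the plane is a manifold, in which derivatives can be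
computed along one-parameter families in the orbit. -/
theorem exists_chartedSpace_orbit (hG : IsCompact (G : Set (SU n)))
    {ν : Fin k → Cn n} (hν : Orthonormal ℝ ν)
    (hspan : Submodule.span ℝ (Set.range ν) = orbitTangent G V) {Ω : Set (ℝ × ℝ)}
    (hΩ : IsOpen Ω) :
    ∃ _ : ChartedSpace (EuclideanSpace ℝ (Fin (k + 2))) (orbit G V ×ˢ Ω : Set (Cn n × ℝ × ℝ)),
      IsManifold 𝓘(ℝ, EuclideanSpace ℝ (Fin (k + 2))) ∞
        (orbit G V ×ˢ Ω : Set (Cn n × ℝ × ℝ)) ∧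
      ∀ (F : Type) [NormedAddCommGroup F] [NormedSpace ℝ F] (f : Cn n × ℝ × ℝ → F),
        (∀ p ∈ orbit G V ×ˢ Ω, ContDiffAt ℝ ∞ f p) →
        ContMDiff 𝓘(ℝ, EuclideanSpace ℝ (Fin (k + 2))) 𝓘(ℝ, F) ∞
          (fun p : (orbit G V ×ˢ Ω : Set (Cn n × ℝ × ℝ)) => f p) ∧
        ∀ p : (orbit G V ×ˢ Ω : Set (Cn n × ℝ × ℝ)), ∃ g ∈ G, act (g : Mat n) V = p.1.1 ∧
          ∀ v : EuclideanSpace ℝ (Fin (k + 2)), ∃ w : ℝ → Cn n, w 0 = p.1.1 ∧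
            HasDerivAt w (∑ i : Fin k, v i.castSucc.castSucc • act (g : Mat n) (ν i)) 0 ∧
            HasDerivAt (fun τ : ℝ => f (w τ, p.1.2.1 + τ * v (Fin.last k).castSucc,
              p.1.2.2 + τ * v (Fin.last (k + 1))))
              ((mfderiv 𝓘(ℝ, EuclideanSpace ℝ (Fin (k + 2))) 𝓘(ℝ, F)
                (fun p : (orbit G V ×ˢ Ω : Set (Cn n × ℝ × ℝ)) => f p) p :
                  EuclideanSpace ℝ (Fin (k + 2)) →L[ℝ] F) v) 0 := by
  have hX : ∀ i, ∃ X ∈ lieAlg G, act X V = ν i := fun i =>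
    (mem_orbitTangent hG).1 (hspan ▸ Submodule.subset_span ⟨i, rfl⟩)
  choose X hXG hXν using hX
  obtain ⟨Q, hQ, hQV, hQ0⟩ := exists_localParam_orbit hG hν hspan hXG hXν
  -- By homogeneity one parametrisation at V suffices; the unitary g moves it to gV.
  choose g hg hgV using fun p : (orbit G V ×ˢ Ω : Set (Cn n × ℝ × ℝ)) => p.2.1
  set P : (orbit G V ×ˢ Ω : Set (Cn n × ℝ × ℝ)) →
    LocalParam (EuclideanSpace ℝ (Fin (k + 2))) (orbit G V ×ˢ Ω) := fun p => Q.ofOrbit (hg p) hΩ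
  have hstar : ∀ p, act (star (g p : Mat n)) p.1.1 = V := fun p => by
    rw [← hgV p, act_star_act]
  have hP : ∀ p, (p : Cn n × ℝ × ℝ) ∈ (P p).nhd := by
    intro p
    refine ⟨?_, p.2.2⟩
    rw [hstar]
    exact hQV
  refine ⟨chartedSpaceOfLocalParam P hP, isManifold_of_localParam P hP, ?_⟩
  intro F _ _ f hf
  refine ⟨contMDiff_of_localParam P hP hf, fun p => ⟨g p, hg p, hgV p, fun v => ?_⟩⟩
  rw [mfderiv_of_localParam P hP hf p]
  have hq : splitL k ((P p).coord p) = (0, p.1.2) := by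
    change splitL k ((splitL k).symm (Q.coord (act (star (g p : Mat n)) p.1.1), p.1.2)) = _
    rw [ContinuousLinearEquiv.apply_symm_apply, hstar, hQ0]
  set q := (P p).coord p with hqdef
  set u : EuclideanSpace ℝ (Fin k) := (splitL k v).1 with hu
  refine ⟨fun τ => act (g p : Mat n) (orbitParam X V (τ • u)), ?_, ?_, ?_⟩
  · simp [hgV]
  · have h1 : HasDerivAt (fun τ : ℝ => τ • u) u 0 := by
      simpa using (hasDerivAt_id (0 : ℝ)).smul_const u
    have h2 : HasFDerivAt (orbitParam X V) (((orbitMapL V).restrictScalars ℝ).comp (combL X))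
        ((0 : ℝ) • u) := by rw [zero_smul]; exact hasFDerivAt_orbitParam X V
    have h3 := ((actL n (g p : Mat n)).restrictScalars ℝ).hasFDerivAt.comp_hasDerivAt (0 : ℝ)
      (h2.comp_hasDerivAt (0 : ℝ) h1)
    refine h3.congr_deriv ?_
    change act (g p : Mat n) (act (combL X u) V) = _
    rw [act_combL]
    refine (map_sum ((actL n (g p : Mat n)).restrictScalars ℝ) _ _).trans ?_
    refine Finset.sum_congr rfl fun i _ => ?_
    rw [hXν]
    exact act_real_smul_right _ _ _
  · have hqd : q ∈ (P p).dom := (P p).coord_mem p p.2 (hP p)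
    have hpar : ContDiffAt ℝ ∞ (P p).param q :=
      (P p).contDiffOn_param.contDiffAt ((P p).isOpen_dom.mem_nhds hqd)
    have hcomp : ContDiffAt ℝ ∞ (f ∘ (P p).param) q := by
      refine ContDiffAt.comp _ ?_ hpar
      rw [(P p).param_coord p p.2 (hP p)]
      exact hf p p.2
    have h1 : HasDerivAt (fun τ : ℝ => q + τ • v) v 0 := by
      simpa using ((hasDerivAt_id (0 : ℝ)).smul_const v).const_add q
    have h2 : HasFDerivAt (f ∘ (P p).param) (fderiv ℝ (f ∘ (P p).param) q) (q + (0 : ℝ) • v) := by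
      rw [zero_smul, add_zero]
      exact (hcomp.differentiableAt (by simp)).hasFDerivAt
    have h3 := h2.comp_hasDerivAt (0 : ℝ) h1
    refine h3.congr_of_eventuallyEq (Eventually.of_forall fun τ => ?_)
    change _ = f (act (g p : Mat n) (Q.param (splitL k (q + τ • v)).1), (splitL k (q + τ • v)).2)
    rw [map_add, map_smul, hq, hQ, Prod.fst_add, Prod.snd_add, zero_add]
    rfl

end CohomTwo

end

noncomputable section

open scoped Manifold ContDiff Matrix Matrix.Norms.L2Operator
open Filter Topology

namespace CohomTwo

open ComplexConjugate

/-! ## Invariance and cohomogeneity of the image -/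

variable {k : ℕ} {G : Subgroup (SU (k + 1))} {γ ξ : ℝ → ℂ} {s₁ s₂ : ℝ} {I₁ I₂ : Set ℝ}
  {z' : Cn (k + 1)} {Φ : (Submodule.span ℂ {z'}) ≃ₗ[ℂ] ℂ}

theorem mem_ansatzImage {p : Cn (k + 2)} : p ∈ ansatzImage G Φ γ ξ s₁ s₂ I₁ I₂ ↔
    ∃ g ∈ G, ∃ x ∈ I₁, ∃ y ∈ I₂,
      orbitMap γ ξ s₁ s₂ (act (g : Mat (k + 1)) (Φ.symm 1 : Cn (k + 1)), x, y) = p := by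
  constructor
  · rintro ⟨⟨g, x, y⟩, ⟨hg, hx, hy⟩, rfl⟩
    exact ⟨g, hg, x, hx, y, hy, (ansatz_eq Φ γ ξ s₁ s₂ _ x y).symm⟩
  · rintro ⟨g, hg, x, hx, y, hy, rfl⟩
    exact ⟨⟨g, x, y⟩, ⟨hg, hx, hy⟩, ansatz_eq Φ γ ξ s₁ s₂ _ x y⟩

theorem act_extMatrix_orbitMap (A : Mat (k + 1)) (w : Cn (k + 1)) (x y : ℝ) :
    act (extMatrix A) (orbitMap γ ξ s₁ s₂ (w, x, y)) = orbitMap γ ξ s₁ s₂ (act A w, x, y) := by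
  rw [orbitMap, act_extMatrix, act_smul_right]
  rfl

theorem orbitMap_mem_axis {w : Cn (k + 1)} (hw : w ≠ 0) {x y : ℝ} :
    orbitMap γ ξ s₁ s₂ (w, x, y) ∈ axis (k + 1) ↔ γ x * ξ y = 0 := by
  rw [orbitMap, pair_mem_axis, smul_eq_zero, or_iff_left hw]

theorem orbitMap_left_injective {w w' : Cn (k + 1)} {x y : ℝ} (h : γ x * ξ y ≠ 0) :
    orbitMap γ ξ s₁ s₂ (w, x, y) = orbitMap γ ξ s₁ s₂ (w', x, y) ↔ w = w' :=
  ⟨fun he => smul_right_injective _ h (pair_injective he).1, fun he => by rw [he]⟩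

theorem symm_one_ne_zero : (Φ.symm 1 : Cn (k + 1)) ≠ 0 := by
  intro h
  have h1 : Φ.symm 1 = 0 := Subtype.ext h
  have h2 : (1 : ℂ) = 0 := by simpa using congrArg Φ h1
  exact one_ne_zero h2

theorem act_SU_mul {n : ℕ} (g h : SU n) (w : Cn n) :
    act ((g * h : SU n) : Mat n) w = act (g : Mat n) (act (h : Mat n) w) :=
  act_mul (g : Mat n) (h : Mat n) w

theorem act_SU_inv {n : ℕ} (g : SU n) (w : Cn n) :
    act ((g⁻¹ : SU n) : Mat n) (act (g : Mat n) w) = w := by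
  rw [SU_coe_inv, act_star_act]

theorem act_SU_ne_zero {n : ℕ} (g : SU n) {w : Cn n} (hw : w ≠ 0) : act (g : Mat n) w ≠ 0 := by
  intro h
  exact hw (act_SU_injective g (by rw [h, act_zero_right]))

theorem act_mem_ansatzImage {g : SU (k + 2)} (hg : g ∈ ext G) {p : Cn (k + 2)}
    (hp : p ∈ ansatzImage G Φ γ ξ s₁ s₂ I₁ I₂) :
    act (g : Mat (k + 2)) p ∈ ansatzImage G Φ γ ξ s₁ s₂ I₁ I₂ := by
  obtain ⟨h, hh, rfl⟩ := hg
  obtain ⟨g', hg', x, hx, y, hy, rfl⟩ := mem_ansatzImage.1 hp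
  refine mem_ansatzImage.2 ⟨h * g', G.mul_mem hh hg', x, hx, y, hy, ?_⟩
  change _ = act (extMatrix (h : Mat (k + 1))) _
  rw [act_extMatrix_orbitMap, act_SU_mul]

/-- The image is of cohomogeneity two away from the axis. -/
theorem isCohomogeneity_ansatzImage
    (hdim : Module.finrank ℝ (orbitTangent G (Φ.symm 1 : Cn (k + 1))) = k) :
    IsCohomogeneity (ext G) 2 (ansatzImage G Φ γ ξ s₁ s₂ I₁ I₂ \ axis (k + 1)) := by
  set V : Cn (k + 1) := (Φ.symm 1 : Cn (k + 1))
  have hV0 : V ≠ 0 := symm_one_ne_zero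
  refine ⟨?_, ?_, ?_⟩
  · rintro g hg p ⟨hp, hpa⟩
    refine ⟨act_mem_ansatzImage hg hp, ?_⟩
    obtain ⟨g', hg', x, hx, y, hy, rfl⟩ := mem_ansatzImage.1 hp
    obtain ⟨h, hh, rfl⟩ := hg
    rw [orbitMap_mem_axis (act_SU_ne_zero _ hV0)] at hpa
    change act (extMatrix (h : Mat (k + 1))) _ ∉ _
    rwa [act_extMatrix_orbitMap, orbitMap_mem_axis (act_SU_ne_zero _ (act_SU_ne_zero _ hV0))]
  · rintro p ⟨hp, hpa⟩ q ⟨hq, hqa⟩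
    obtain ⟨g₁, hg₁, x₁, hx₁, y₁, hy₁, rfl⟩ := mem_ansatzImage.1 hp
    obtain ⟨g₂, hg₂, x₂, hx₂, y₂, hy₂, rfl⟩ := mem_ansatzImage.1 hq
    rw [orbitMap_mem_axis (act_SU_ne_zero _ hV0)] at hpa hqa
    -- Off the axis the stabiliser of a point is that of gV, so g₂g₁⁻¹ conjugates the stabiliser of
    -- the first point to that of the second.
    refine ⟨extHom _ (g₂ * g₁⁻¹), ⟨_, G.mul_mem hg₂ (G.inv_mem hg₁), rfl⟩, ?_⟩
    rintro _ ⟨h, hh, rfl⟩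
    rw [← map_inv, ← map_mul, ← map_mul]
    change act (extMatrix (h : Mat (k + 1))) _ = _ ↔
      act (extMatrix ((g₂ * g₁⁻¹ * h * (g₂ * g₁⁻¹)⁻¹ : SU (k + 1)) : Mat (k + 1))) _ = _
    rw [act_extMatrix_orbitMap, act_extMatrix_orbitMap, orbitMap_left_injective hpa,
      orbitMap_left_injective hqa, mul_inv_rev, inv_inv, act_SU_mul _ (g₁ * g₂⁻¹), act_SU_mul g₁,
      act_SU_inv, mul_assoc, act_SU_mul g₂, act_SU_mul g₁⁻¹]
    refine Iff.trans ?_ (act_SU_injective g₂).eq_iff.symm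
    constructor
    · intro e
      rw [e, act_SU_inv]
    · intro e
      have e' := congrArg (act (g₁ : Mat (k + 1))) e
      rwa [SU_coe_inv, act_act_star] at e'
  · rintro p ⟨hp, hpa⟩
    obtain ⟨g, hg, x, hx, y, hy, rfl⟩ := mem_ansatzImage.1 hp
    rw [orbitMap_mem_axis (act_SU_ne_zero _ hV0)] at hpa
    rw [orbitMap, finrank_orbitTangent_ext, finrank_orbitTangent_smul hpa,
      finrank_orbitTangent_act hg, hdim]

/-! ## The Liouville form on the whole parameter domain -/

/-- The identity only needs ‖V‖ = 1 and ⟨gV, XgV⟩ = 0, so zeros of γξ do no harm. -/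
theorem hasDerivAt_ansatz_liouville {ν : Fin k → Cn (k + 1)}
    (hD : AdaptedData G (Φ.symm 1 : Cn (k + 1)) ν)
    (hγ : IsRegularCurve γ I₁ s₁) (hξ : IsRegularCurve ξ I₂ s₂)
    {u : SU (k + 1) × ℝ × ℝ} (hu : u ∈ dom G I₁ I₂) {X : Mat (k + 1)} (hX : X ∈ lieAlg G) (s t : ℝ) :
    ∃ v : Cn (k + 2),
      HasDerivAt (fun τ : ℝ => ansatz Φ γ ξ s₁ s₂ (NormedSpace.exp (τ • X) * u.1)
        (u.2.1 + τ * s) (u.2.2 + τ * t)) v 0 ∧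
      HasDerivAt (fun τ : ℝ => primitive γ ξ s₁ s₂ (u.2.1 + τ * s) (u.2.2 + τ * t))
        (liouville (ansatz Φ γ ξ s₁ s₂ u.1 u.2.1 u.2.2) v) 0 := by
  obtain ⟨hg, hx, hy⟩ := hu
  have dlin : ∀ x r : ℝ, HasDerivAt (fun τ : ℝ => x + τ * r) r 0 := fun x r => by
    simpa using ((hasDerivAt_id (0 : ℝ)).mul_const r).const_add x
  have dw := hasDerivAt_act_exp X (u.1 : Mat (k + 1)) (Φ.symm 1 : Cn (k + 1)) 0
  have hx' : u.2.1 + 0 * s ∈ I₁ := by simpa using hx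
  have hy' : u.2.2 + 0 * t ∈ I₂ := by simpa using hy
  have h1 := hasDerivAt_orbitMap hγ hξ dw (dlin u.2.1 s) (dlin u.2.2 t) hx' hy'
  have h2 := hasDerivAt_primitive hγ hξ (dlin u.2.1 s) (dlin u.2.2 t) hx' hy'
  simp only [ansatz_eq]
  refine ⟨_, h1, ?_⟩
  simp only [zero_mul, add_zero, zero_smul, NormedSpace.exp_zero, one_mul] at h2 ⊢
  rw [liouville_orbitMap]
  · exact h2
  · rw [norm_act (star_mul_self_of_SU u.1), hD.norm_eq]
  · exact inner_self_act (act_mem_zeroLevel hD.mem hg) hX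

/-! ## The immersion -/

/-- The parameters at which the Ansatz avoids the axis. -/
def regularParams (γ ξ : ℝ → ℂ) (I₁ I₂ : Set ℝ) : Set (ℝ × ℝ) :=
  {p | p.1 ∈ I₁ ∧ p.2 ∈ I₂ ∧ γ p.1 * ξ p.2 ≠ 0}

theorem isOpen_regularParams (hγ : IsRegularCurve γ I₁ s₁) (hξ : IsRegularCurve ξ I₂ s₂) :
    IsOpen (regularParams γ ξ I₁ I₂) := by
  have h1 : ContinuousOn (fun p : ℝ × ℝ => γ p.1 * ξ p.2) (I₁ ×ˢ I₂) :=
    (hγ.contDiffOn.continuousOn.comp continuousOn_fst fun p hp => hp.1).mul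
      (hξ.contDiffOn.continuousOn.comp continuousOn_snd fun p hp => hp.2)
  have h2 := h1.isOpen_inter_preimage (hγ.isOpen.prod hξ.isOpen) isOpen_compl_singleton (t := {0}ᶜ)
  convert h2 using 1
  ext p
  simp [regularParams, and_assoc]

/-- The product of the orbit of `V` with the parameters at which the Ansatz avoids the axis. -/
abbrev regularOrbit (G : Subgroup (SU (k + 1))) (V : Cn (k + 1)) (γ ξ : ℝ → ℂ) (I₁ I₂ : Set ℝ) :
    Set (Cn (k + 1) × ℝ × ℝ) :=
  orbit G V ×ˢ regularParams γ ξ I₁ I₂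

theorem profileMap_snd_im (γ ξ : ℝ → ℂ) (s₁ s₂ x y : ℝ) :
    (profileMap γ ξ s₁ s₂ x y).2.im = beta ξ s₂ y - beta γ s₁ x := by
  simp only [profileMap, Complex.add_im, Complex.ofReal_im, Complex.I_mul_im, Complex.ofReal_re,
    zero_add]

/-- The Lagrangian immersion, its Liouville primitive and its Lagrangian angle. -/
theorem exists_immersion (hG : IsCompact (G : Set (SU (k + 1)))) {V : Cn (k + 1)}
    {ν : Fin k → Cn (k + 1)} (hD : AdaptedData G V ν)
    (hγ : IsRegularCurve γ I₁ s₁) (hξ : IsRegularCurve ξ I₂ s₂) :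
    ∃ _ : ChartedSpace (EuclideanSpace ℝ (Fin (k + 2))) (regularOrbit G V γ ξ I₁ I₂),
      IsManifold 𝓘(ℝ, EuclideanSpace ℝ (Fin (k + 2))) ∞ (regularOrbit G V γ ξ I₁ I₂) ∧
      IsLagrangianImmersion (fun p : regularOrbit G V γ ξ I₁ I₂ => orbitMap γ ξ s₁ s₂ p.1) ∧
      IsLiouvillePrimitive (fun p : regularOrbit G V γ ξ I₁ I₂ => orbitMap γ ξ s₁ s₂ p.1)
        (fun p => primitive γ ξ s₁ s₂ p.1.2.1 p.1.2.2) ∧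
      ∀ a b : ℝ, IsSolitonCurve k a γ I₁ → IsSolitonCurve k b ξ I₂ → b = -a →
        ∃ c : ℝ, ∀ p : regularOrbit G V γ ξ I₁ I₂,
          HasLagrangianAngle
            (tangentPlane (fun p : regularOrbit G V γ ξ I₁ I₂ => orbitMap γ ξ s₁ s₂ p.1) p)
            (-inner ℝ (orbitMap γ ξ s₁ s₂ p.1) (Complex.I • ((-a) • lastVec (k + 1))) + c) := by
  obtain ⟨inst, hM, hder⟩ := exists_chartedSpace_orbit hG
    (orthonormal_real_of_complex hD.orthonormal) hD.span_eq (isOpen_regularParams hγ hξ)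
  refine ⟨inst, hM, ?_⟩
  have dlin : ∀ x r : ℝ, HasDerivAt (fun τ : ℝ => x + τ * r) r 0 := fun x r => by
    simpa using ((hasDerivAt_id (0 : ℝ)).mul_const r).const_add x
  obtain ⟨hιs, hιd⟩ := hder (Cn (k + 2)) (orbitMap γ ξ s₁ s₂)
    fun p hp => contDiffAt_orbitMap hγ hξ hp.2.1 hp.2.2.1
  obtain ⟨hhs, hhd⟩ := hder ℝ (fun p => primitive γ ξ s₁ s₂ p.2.1 p.2.2)
    fun p hp => contDiffAt_primitive hγ hξ hp.2.1 hp.2.2.1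
  set ι : regularOrbit G V γ ξ I₁ I₂ → Cn (k + 2) := fun p => orbitMap γ ξ s₁ s₂ p.1 with hι
  have hdι : ∀ p : regularOrbit G V γ ξ I₁ I₂, ∃ g ∈ G, act (g : Mat (k + 1)) V = p.1.1 ∧
      ∀ v : EuclideanSpace ℝ (Fin (k + 2)), dmap ι p v =
        pair ((γ p.1.2.1 * ξ p.1.2.2) •
          ∑ i : Fin k, v i.castSucc.castSucc • act (g : Mat (k + 1)) (ν i)) 0 +
        v (Fin.last k).castSucc • pair ((deriv γ p.1.2.1 * ξ p.1.2.2) • act (g : Mat (k + 1)) V)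
          (-(conj (γ p.1.2.1) * deriv γ p.1.2.1)) +
        v (Fin.last (k + 1)) • pair ((γ p.1.2.1 * deriv ξ p.1.2.2) • act (g : Mat (k + 1)) V)
          (conj (ξ p.1.2.2) * deriv ξ p.1.2.2) := by
    intro p
    obtain ⟨g, hg, hgV, h⟩ := hιd p
    refine ⟨g, hg, hgV, fun v => ?_⟩
    obtain ⟨w, hw0, hw, hd⟩ := h v
    have h1 := hasDerivAt_orbitMap hγ hξ hw (dlin p.1.2.1 (v (Fin.last k).castSucc))
      (dlin p.1.2.2 (v (Fin.last (k + 1)))) (by simpa using p.2.2.1) (by simpa using p.2.2.2.1)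
      (s₁ := s₁) (s₂ := s₂)
    have h2 := hd.unique h1
    simp only [zero_mul, add_zero, hw0] at h2
    rw [hgV]
    exact h2
  have hframe : ∀ p : regularOrbit G V γ ξ I₁ I₂, ∃ e : Fin (k + 2) → Cn (k + 2), Orthonormal ℂ e ∧
      holVol e ^ 2 = ((γ p.1.2.1 / conj (γ p.1.2.1)) ^ k *
        (deriv γ p.1.2.1 / conj (deriv γ p.1.2.1))) *
        ((ξ p.1.2.2 / conj (ξ p.1.2.2)) ^ k * (deriv ξ p.1.2.2 / conj (deriv ξ p.1.2.2))) ∧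
      Function.Injective (dmap ι p) ∧ (∀ u v, kaehler (dmap ι p u) (dmap ι p v) = 0) ∧
      Submodule.span ℝ (Set.range e) = tangentPlane ι p := by
    intro p
    obtain ⟨g, hg, hgV, h⟩ := hdι p
    obtain ⟨e, r, he, hr, hvol, hsum⟩ := exists_unitary_frame hD (g := g)
      (left_ne_zero_of_mul p.2.2.2.2) (right_ne_zero_of_mul p.2.2.2.2)
      (hγ.deriv_ne_zero _ p.2.2.1) (hξ.deriv_ne_zero _ p.2.2.2.1)
    exact ⟨e, he, hvol, lagrangian_of_unitary_frame he hr fun v => by rw [h v, hsum v]⟩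
  refine ⟨⟨hιs, fun p => ?_, fun p => ?_⟩, ⟨hhs, fun p v => ?_⟩, ?_⟩
  · obtain ⟨e, -, -, h, -⟩ := hframe p
    exact h
  · obtain ⟨e, -, -, -, h, -⟩ := hframe p
    exact h
  · obtain ⟨g, hg, hgV, h⟩ := hdι p
    obtain ⟨g', -, -, h'⟩ := hhd p
    obtain ⟨w, hw0, hw, hd⟩ := h' v
    have h1 := hasDerivAt_primitive hγ hξ (dlin p.1.2.1 (v (Fin.last k).castSucc))
      (dlin p.1.2.2 (v (Fin.last (k + 1)))) (by simpa using p.2.2.1) (by simpa using p.2.2.2.1)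
    have h2 := hd.unique h1
    simp only [zero_mul, add_zero] at h2
    refine Eq.trans ?_ h2.symm
    rw [h v, hgV]
    refine liouville_orbitMap ?_ ?_
    · rw [← hgV, norm_act (star_mul_self_of_SU g), hD.norm_eq]
    · rw [inner_sum]
      refine Finset.sum_eq_zero fun i _ => ?_
      rw [← Complex.coe_smul, inner_smul_right, ← hgV, inner_act_act (star_mul_self_of_SU g),
        ← inner_conj_symm, hD.inner_eq]
      simp
  · rintro a b ha hb rfl
    obtain ⟨τ₁, h₁⟩ := ha.exists_angle hγ.isOpen hγ.ordConnected hγ.mem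
    obtain ⟨τ₂, h₂⟩ := hb.exists_angle hξ.isOpen hξ.ordConnected hξ.mem
    refine ⟨τ₁ + τ₂, fun p => ?_⟩
    obtain ⟨e, he, hvol, -, -, hspan⟩ := hframe p
    refine HasLagrangianAngle.of_sq (orthonormal_real_of_complex he) hspan ?_
    rw [hvol, h₁ _ p.2.2.1 (left_ne_zero_of_mul p.2.2.2.2),
      h₂ _ p.2.2.2.1 (right_ne_zero_of_mul p.2.2.2.2), ← Complex.exp_add]
    -- The imaginary part of the last coordinate is β_ξ − β_γ; with b = −a it is exactly the
    -- combination in which the two angle functions enter.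
    have h3 : inner ℝ (orbitMap γ ξ s₁ s₂ p.1) (Complex.I • ((-a) • lastVec (k + 1))) =
        -a * (beta ξ s₂ p.1.2.2 - beta γ s₁ p.1.2.1) := by
      rw [real_inner_eq_re, ← Complex.coe_smul, inner_smul_right, inner_smul_right, orbitMap,
        lastVec, inner_pair]
      simp [profileMap_snd_im]
      ring
    rw [h3]
    congr 1
    push_cast
    ring

end CohomTwo

end

/-! ### Assembly of the theorem -/

open CohomTwo in
theorem theorem5 (k : ℕ) (G : Subgroup (SU (k + 1)))
    (hGcompact : IsCompact (G : Set (SU (k + 1))))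
    (hGconn : IsConnected (G : Set (SU (k + 1))))
    (Z : Set (Cn (k + 1)))
    (hZ : ∃ p ∈ zeroLevel G, Z = connectedComponentIn (zeroLevel G) p)
    (hL : ∃ L ⊆ Z, L.Nonempty ∧ IsImmersedLagrangian L ∧ IsCohomogeneity G 1 L)
    (z' : Cn (k + 1)) (hz'Z : z' ∈ Z) (hz' : z' ≠ 0) :
    -- the isomorphism `Φ` exists
    (∃ Φ : (Submodule.span ℂ {z'}) ≃ₗ[ℂ] ℂ, IsAdapted G z' Φ) ∧
    ∀ Φ : (Submodule.span ℂ {z'}) ≃ₗ[ℂ] ℂ, IsAdapted G z' Φ →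
    ∀ I₁ I₂ : Set ℝ, IsOpen I₁ → I₁.OrdConnected → IsOpen I₂ → I₂.OrdConnected →
    ∀ s₁ ∈ I₁, ∀ s₂ ∈ I₂, ∀ (γ ξ : ℝ → ℂ) (a b : ℝ),
    IsSolitonCurve k a γ I₁ → IsSolitonCurve k b ξ I₂ →
      -- `L` is `G`-invariant, and of cohomogeneity two away from `{0} × ℂ`
      (∀ g ∈ ext G, ∀ p ∈ ansatzImage G Φ γ ξ s₁ s₂ I₁ I₂,
        act (g : Matrix (Fin (k + 2)) (Fin (k + 2)) ℂ) p ∈ ansatzImage G Φ γ ξ s₁ s₂ I₁ I₂) ∧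
      IsCohomogeneity (ext G) 2 (ansatzImage G Φ γ ξ s₁ s₂ I₁ I₂ \ axis (k + 1)) ∧
      -- `F^* λ = d(primitive)` on all of `G × I₁ × I₂`, tested on the tangent vector `(X, s, t)`
      (∀ u ∈ dom G I₁ I₂, ∀ X ∈ lieAlg G, ∀ s t : ℝ, ∃ v : Cn (k + 2),
        HasDerivAt (fun τ : ℝ => ansatz Φ γ ξ s₁ s₂ (NormedSpace.exp (τ • X) * u.1)
          (u.2.1 + τ * s) (u.2.2 + τ * t)) v 0 ∧
        HasDerivAt (fun τ : ℝ => primitive γ ξ s₁ s₂ (u.2.1 + τ * s) (u.2.2 + τ * t))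
          (liouville (ansatz Φ γ ξ s₁ s₂ u.1 u.2.1 u.2.2) v) 0) ∧
      -- away from `{0} × ℂ`, `L` is immersed: `F` descends to a Lagrangian immersion `ι` of a
      -- manifold `M`, the quotient by `Stab z'` of the part of the domain off the preimage of the axis
      ∃ (M : Type) (_ : TopologicalSpace M)
        (_ : ChartedSpace (EuclideanSpace ℝ (Fin (k + 2))) M)
        (ι : M → Cn (k + 2)) (q : regularDom G Φ γ ξ s₁ s₂ I₁ I₂ → M) (h : M → ℝ),
        T2Space M ∧ SecondCountableTopology M ∧
        IsManifold 𝓘(ℝ, EuclideanSpace ℝ (Fin (k + 2))) ∞ M ∧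
        IsLagrangianImmersion ι ∧
        Set.range ι = ansatzImage G Φ γ ξ s₁ s₂ I₁ I₂ \ axis (k + 1) ∧
        Continuous q ∧ Function.Surjective q ∧
        (∀ u, ι (q u) = ansatz Φ γ ξ s₁ s₂ u.1.1 u.1.2.1 u.1.2.2) ∧
        (∀ u u', q u = q u' ↔ u.1.2 = u'.1.2 ∧
          act (u.1.1 : Matrix (Fin (k + 1)) (Fin (k + 1)) ℂ) z' =
            act (u'.1.1 : Matrix (Fin (k + 1)) (Fin (k + 1)) ℂ) z') ∧
        -- it is exact, with the same primitive
        IsLiouvillePrimitive ι h ∧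
        (∀ u, h (q u) = primitive γ ξ s₁ s₂ u.1.2.1 u.1.2.2) ∧
        -- special Lagrangians and translators
        (a = 0 → b = 0 → IsSpecialLagrangian ι) ∧
        (b = -a → IsLagrangianTranslator ι ((-a) • lastVec (k + 1))) := by
  have hzero : Z ⊆ zeroLevel G := by
    obtain ⟨p, -, rfl⟩ := hZ
    exact connectedComponentIn_subset _ _
  have hz'zero := hzero hz'Z
  obtain ⟨L, hLZ, ⟨p₀, hp₀⟩, -, hLcoh⟩ := hL
  -- One point of the given Lagrangian suffices: cohomogeneity one in ℂ^(k+1) means orbit dimension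
  -- k.
  have hdim : ∀ z ∈ zeroLevel G, z ≠ 0 → Module.finrank ℝ (orbitTangent G z) = k := fun z hz hz0 =>
    finrank_orbitTangent_of_mem_zeroLevel hGcompact hz (hzero (hLZ hp₀)) hz0
      (Nat.succ_injective (hLcoh.2.2 p₀ hp₀))
  refine ⟨exists_isAdapted hGcompact hz'zero hz' (hdim z' hz'zero hz'), ?_⟩
  intro Φ hΦ I₁ I₂ hI₁ hI₁' hI₂ hI₂' s₁ hs₁ s₂ hs₂ γ ξ a b hγs hξs
  obtain ⟨ν, hD⟩ := hΦ.exists_data hGcompact hz'zero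
  have hγ : IsRegularCurve γ I₁ s₁ := ⟨hI₁, hI₁', hs₁, hγs.1, hγs.2.1⟩
  have hξ : IsRegularCurve ξ I₂ s₂ := ⟨hI₂, hI₂', hs₂, hξs.1, hξs.2.1⟩
  have hV0 : (Φ.symm 1 : Cn (k + 1)) ≠ 0 := symm_one_ne_zero
  -- V = c₀z' with c₀ ≠ 0, so gV = g₁V exactly when gz' = g₁z'.
  obtain ⟨c₀, hc₀⟩ := Submodule.mem_span_singleton.1 (Φ.symm 1).2
  have hc₀0 : c₀ ≠ 0 := by
    rintro rfl
    rw [zero_smul] at hc₀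
    exact hV0 hc₀.symm
  refine ⟨fun g hg p hp => act_mem_ansatzImage hg hp,
    isCohomogeneity_ansatzImage (hdim _ hD.mem hV0),
    fun u hu X hX s t => hasDerivAt_ansatz_liouville hD hγ hξ hu hX s t, ?_⟩
  obtain ⟨inst, hM, hι, hh, hang⟩ := exists_immersion (s₁ := s₁) (s₂ := s₂) hGcompact hD hγ hξ
  have hreg : ∀ u ∈ regularDom G Φ γ ξ s₁ s₂ I₁ I₂,
      ((act (u.1 : Matrix (Fin (k + 1)) (Fin (k + 1)) ℂ) (Φ.symm 1 : Cn (k + 1)), u.2) :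
        Cn (k + 1) × ℝ × ℝ) ∈ regularOrbit G (Φ.symm 1 : Cn (k + 1)) γ ξ I₁ I₂ := by
    rintro ⟨g, x, y⟩ ⟨⟨hg, hx, hy⟩, hu⟩
    rw [ansatz_eq, orbitMap_mem_axis (act_SU_ne_zero g hV0)] at hu
    exact ⟨⟨g, hg, rfl⟩, hx, hy, hu⟩
  have hreg' : ∀ g ∈ G, ∀ q ∈ regularParams γ ξ I₁ I₂,
      ((g, q) : SU (k + 1) × ℝ × ℝ) ∈ regularDom G Φ γ ξ s₁ s₂ I₁ I₂ := by
    rintro g hg ⟨x, y⟩ ⟨hx, hy, hxy⟩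
    refine ⟨⟨hg, hx, hy⟩, ?_⟩
    rw [ansatz_eq, orbitMap_mem_axis (act_SU_ne_zero g hV0)]
    exact hxy
  have htrans : b = -a → IsLagrangianTranslator (fun p : regularOrbit G (Φ.symm 1 : Cn (k + 1)) γ ξ I₁ I₂ => orbitMap γ ξ s₁ s₂ p.1)
      ((-a) • lastVec (k + 1)) := by
    intro hab
    obtain ⟨c, hc⟩ := hang a b hγs hξs hab
    exact isLagrangianTranslator_of_angle hι hc
  -- The quotient is realised concretely as the orbit of V times the regular parameters, with
  -- quotient map (g, x, y) ↦ (gV, x, y).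
  refine ⟨_, inferInstance, inst, _, fun u => ⟨_, hreg u.1 u.2⟩, _, inferInstance, inferInstance,
    hM, hι, ?_, ?_, ?_, ?_, ?_, hh, fun u => rfl, ?_, htrans⟩
  · apply Set.Subset.antisymm
    · rintro _ ⟨⟨⟨w, x, y⟩, ⟨g, hg, hw⟩, hx, hy, hxy⟩, rfl⟩
      dsimp only at hw hx hy hxy ⊢
      subst hw
      refine ⟨mem_ansatzImage.2 ⟨g, hg, x, hx, y, hy, rfl⟩, ?_⟩
      rw [orbitMap_mem_axis (act_SU_ne_zero g hV0)]
      exact hxy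
    · rintro _ ⟨hp, hpa⟩
      obtain ⟨g, hg, x, hx, y, hy, rfl⟩ := mem_ansatzImage.1 hp
      rw [orbitMap_mem_axis (act_SU_ne_zero g hV0)] at hpa
      exact ⟨⟨_, ⟨g, hg, rfl⟩, hx, hy, hpa⟩, rfl⟩
  · refine Continuous.subtype_mk ?_ _
    refine Continuous.prodMk ?_ (continuous_snd.comp continuous_subtype_val)
    exact ((orbitMapL (Φ.symm 1 : Cn (k + 1))).continuous.comp continuous_subtype_val).comp
      (continuous_fst.comp continuous_subtype_val)
  · rintro ⟨⟨w, q⟩, ⟨g, hg, hw⟩, hq⟩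
    exact ⟨⟨(g, q), hreg' g hg q hq⟩, Subtype.ext (Prod.ext hw rfl)⟩
  · intro u
    exact (ansatz_eq Φ γ ξ s₁ s₂ _ _ _).symm
  · intro u u'
    rw [Subtype.mk.injEq, Prod.mk.injEq, and_comm, ← hc₀, act_smul_right, act_smul_right]
    exact and_congr_right fun _ => (smul_right_injective _ hc₀0).eq_iff
  · rintro rfl rfl
    have h := htrans neg_zero.symm
    rw [neg_zero, zero_smul] at h
    exact h.isSpecialLagrangian
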